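/- Let $n\ge 3$ and $0<\mu<1/2$. There is a constant $C_1>0$ depending only on $n$ and $\mu$ such that the following holds for every $T>0$. Write $x^0=t$, $\partial_0=\partial_t$, $\partial_a=\partial/\partial x^a$ $(1\le a\le n)$, $r=|x|$, $\langle r\rangle=(1+r^2)^{1/2}$, $|\partial\phi|=\bigl(\sum_{\alpha=0}^n(\partial_\alpha\phi)^2\bigr)^{1/2}$, $|h|=\bigl(\sum_{\alpha,\beta=0}^n(h^{\alpha\beta})^2\bigr)^{1/2}$, $|\partial h|=\bigl(\sum_{\alpha,\beta,\gamma=0}^n(\partial_\gamma h^{\alpha\beta})^2\bigr)^{1/2}$, and $S_T=(0,T)\times\mathbb R^n$. Let $h^{\alpha\beta}\in C^1([0,T]\times\mathbb R^n)$ $(\alpha,\beta=0,\dots,n)$ be real functions, bounded together with their first derivatives, with $$\sum_{\alpha,\beta=0}^n|h^{\alpha\beta}(t,x)|\le\tfrac12,\qquad h^{\alpha\beta}(t,x)=h^{\beta\alpha}(t,x)\qquad\text{on }[0,T]\times\mathbb R^n .$$ Let $\phi\in C^2([0,T]\times\mathbb R^n)$ be a real solution of $$\partial_t^2\phi-\Delta\phi+\sum_{\alpha,\beta=0}^n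 h^{\alpha\beta}\partial_\alpha\partial_\beta\phi=F\ \text{ in }S_T,\qquad \phi(0,\cdot)=f\in H^1(\mathbb R^n),\quad \partial_t\phi(0,\cdot)=g\in L^2(\mathbb R^n),$$ such that $\phi\in C^0([0,T];H^1(\mathbb R^n))\cap C^1([0,T];L^2(\mathbb R^n))$ and $$|\partial\phi||F|+\frac{|\phi||F|}{r^{1-2\mu}\langle r\rangle^{2\mu}}\in L^1(S_T).$$ Then $$\begin{aligned} &(1+T)^{-2\mu}\Bigl(\|r^{-3/2+\mu}\phi\|^2_{L^2(S_T)}+\|r^{-1/2+\mu}\partial\phi\|^2_{L^2(S_T)}\Bigr)\\ &\quad+\bigl(\log(2+T)\bigr)^{-1}\Bigl(\|r^{-3/2+\mu}\langle r\rangle^{-\mu}\phi\|^2_{L^2(S_T)}+\|r^{-1/2+\mu}\langle r\rangle^{-\mu}\partial\phi\|^2_{L^2(S_T)}\Bigr)\\ &\le C_1\bigl(\|\nabla f\|^2_{L^2(\mathbb R^n)}+\|g\|^2_{L^2(\mathbb R^n)}\bigr) +C_1\int_0^T\!\!\int_{\mathbb R^n}\Bigl(|\partial\phi||F|+\frac{|\phi||F|}{r^{1-2\mu}\langle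 r\rangle^{2\mu}}+|\partial h||\partial\phi|^2\\ &\qquad\qquad+\frac{|\partial h||\phi\,\partial\phi|}{r^{1-2\mu}\langle r\rangle^{2\mu}}+\frac{|h||\partial\phi|^2}{r^{1-2\mu}\langle r\rangle^{2\mu}}+\frac{|h||\phi\,\partial\phi|}{r^{2-2\mu}\langle r\rangle^{2\mu}}\Bigr)\,dx\,dt . \end{aligned}$$ -/

import Mathlib

open MeasureTheory Set
open scoped ContDiff ENNReal

noncomputable section

namespace KSSWave

/-- The space `ℝⁿ` with its Euclidean norm. -/
abbrev Space (n : ℕ) : Type := EuclideanSpace ℝ (Fin n)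

/-- Space-time: a point is a pair `(t, x)`. -/
abbrev SpaceTime (n : ℕ) : Type := ℝ × Space n

/-- The unit vector of `ℝⁿ` in the direction `a`. -/
def spaceBasis {n : ℕ} (a : Fin n) : Space n := EuclideanSpace.single a (1 : ℝ)

/-- The coordinate vectors of space-time: index `0` is time, index `a.succ` is the `a`-th
space direction. -/
def stBasis {n : ℕ} (α : Fin (n + 1)) : SpaceTime n :=
  Fin.cases ((1, 0) : SpaceTime n) (fun a => (0, spaceBasis a)) α

/-- The closed slab `[0,T] × ℝⁿ`. -/
def closedSlab (n : ℕ) (T : ℝ) : Set (SpaceTime n) := Icc 0 T ×ˢ univ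

/-- The open slab `(0,T) × ℝⁿ`. -/
def openSlab (n : ℕ) (T : ℝ) : Set (SpaceTime n) := Ioo 0 T ×ˢ univ

/-- The partial derivative `∂_α u` on the closed slab `[0,T] × ℝⁿ` (the time derivative is
one-sided at `t = 0` and `t = T`; in the open slab this is the usual partial derivative). -/
def pd {n : ℕ} (T : ℝ) (α : Fin (n + 1)) (u : SpaceTime n → ℝ) (z : SpaceTime n) : ℝ :=
  fderivWithin ℝ u (closedSlab n T) z (stBasis α)

/-- `|∂φ| = ((∂_t φ)² + (∂_1 φ)² + ⋯ + (∂_n φ)²)^{1/2}`. -/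
def normD {n : ℕ} (T : ℝ) (φ : SpaceTime n → ℝ) (z : SpaceTime n) : ℝ :=
  Real.sqrt (∑ α, (pd T α φ z) ^ 2)

/-- `|h|`, the Euclidean norm of all the coefficients `h^{αβ}`. -/
def normH {n : ℕ} (h : Fin (n + 1) → Fin (n + 1) → SpaceTime n → ℝ) (z : SpaceTime n) : ℝ :=
  Real.sqrt (∑ α, ∑ β, (h α β z) ^ 2)

/-- `|∂h|`, the Euclidean norm of all the first derivatives `∂_γ h^{αβ}`. -/
def normDH {n : ℕ} (T : ℝ) (h : Fin (n + 1) → Fin (n + 1) → SpaceTime n → ℝ)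
    (z : SpaceTime n) : ℝ :=
  Real.sqrt (∑ γ, ∑ α, ∑ β, (pd T γ (h α β) z) ^ 2)

/-- `r = |x|` at the space-time point `(t, x)`. -/
def rad {n : ℕ} (z : SpaceTime n) : ℝ := ‖z.2‖

/-- `⟨r⟩ = (1 + |x|²)^{1/2}` at the space-time point `(t, x)`. -/
def jap {n : ℕ} (z : SpaceTime n) : ℝ := Real.sqrt (1 + ‖z.2‖ ^ 2)

/-- The left-hand side `∂_t² φ - Δ φ + h^{αβ} ∂_α ∂_β φ` of the equation. -/
def waveOp {n : ℕ} (T : ℝ) (h : Fin (n + 1) → Fin (n + 1) → SpaceTime n → ℝ)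
    (φ : SpaceTime n → ℝ) (z : SpaceTime n) : ℝ :=
  pd T 0 (pd T 0 φ) z - ∑ a : Fin n, pd T a.succ (pd T a.succ φ) z
    + ∑ α, ∑ β, h α β z * pd T α (pd T β φ) z

/-- `v` is the weak partial derivative `∂_a u` on `ℝⁿ` (used for `u, v ∈ L²`). -/
def IsWeakPartial {n : ℕ} (a : Fin n) (u v : Space n → ℝ) : Prop :=
  ∀ η : Space n → ℝ, ContDiff ℝ ∞ η → HasCompactSupport η →
    ∫ x, u x * fderiv ℝ η x (spaceBasis a) = - ∫ x, v x * η x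

/-- `u ∈ H¹(ℝⁿ)`: `u` and its weak first derivatives are in `L²`. -/
def MemH1 {n : ℕ} (u : Space n → ℝ) : Prop :=
  MemLp u 2 volume ∧ ∀ a : Fin n, ∃ v : Space n → ℝ, MemLp v 2 volume ∧ IsWeakPartial a u v

/-- `L²(ℝⁿ)`. -/
abbrev L2 (n : ℕ) : Type := Lp ℝ 2 (volume : Measure (Space n))

/-- `φ ∈ C⁰([0,T]; H¹(ℝⁿ))`: the map `t ↦ φ(t,·)` and the maps `t ↦ ∂_a φ(t,·)` given by the
weak derivatives are continuous from `[0,T]` to `L²(ℝⁿ)`. -/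
def ContinuousInH1 {n : ℕ} (T : ℝ) (φ : SpaceTime n → ℝ) : Prop :=
  ∃ (U : ℝ → L2 n) (V : Fin n → ℝ → L2 n),
    ContinuousOn U (Icc 0 T) ∧ (∀ a, ContinuousOn (V a) (Icc 0 T)) ∧
    ∀ t ∈ Icc (0 : ℝ) T,
      (U t =ᵐ[volume] fun x => φ (t, x)) ∧ ∀ a, IsWeakPartial a (U t) (V a t)

/-- `φ ∈ C¹([0,T]; L²(ℝⁿ))`: the map `t ↦ φ(t,·)` is continuously differentiable from `[0,T]`
to `L²(ℝⁿ)`. -/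
def ContDiffInL2 {n : ℕ} (T : ℝ) (φ : SpaceTime n → ℝ) : Prop :=
  ∃ U : ℝ → L2 n, ContDiffOn ℝ 1 U (Icc 0 T) ∧
    ∀ t ∈ Icc (0 : ℝ) T, U t =ᵐ[volume] fun x => φ (t, x)

/-- The squared norm `‖w‖²` in `L²((0,T) × ℝⁿ)`, possibly infinite. -/
def sqNormSlab {n : ℕ} (T : ℝ) (w : SpaceTime n → ℝ) : ℝ≥0∞ :=
  (eLpNorm w 2 (volume.restrict (openSlab n T))) ^ 2

/-- `|∂φ| |F| + |φ| |F| / (r^{1-2μ} ⟨r⟩^{2μ})`. -/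
def forcing {n : ℕ} (T μ : ℝ) (φ F : SpaceTime n → ℝ) (z : SpaceTime n) : ℝ :=
  normD T φ z * |F z| + |φ z| * |F z| / (rad z ^ (1 - 2 * μ) * jap z ^ (2 * μ))

/-- The terms of the estimate that contain `h` and `∂h`. -/
def perturbation {n : ℕ} (T μ : ℝ) (h : Fin (n + 1) → Fin (n + 1) → SpaceTime n → ℝ)
    (φ : SpaceTime n → ℝ) (z : SpaceTime n) : ℝ :=
  normDH T h z * normD T φ z ^ 2
    + normDH T h z * (|φ z| * normD T φ z) / (rad z ^ (1 - 2 * μ) * jap z ^ (2 * μ))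
    + normH h z * normD T φ z ^ 2 / (rad z ^ (1 - 2 * μ) * jap z ^ (2 * μ))
    + normH h z * (|φ z| * normD T φ z) / (rad z ^ (2 - 2 * μ) * jap z ^ (2 * μ))

end KSSWave

end

/-!
# Weighted space-time estimates for perturbed wave equations

The estimate follows from one application of the multiplier method for every scale `R ≥ 1`.
With `p(σ) = σ^{μ-1/2} (R² + σ)^{-μ}` and `p = p(r²)`, the equation is multiplied by

  `K φ = 28 n ∂_t φ + p x·∇φ + (n-1)/2 p φ`.

The function `r p(r²) = (r² / (R² + r²))^μ` is bounded and increasing, and `p` is superharmonic for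
`n ≥ 3`. In `sum_pd_current` the product `K φ · (□φ + h^{αβ} ∂_α ∂_β φ)` is a divergence minus
quadratic terms; by `flatBulk_le` those without `h` have a sign and control
`R² p / (R² + r²) · (|∂φ|² + φ² / r²)`, and by `abs_pertBulk_le` those with `h` or `∂h` are bounded by
the last four integrands of the right-hand side, because `p ≤ r^{2μ-1} ⟨r⟩^{-2μ}`. The time
component of the current is comparable to the energy density (`abs_current_zero_sub_le`): the
coefficient `28 n`, the smallness of `h` and Hardy's inequality (`hardy`) absorb what is not
positive. The result is `WaveSolution.energy_morawetz`, a bound uniform in `R` and in time.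

Two points need care. The profile is singular at the origin, so `r²` is replaced by `δ + r²`, and
Fatou's lemma removes `δ` at the end (`WaveSolution.lintegral_bulk_le`). Second derivatives of `φ`
need not be integrable, so that the divergence cannot be integrated over space directly:
`integral_le_of_divergence_le` uses spatial cutoffs and needs integrability of the current only,
which comes from `φ ∈ C⁰([0,T]; H¹) ∩ C¹([0,T]; L²)` once the weak derivatives are identified with
the classical ones (`exists_bound_integral_sq`).

The two norms on the left are then read off (`weighted_norms_le`). In `r ≤ 1 + T` the first one is
the scale `R = 1 + T`; for the second one the shells `2^k ≤ r ≤ 2^{k+1}` up to `1 + T` are each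
bounded by the scale `R = 2^k`, and their number is `O(log (2 + T))`. In `r ≥ 1 + T` both weights are
at most `1 / (1 + T)`, and the energy bound with Hardy's inequality, integrated over `[0,T]`,
suffices.
-/

noncomputable section

namespace KSSWave

/-! ### Partial derivatives on the closed slab -/

theorem uniqueDiffOn_closedSlab (n : ℕ) {T : ℝ} (hT : 0 < T) :
    UniqueDiffOn ℝ (closedSlab n T) :=
  (uniqueDiffOn_Icc hT).prod uniqueDiffOn_univ

theorem openSlab_subset_closedSlab (n : ℕ) (T : ℝ) : openSlab n T ⊆ closedSlab n T :=
  prod_mono Ioo_subset_Icc_self subset_rfl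

theorem isOpen_openSlab (n : ℕ) (T : ℝ) : IsOpen (openSlab n T) := isOpen_Ioo.prod isOpen_univ

theorem measurableSet_openSlab (n : ℕ) (T : ℝ) : MeasurableSet (openSlab n T) :=
  (isOpen_openSlab n T).measurableSet

theorem closedSlab_mem_nhds {n : ℕ} {T : ℝ} {z : SpaceTime n} (hz : z ∈ openSlab n T) :
    closedSlab n T ∈ nhds z :=
  Filter.mem_of_superset ((isOpen_openSlab n T).mem_nhds hz) (openSlab_subset_closedSlab n T)

theorem openSlab_mono (n : ℕ) {t T : ℝ} (h : t ≤ T) : openSlab n t ⊆ openSlab n T :=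
  prod_mono (Ioo_subset_Ioo_right h) subset_rfl

theorem contDiffOn_pd {n : ℕ} {T : ℝ} (hT : 0 < T) {u : SpaceTime n → ℝ}
    (hu : ContDiffOn ℝ 2 u (closedSlab n T)) (α : Fin (n + 1)) :
    ContDiffOn ℝ 1 (pd T α u) (closedSlab n T) :=
  (hu.fderivWithin (uniqueDiffOn_closedSlab n hT) (by norm_num)).clm_apply contDiffOn_const

theorem continuousOn_pd {n : ℕ} {T : ℝ} (hT : 0 < T) {u : SpaceTime n → ℝ}
    (hu : ContDiffOn ℝ 1 u (closedSlab n T)) (α : Fin (n + 1)) :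
    ContinuousOn (pd T α u) (closedSlab n T) :=
  (hu.continuousOn_fderivWithin (uniqueDiffOn_closedSlab n hT) le_rfl).clm_apply
    continuousOn_const

theorem pd_eq_fderiv {n : ℕ} {T : ℝ} {z : SpaceTime n} (hz : z ∈ openSlab n T)
    (u : SpaceTime n → ℝ) (α : Fin (n + 1)) : pd T α u z = fderiv ℝ u z (stBasis α) := by
  rw [pd, fderivWithin_of_mem_nhds (closedSlab_mem_nhds hz)]

theorem differentiableAt_of_contDiffOn {n : ℕ} {T : ℝ} {z : SpaceTime n} (hz : z ∈ openSlab n T)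
    {u : SpaceTime n → ℝ} (hu : ContDiffOn ℝ 1 u (closedSlab n T)) : DifferentiableAt ℝ u z :=
  (hu.contDiffAt (closedSlab_mem_nhds hz)).differentiableAt (by norm_num)

/-- Along the coordinate line in direction `α` the function `u` has derivative `∂_α u`. -/
theorem hasDerivAt_pd {n : ℕ} {T : ℝ} {z : SpaceTime n} (hz : z ∈ openSlab n T)
    {u : SpaceTime n → ℝ} (hu : DifferentiableAt ℝ u z) (α : Fin (n + 1)) :
    HasDerivAt (fun τ : ℝ => u (z + τ • stBasis α)) (pd T α u z) 0 := by
  rw [pd_eq_fderiv hz]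
  exact hu.hasFDerivAt.hasLineDerivAt (stBasis α)

theorem pd_eq_of_hasDerivAt {n : ℕ} {T : ℝ} {z : SpaceTime n} (hz : z ∈ openSlab n T)
    {u : SpaceTime n → ℝ} (hu : DifferentiableAt ℝ u z) {α : Fin (n + 1)} {d : ℝ}
    (h : HasDerivAt (fun τ : ℝ => u (z + τ • stBasis α)) d 0) : pd T α u z = d :=
  (hasDerivAt_pd hz hu α).unique h

theorem pd_comm {n : ℕ} {T : ℝ} {z : SpaceTime n} (hz : z ∈ openSlab n T)
    {u : SpaceTime n → ℝ} (hu : ContDiffOn ℝ 2 u (closedSlab n T)) (α β : Fin (n + 1)) :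
    pd T α (pd T β u) z = pd T β (pd T α u) z := by
  have hc : ContDiffAt ℝ 2 u z := hu.contDiffAt (closedSlab_mem_nhds hz)
  have key : ∀ α β : Fin (n + 1), pd T α (pd T β u) z
      = fderiv ℝ (fderiv ℝ u) z (stBasis α) (stBasis β) := by
    intro α β
    rw [pd_eq_fderiv hz]
    have he : pd T β u =ᶠ[nhds z] fun y => fderiv ℝ u y (stBasis β) :=
      Filter.mem_of_superset ((isOpen_openSlab n T).mem_nhds hz) fun y hy => pd_eq_fderiv hy u β
    rw [he.fderiv_eq]
    have hd : DifferentiableAt ℝ (fderiv ℝ u) z :=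
      (hc.fderiv_right (m := 1) (by norm_num)).differentiableAt (by norm_num)
    rw [fderiv_clm_apply hd (differentiableAt_const _)]
    simp
  rw [key, key]
  exact hc.isSymmSndFDerivAt (by simp) _ _

theorem stBasis_zero (n : ℕ) : (stBasis 0 : SpaceTime n) = (1, 0) := rfl

theorem stBasis_succ {n : ℕ} (a : Fin n) : (stBasis a.succ : SpaceTime n) = (0, spaceBasis a) := rfl

theorem mem_openSlab {n : ℕ} {T : ℝ} {z : SpaceTime n} :
    z ∈ openSlab n T ↔ 0 < z.1 ∧ z.1 < T := by simp [openSlab]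

theorem mem_closedSlab {n : ℕ} {T : ℝ} {z : SpaceTime n} :
    z ∈ closedSlab n T ↔ 0 ≤ z.1 ∧ z.1 ≤ T := by simp [closedSlab]

/-- The spatial slices of a `C¹` function on the closed slab are `C¹`. -/
theorem contDiff_slice {n : ℕ} {T : ℝ} {k : ℕ∞ω} {u : SpaceTime n → ℝ}
    (hu : ContDiffOn ℝ k u (closedSlab n T)) {t : ℝ} (ht : t ∈ Icc 0 T) :
    ContDiff ℝ k (fun x : Space n => u (t, x)) := by
  have h1 : ContDiff ℝ k (fun x : Space n => ((t, x) : SpaceTime n)) :=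
    contDiff_const.prodMk contDiff_id
  exact hu.comp_contDiff h1 fun x => mem_closedSlab.2 ⟨ht.1, ht.2⟩

theorem fderiv_slice {n : ℕ} {T : ℝ} {u : SpaceTime n → ℝ}
    (hu : ContDiffOn ℝ 1 u (closedSlab n T)) {t : ℝ} (ht : t ∈ Icc 0 T) (x : Space n)
    (a : Fin n) :
    fderiv ℝ (fun x : Space n => u (t, x)) x (spaceBasis a) = pd T a.succ u (t, x) := by
  have hz : ((t, x) : SpaceTime n) ∈ closedSlab n T := mem_closedSlab.2 ⟨ht.1, ht.2⟩
  have h1 : HasFDerivWithinAt u (fderivWithin ℝ u (closedSlab n T) (t, x)) (closedSlab n T)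
      (t, x) := (hu.differentiableOn (by norm_num) _ hz).hasFDerivWithinAt
  have h2 : HasFDerivAt (fun x : Space n => ((t, x) : SpaceTime n))
      (ContinuousLinearMap.inr ℝ ℝ (Space n)) x := hasFDerivAt_prodMk_right t x
  have h3 := h1.comp_hasFDerivAt x h2 (Filter.Eventually.of_forall fun y =>
    mem_closedSlab.2 ⟨ht.1, ht.2⟩)
  rw [show (fun x : Space n => u (t, x)) = u ∘ (fun x : Space n => ((t, x) : SpaceTime n)) from rfl,
    h3.fderiv]
  rfl

theorem hasDerivWithinAt_time {n : ℕ} {T : ℝ} {u : SpaceTime n → ℝ}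
    (hu : ContDiffOn ℝ 1 u (closedSlab n T)) {t : ℝ} (ht : t ∈ Icc 0 T) (x : Space n) :
    HasDerivWithinAt (fun s => u (s, x)) (pd T 0 u (t, x)) (Icc 0 T) t := by
  have hz : ((t, x) : SpaceTime n) ∈ closedSlab n T := mem_closedSlab.2 ⟨ht.1, ht.2⟩
  have h1 : HasFDerivWithinAt u (fderivWithin ℝ u (closedSlab n T) (t, x)) (closedSlab n T)
      (t, x) := (hu.differentiableOn (by norm_num) _ hz).hasFDerivWithinAt
  have h2 : HasDerivWithinAt (fun s : ℝ => ((s, x) : SpaceTime n)) (1, 0) (Icc 0 T) t :=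
    (hasDerivWithinAt_id t _).prodMk (hasDerivWithinAt_const t _ x)
  exact h1.comp_hasDerivWithinAt t h2 fun s hs => mem_closedSlab.2 ⟨hs.1, hs.2⟩

/-! ### The divergence theorem on a slab -/

theorem volume_restrict_openSlab (n : ℕ) (t : ℝ) :
    (volume : Measure (SpaceTime n)).restrict (openSlab n t)
      = ((volume : Measure ℝ).restrict (Ioo 0 t)).prod (volume : Measure (Space n)) := by
  rw [openSlab, Measure.volume_eq_prod, ← Measure.prod_restrict, Measure.restrict_univ]

theorem integrableOn_cutoff_mul {n : ℕ} {T t : ℝ} (ht : t ≤ T) {u : SpaceTime n → ℝ}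
    (hu : ContinuousOn u (closedSlab n T)) {χ : Space n → ℝ} (hχ : Continuous χ)
    (hχc : HasCompactSupport χ) :
    IntegrableOn (fun z : SpaceTime n => χ z.2 * u z) (openSlab n t) := by
  have hK : IsCompact (Icc (0 : ℝ) T ×ˢ tsupport χ) := isCompact_Icc.prod hχc
  have hc : ContinuousOn (fun z : SpaceTime n => χ z.2 * u z) (Icc (0 : ℝ) T ×ˢ tsupport χ) :=
    (hχ.comp continuous_snd).continuousOn.mul
      (hu.mono (prod_mono subset_rfl (subset_univ _)))
  refine (hc.integrableOn_compact hK).of_forall_sdiff_eq_zero (measurableSet_openSlab n t) ?_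
  rintro z ⟨hz, hzK⟩
  have h1 := mem_openSlab.1 hz
  have h2 : z.2 ∉ tsupport χ := fun h => hzK ⟨⟨h1.1.le, h1.2.le.trans ht⟩, h⟩
  simp [image_eq_zero_of_notMem_tsupport h2]

theorem integral_cutoff_pd_time {n : ℕ} {T t : ℝ} (hT : 0 < T) (ht : t ∈ Icc 0 T)
    {u : SpaceTime n → ℝ} (hu : ContDiffOn ℝ 1 u (closedSlab n T)) {χ : Space n → ℝ}
    (hχ : Continuous χ) (hχc : HasCompactSupport χ) :
    ∫ z in openSlab n t, χ z.2 * pd T 0 u z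
      = (∫ x, χ x * u (t, x)) - ∫ x, χ x * u (0, x) := by
  have hi := integrableOn_cutoff_mul ht.2 (continuousOn_pd hT hu 0) hχ hχc
  rw [IntegrableOn, volume_restrict_openSlab] at hi
  rw [volume_restrict_openSlab, integral_prod_symm _ hi]
  have hs : ∀ s ∈ Icc (0 : ℝ) T, Integrable (fun x => χ x * u (s, x)) := fun s hs =>
    (hχ.mul (contDiff_slice hu hs).continuous).integrable_of_hasCompactSupport hχc.mul_right
  rw [← integral_sub (hs t ht) (hs 0 ⟨le_rfl, hT.le⟩)]
  refine integral_congr_ae (Filter.Eventually.of_forall fun x => ?_)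
  simp only
  rw [← mul_sub, integral_const_mul]
  congr 1
  rw [← integral_Ioc_eq_integral_Ioo, ← intervalIntegral.integral_of_le ht.1]
  have hcl : ∀ s ∈ Icc (0 : ℝ) t, s ∈ Icc (0 : ℝ) T := fun s hs => ⟨hs.1, hs.2.trans ht.2⟩
  refine intervalIntegral.integral_eq_sub_of_hasDerivAt_of_le ht.1 (f := fun s => u (s, x)) ?_ ?_ ?_
  · exact fun s hs => ((hasDerivWithinAt_time hu (hcl s hs) x).continuousWithinAt).mono hcl
  · intro s hs
    refine (hasDerivWithinAt_time hu (hcl s (Ioo_subset_Icc_self hs)) x).hasDerivAt ?_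
    exact Icc_mem_nhds hs.1 (hs.2.trans_le ht.2)
  · refine ContinuousOn.intervalIntegrable_of_Icc ht.1 ?_
    refine (continuousOn_pd hT hu 0).comp (by fun_prop) fun s hs => ?_
    exact mem_closedSlab.2 ⟨hs.1, hs.2.trans ht.2⟩

theorem integral_cutoff_pd_space {n : ℕ} {T t : ℝ} (hT : 0 < T) (ht : t ∈ Icc 0 T)
    {u : SpaceTime n → ℝ} (hu : ContDiffOn ℝ 1 u (closedSlab n T)) {χ : Space n → ℝ}
    (hχ : ContDiff ℝ 1 χ) (hχc : HasCompactSupport χ) (a : Fin n) :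
    ∫ z in openSlab n t, χ z.2 * pd T a.succ u z
      = - ∫ z in openSlab n t, fderiv ℝ χ z.2 (spaceBasis a) * u z := by
  have hχ' : Continuous fun x => fderiv ℝ χ x (spaceBasis a) :=
    (hχ.continuous_fderiv (by norm_num)).clm_apply continuous_const
  have hχc' : HasCompactSupport fun x => fderiv ℝ χ x (spaceBasis a) :=
    hχc.fderiv_apply (𝕜 := ℝ) _
  have hi := integrableOn_cutoff_mul ht.2 (continuousOn_pd hT hu a.succ) hχ.continuous hχc
  have hi' := integrableOn_cutoff_mul ht.2 hu.continuousOn hχ' hχc'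
  rw [IntegrableOn, volume_restrict_openSlab] at hi hi'
  rw [volume_restrict_openSlab, integral_prod _ hi, integral_prod _ hi', ← integral_neg]
  refine setIntegral_congr_fun measurableSet_Ioo fun s hs => ?_
  have hs' : s ∈ Icc (0 : ℝ) T := ⟨hs.1.le, hs.2.le.trans ht.2⟩
  have hsl := contDiff_slice hu hs'
  have hsl' : Continuous fun x => fderiv ℝ (fun x : Space n => u (s, x)) x (spaceBasis a) :=
    (hsl.continuous_fderiv (by norm_num)).clm_apply continuous_const
  have := integral_mul_fderiv_eq_neg_fderiv_mul_of_integrable (μ := (volume : Measure (Space n)))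
    (f := χ) (g := fun x => u (s, x)) (v := spaceBasis a)
    ((hχ'.mul hsl.continuous).integrable_of_hasCompactSupport hχc'.mul_right)
    ((hχ.continuous.mul hsl').integrable_of_hasCompactSupport hχc.mul_right)
    ((hχ.continuous.mul hsl.continuous).integrable_of_hasCompactSupport hχc.mul_right)
    (fun x _ => hχ.differentiable (by norm_num) x)
    (fun x _ => hsl.differentiable (by norm_num) x)
  simpa only [fderiv_slice hu hs'] using this

/-- The cutoff turns the spatial part of the divergence into a term supported where `χ` varies. -/
theorem integral_cutoff_divergence {n : ℕ} {T t : ℝ} (hT : 0 < T) (ht : t ∈ Icc 0 T)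
    {P : Fin (n + 1) → SpaceTime n → ℝ} (hP : ∀ α, ContDiffOn ℝ 1 (P α) (closedSlab n T))
    {χ : Space n → ℝ} (hχ : ContDiff ℝ 1 χ) (hχc : HasCompactSupport χ) :
    ∫ z in openSlab n t, χ z.2 * ∑ α, pd T α (P α) z
      = (∫ x, χ x * P 0 (t, x)) - (∫ x, χ x * P 0 (0, x))
        - ∫ z in openSlab n t, ∑ a : Fin n, fderiv ℝ χ z.2 (spaceBasis a) * P a.succ z := by
  have hχ' : ∀ a, Continuous fun x => fderiv ℝ χ x (spaceBasis a) := fun a =>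
    (hχ.continuous_fderiv (by norm_num)).clm_apply continuous_const
  have hχc' : ∀ a, HasCompactSupport fun x => fderiv ℝ χ x (spaceBasis a) := fun a =>
    hχc.fderiv_apply (𝕜 := ℝ) _
  simp only [Finset.mul_sum]
  rw [integral_finsetSum _ fun α _ =>
      integrableOn_cutoff_mul ht.2 (continuousOn_pd hT (hP α) α) hχ.continuous hχc,
    integral_finsetSum _ fun a _ =>
      integrableOn_cutoff_mul ht.2 (hP (Fin.succ a)).continuousOn (hχ' a) (hχc' a),
    Fin.sum_univ_succ, integral_cutoff_pd_time hT ht (hP 0) hχ.continuous hχc]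
  simp only [integral_cutoff_pd_space hT ht (hP _) hχ hχc, Finset.sum_neg_distrib]
  ring

/-- Smooth cutoffs that exhaust space and whose first derivatives are `O(1/k)`. -/
theorem exists_cutoff (n : ℕ) : ∃ (χ : ℕ → Space n → ℝ) (C : ℝ),
    (∀ k, ContDiff ℝ 1 (χ k)) ∧ (∀ k, HasCompactSupport (χ k)) ∧
    (∀ k x, 0 ≤ χ k x ∧ χ k x ≤ 1) ∧
    (∀ k a x, |fderiv ℝ (χ k) x (spaceBasis a)| ≤ C / (k + 1)) ∧
    ∀ x, ∀ᶠ k in Filter.atTop, χ k x = 1 := by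
  let b : ContDiffBump (0 : Space n) := ⟨1, 2, one_pos, one_lt_two⟩
  obtain ⟨C, hC⟩ := (b.contDiff.continuous_fderiv (n := 1) (by norm_num)).bounded_above_of_compact_support
    (b.hasCompactSupport.fderiv (𝕜 := ℝ))
  have hb : ContDiff ℝ 1 b := b.contDiff
  have hpos : ∀ k : ℕ, (0 : ℝ) < (k : ℝ) + 1 := fun k => by positivity
  refine ⟨fun k x => b (((k : ℝ) + 1)⁻¹ • x), C, ?_, ?_, ?_, ?_, ?_⟩
  · intro k
    exact hb.comp (contDiff_const_smul _)
  · intro k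
    exact b.hasCompactSupport.comp_smul (inv_ne_zero (hpos k).ne')
  · exact fun k x => ⟨b.nonneg, b.le_one⟩
  · intro k a x
    have h1 : HasFDerivAt (fun x : Space n => ((k : ℝ) + 1)⁻¹ • x)
        (((k : ℝ) + 1)⁻¹ • ContinuousLinearMap.id ℝ (Space n)) x :=
      (hasFDerivAt_id x).fun_const_smul _
    have h2 := ((hb.differentiable (by norm_num) (((k : ℝ) + 1)⁻¹ • x)).hasFDerivAt).comp x h1
    have h3 : fderiv ℝ (fun x => b (((k : ℝ) + 1)⁻¹ • x)) x = _ := h2.fderiv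
    rw [h3]
    simp only [ContinuousLinearMap.comp_apply, smul_apply,
      ContinuousLinearMap.id_apply, map_smul, smul_eq_mul, abs_mul, abs_inv, abs_of_pos (hpos k)]
    rw [div_eq_inv_mul]
    gcongr
    have := (fderiv ℝ b (((k : ℝ) + 1)⁻¹ • x)).le_opNorm (spaceBasis a)
    rw [Real.norm_eq_abs, show ‖(spaceBasis a : Space n)‖ = 1 by simp [spaceBasis], mul_one] at this
    exact this.trans (hC _)
  · intro x
    filter_upwards [Filter.eventually_ge_atTop ⌈‖x‖⌉₊] with k hk
    apply b.one_of_mem_closedBall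
    have hx : ‖x‖ ≤ k := (Nat.le_ceil _).trans (by exact_mod_cast hk)
    rw [mem_closedBall_zero_iff, norm_smul, norm_inv, Real.norm_of_nonneg (hpos k).le]
    change _ ≤ (1 : ℝ)
    rw [inv_mul_le_iff₀ (hpos k)]
    linarith

/-! ### Currents without flux at spatial infinity -/

theorem tendsto_integral_cutoff_mul {n : ℕ} {χ : ℕ → Space n → ℝ}
    (hχ : ∀ k, ContDiff ℝ 1 (χ k)) (hχ01 : ∀ k x, 0 ≤ χ k x ∧ χ k x ≤ 1)
    (hχ1 : ∀ x, ∀ᶠ k in Filter.atTop, χ k x = 1) {p : Space n → ℝ} (hp : Integrable p) :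
    Filter.Tendsto (fun k => ∫ x, χ k x * p x) Filter.atTop (nhds (∫ x, p x)) := by
  refine tendsto_integral_of_dominated_convergence (fun x => |p x|)
    (fun k => (hχ k).continuous.aestronglyMeasurable.mul hp.aestronglyMeasurable) hp.abs ?_ ?_
  · intro k
    refine Filter.Eventually.of_forall fun x => ?_
    rw [norm_mul, Real.norm_eq_abs, Real.norm_eq_abs, abs_of_nonneg (hχ01 k x).1]
    exact mul_le_of_le_one_left (abs_nonneg _) (hχ01 k x).2
  · refine Filter.Eventually.of_forall fun x => ?_
    refine Filter.Tendsto.congr' ?_ tendsto_const_nhds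
    filter_upwards [hχ1 x] with k hk
    rw [hk, one_mul]

/-- Integrated form of a differential inequality `∑ ∂_α P^α ≤ -W + B` with `W, B ≥ 0`: an
integrable current has no flux through spatial infinity. Only the current, not its divergence,
is required to be integrable; the integrability of `W` is part of the conclusion. -/
theorem integral_le_of_divergence_le {n : ℕ} {T t : ℝ} (hT : 0 < T) (ht : t ∈ Icc 0 T)
    {P : Fin (n + 1) → SpaceTime n → ℝ} (hP : ∀ α, ContDiffOn ℝ 1 (P α) (closedSlab n T))
    {Q W B : SpaceTime n → ℝ} (hQ : IntegrableOn Q (openSlab n t))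
    (hPQ : ∀ z ∈ openSlab n t, ∀ a : Fin n, |P a.succ z| ≤ Q z)
    (hPt : Integrable fun x => P 0 (t, x)) (hP0 : Integrable fun x => P 0 (0, x))
    (hW : ContinuousOn W (closedSlab n T)) (hW0 : ∀ z ∈ openSlab n t, 0 ≤ W z)
    (hB : IntegrableOn B (openSlab n t))
    (hB0 : ∀ᵐ z ∂(volume.restrict (openSlab n t)), 0 ≤ B z)
    (hdiv : ∀ᵐ z ∂(volume.restrict (openSlab n t)), ∑ α, pd T α (P α) z ≤ -W z + B z) :
    IntegrableOn W (openSlab n t) ∧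
      ∫ z in openSlab n t, W z
        ≤ (∫ x, P 0 (0, x)) - (∫ x, P 0 (t, x)) + ∫ z in openSlab n t, B z := by
  obtain ⟨χ, C, hχ, hχc, hχ01, hχ', hχ1⟩ := exists_cutoff n
  set A : ℕ → ℝ := fun k => (∫ x, χ k x * P 0 (0, x)) - (∫ x, χ k x * P 0 (t, x))
    + (∫ z in openSlab n t, B z) + n * (C / ((k : ℝ) + 1)) * ∫ z in openSlab n t, Q z with hA
  set A' : ℝ := (∫ x, P 0 (0, x)) - (∫ x, P 0 (t, x)) + ∫ z in openSlab n t, B z with hA'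
  have hlim : Filter.Tendsto A Filter.atTop (nhds A') := by
    have h1 := tendsto_integral_cutoff_mul hχ hχ01 hχ1 hP0
    have h2 := tendsto_integral_cutoff_mul hχ hχ01 hχ1 hPt
    have h3 : Filter.Tendsto (fun k : ℕ => C / ((k : ℝ) + 1)) Filter.atTop (nhds 0) :=
      tendsto_const_div_atTop_nhds_zero_nat C |>.comp (Filter.tendsto_add_atTop_nat 1) |>.congr
        fun k => by simp
    have h4 := ((h1.sub h2).add_const (∫ z in openSlab n t, B z)).add
      ((h3.const_mul (n : ℝ)).mul_const (∫ z in openSlab n t, Q z))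
    simpa [hA, hA'] using h4
  have hWi : ∀ k, IntegrableOn (fun z : SpaceTime n => χ k z.2 * W z) (openSlab n t) := fun k =>
    integrableOn_cutoff_mul ht.2 hW (hχ k).continuous (hχc k)
  have hχWnn : ∀ k, ∀ z ∈ openSlab n t, 0 ≤ χ k z.2 * W z := fun k z hz =>
    mul_nonneg (hχ01 k z.2).1 (hW0 z hz)
  have hle : ∀ k, ∫ z in openSlab n t, χ k z.2 * W z ≤ A k := by
    intro k
    have h1 := integral_cutoff_divergence hT ht hP (hχ k) (hχc k)
    have hDi : IntegrableOn (fun z : SpaceTime n => χ k z.2 * ∑ α, pd T α (P α) z)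
        (openSlab n t) :=
      integrableOn_cutoff_mul ht.2
        (continuousOn_finsetSum _ fun α _ => continuousOn_pd hT (hP α) α)
        (hχ k).continuous (hχc k)
    have h2 : ∫ z in openSlab n t, χ k z.2 * ∑ α, pd T α (P α) z
        ≤ ∫ z in openSlab n t, (-(χ k z.2 * W z) + B z) := by
      refine integral_mono_ae hDi ((hWi k).neg.add hB) ?_
      filter_upwards [hB0, hdiv] with z hz1 hz2
      have h3 := mul_le_mul_of_nonneg_left hz2 (hχ01 k z.2).1
      have h4 := mul_le_of_le_one_left hz1 (hχ01 k z.2).2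
      linarith
    rw [integral_add (f := fun z => -(χ k z.2 * W z)) (hWi k).neg hB, integral_neg] at h2
    have h5 : ‖∫ z in openSlab n t, ∑ a : Fin n, fderiv ℝ (χ k) z.2 (spaceBasis a) * P a.succ z‖
        ≤ ∫ z in openSlab n t, n * (C / ((k : ℝ) + 1)) * Q z := by
      refine norm_integral_le_of_norm_le (hQ.const_mul _) ?_
      filter_upwards [ae_restrict_mem (measurableSet_openSlab n t)] with z hz
      refine (norm_sum_le _ _).trans ?_
      have : ∀ a ∈ (Finset.univ : Finset (Fin n)),
          ‖fderiv ℝ (χ k) z.2 (spaceBasis a) * P a.succ z‖ ≤ C / ((k : ℝ) + 1) * Q z := by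
        intro a _
        rw [norm_mul]
        exact mul_le_mul (hχ' k a z.2) (hPQ z hz a) (norm_nonneg _)
          ((abs_nonneg _).trans (hχ' k a z.2))
      refine (Finset.sum_le_card_nsmul _ _ _ this).trans ?_
      simp [mul_assoc]
    rw [integral_const_mul] at h5
    have h6 := (abs_le.1 h5).2
    simp only [hA]
    linarith
  have hA'nn : 0 ≤ A' := ge_of_tendsto' hlim fun k =>
    (setIntegral_nonneg (measurableSet_openSlab n t) (hχWnn k)).trans (hle k)
  have hWm : AEStronglyMeasurable W (volume.restrict (openSlab n t)) :=
    (hW.mono ((openSlab_mono n ht.2).trans (openSlab_subset_closedSlab n T))).aestronglyMeasurable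
      (measurableSet_openSlab n t)
  have hWae : ∀ᵐ z ∂(volume.restrict (openSlab n t)), 0 ≤ W z := by
    filter_upwards [ae_restrict_mem (measurableSet_openSlab n t)] with z hz using hW0 z hz
  have hfatou : ∫⁻ z in openSlab n t, ENNReal.ofReal (W z) ≤ ENNReal.ofReal A' := by
    have h1 : ∀ z, Filter.liminf (fun k => ENNReal.ofReal (χ k z.2 * W z)) Filter.atTop
        = ENNReal.ofReal (W z) := by
      intro z
      refine Filter.Tendsto.liminf_eq (Filter.Tendsto.congr' ?_ tendsto_const_nhds)
      filter_upwards [hχ1 z.2] with k hk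
      rw [hk, one_mul]
    calc ∫⁻ z in openSlab n t, ENNReal.ofReal (W z)
        = ∫⁻ z in openSlab n t,
            Filter.liminf (fun k => ENNReal.ofReal (χ k z.2 * W z)) Filter.atTop := by
          simp only [h1]
      _ ≤ Filter.liminf (fun k => ∫⁻ z in openSlab n t, ENNReal.ofReal (χ k z.2 * W z))
            Filter.atTop :=
          lintegral_liminf_le' fun k => (hWi k).aestronglyMeasurable.aemeasurable.ennreal_ofReal
      _ ≤ Filter.liminf (fun k => ENNReal.ofReal (A k)) Filter.atTop := by
          refine Filter.liminf_le_liminf (Filter.Eventually.of_forall fun k => ?_)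
          rw [← ofReal_integral_eq_lintegral_ofReal (hWi k)]
          · exact ENNReal.ofReal_le_ofReal (hle k)
          · filter_upwards [ae_restrict_mem (measurableSet_openSlab n t)] with z hz
            exact hχWnn k z hz
      _ = ENNReal.ofReal A' := (ENNReal.tendsto_ofReal hlim).liminf_eq
  have hWint : IntegrableOn W (openSlab n t) := by
    refine ⟨hWm, ?_⟩
    rw [hasFiniteIntegral_iff_ofReal hWae]
    exact hfatou.trans_lt ENNReal.ofReal_lt_top
  refine ⟨hWint, ?_⟩
  rw [← ofReal_integral_eq_lintegral_ofReal hWint hWae] at hfatou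
  exact (ENNReal.ofReal_le_ofReal_iff hA'nn).1 hfatou

/-! ### Square integrability of the classical derivatives -/

theorem integral_sq_eq_norm_sq {n : ℕ} {U : L2 n} {u : Space n → ℝ} (h : U =ᵐ[volume] u) :
    Integrable (fun x => u x ^ 2) ∧ ∫ x, u x ^ 2 = ‖U‖ ^ 2 := by
  have h1 : Integrable (fun x => U x ^ 2) := (Lp.memLp U).integrable_sq
  have h2 : (fun x => U x ^ 2) =ᵐ[volume] fun x => u x ^ 2 := h.fun_comp (· ^ 2)
  refine ⟨h1.congr h2, ?_⟩
  rw [← integral_congr_ae h2, ← real_inner_self_eq_norm_sq, L2.inner_def]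
  simp [pow_two]

/-- For a `C¹` function the weak partial derivatives are the classical ones. -/
theorem weakPartial_ae_eq_pd {n : ℕ} {T : ℝ} {φ : SpaceTime n → ℝ}
    (hφ : ContDiffOn ℝ 1 φ (closedSlab n T)) {t : ℝ} (ht : t ∈ Icc 0 T) {a : Fin n}
    {U V : L2 n} (hU : U =ᵐ[volume] fun x => φ (t, x)) (hV : IsWeakPartial a U V) :
    V =ᵐ[volume] fun x => pd T a.succ φ (t, x) := by
  have hsl := contDiff_slice hφ ht
  have hsl' : Continuous fun x => pd T a.succ φ (t, x) := by
    simp only [← fderiv_slice hφ ht]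
    exact (hsl.continuous_fderiv (by norm_num)).clm_apply continuous_const
  refine ae_eq_of_integral_contDiff_smul_eq
    ((Lp.memLp V).locallyIntegrable (by norm_num)) hsl'.locallyIntegrable fun η hη hηc => ?_
  have h1 := hV η hη hηc
  have hη' : Continuous fun x => fderiv ℝ η x (spaceBasis a) :=
    (hη.continuous_fderiv (by simp)).clm_apply continuous_const
  have hηc' : HasCompactSupport fun x => fderiv ℝ η x (spaceBasis a) :=
    hηc.fderiv_apply (𝕜 := ℝ) _
  have h2 : ∫ x, U x * fderiv ℝ η x (spaceBasis a)
      = ∫ x, φ (t, x) * fderiv ℝ η x (spaceBasis a) :=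
    integral_congr_ae (hU.mono fun x hx => by simp only [hx])
  have h3 := integral_mul_fderiv_eq_neg_fderiv_mul_of_integrable
    (μ := (volume : Measure (Space n)))
    (f := fun x => φ (t, x)) (g := η) (v := spaceBasis a)
    (by
      simp only [fderiv_slice hφ ht]
      exact (hsl'.mul hη.continuous).integrable_of_hasCompactSupport hηc.mul_left)
    ((hsl.continuous.mul hη').integrable_of_hasCompactSupport hηc'.mul_left)
    ((hsl.continuous.mul hη.continuous).integrable_of_hasCompactSupport hηc.mul_left)
    (fun x _ => hsl.differentiable (by norm_num) x)
    (fun x _ => hη.differentiable (by simp) x)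
  simp only [fderiv_slice hφ ht] at h3
  rw [h2, h3, neg_inj] at h1
  simpa only [smul_eq_mul, mul_comm] using h1.symm

/-- The derivative of `t ↦ φ(t,·)` in `L²` is the classical time derivative. -/
theorem derivWithin_ae_eq_pd {n : ℕ} {T : ℝ} {φ : SpaceTime n → ℝ}
    (hφ : ContDiffOn ℝ 1 φ (closedSlab n T)) {U : ℝ → L2 n} {U' : L2 n} {t : ℝ} (hT : 0 < T)
    (ht : t ∈ Icc 0 T) (hU : ∀ s ∈ Icc (0 : ℝ) T, U s =ᵐ[volume] fun x => φ (s, x))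
    (hU' : HasDerivWithinAt U U' (Icc 0 T) t) :
    U' =ᵐ[volume] fun x => pd T 0 φ (t, x) := by
  have hne : (nhdsWithin t (Icc 0 T \ {t})).NeBot :=
    accPt_principal_iff_nhdsWithin.1 ((uniqueDiffOn_Icc hT t ht).accPt)
  obtain ⟨s, hs⟩ := (nhdsWithin t (Icc 0 T \ {t})).exists_seq_tendsto
  have hsmem : ∀ᶠ k in Filter.atTop, s k ∈ Icc (0 : ℝ) T \ {t} :=
    hs.eventually self_mem_nhdsWithin
  have h1 : Filter.Tendsto (fun k => slope U t (s k)) Filter.atTop (nhds U') :=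
    (hasDerivWithinAt_iff_tendsto_slope.1 hU').comp hs
  obtain ⟨m, hm, h2⟩ := (tendstoInMeasure_of_tendsto_Lp h1).exists_seq_tendsto_ae
  have h3 : ∀ᵐ x ∂(volume : Measure (Space n)), ∀ k, s k ∈ Icc (0 : ℝ) T \ {t} →
      (slope U t (s k) : L2 n) x = slope (fun s => φ (s, x)) t (s k) := by
    rw [ae_all_iff]
    intro k
    by_cases hk : s k ∈ Icc (0 : ℝ) T \ {t}
    · filter_upwards [hU _ hk.1, hU t ht, Lp.coeFn_sub (U (s k)) (U t),
        Lp.coeFn_smul ((s k - t)⁻¹) (U (s k) - U t)] with x e1 e2 e3 e4 _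
      rw [slope_def_module, slope_def_field, e4, Pi.smul_apply, e3, Pi.sub_apply, e1, e2,
        smul_eq_mul, inv_mul_eq_div]
    · exact Filter.Eventually.of_forall fun x h => absurd h hk
  filter_upwards [h2, h3] with x hx2 hx3
  have h4 : Filter.Tendsto (fun k => slope (fun s => φ (s, x)) t (s (m k))) Filter.atTop
      (nhds (pd T 0 φ (t, x))) :=
    ((hasDerivWithinAt_iff_tendsto_slope.1 (hasDerivWithinAt_time hφ ht x)).comp hs).comp
      hm.tendsto_atTop
  refine tendsto_nhds_unique hx2 (h4.congr' ?_)
  filter_upwards [hm.tendsto_atTop.eventually hsmem] with k hk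
  exact (hx3 (m k) hk).symm

/-- A `C¹` function in `C⁰([0,T]; H¹) ∩ C¹([0,T]; L²)` has slices which are, with all classical
first derivatives, square integrable uniformly in time. -/
theorem exists_bound_integral_sq {n : ℕ} {T : ℝ} (hT : 0 < T) {φ : SpaceTime n → ℝ}
    (hφ : ContDiffOn ℝ 1 φ (closedSlab n T)) (hH1 : ContinuousInH1 T φ)
    (hL2 : ContDiffInL2 T φ) :
    ∃ M : ℝ, ∀ t ∈ Icc (0 : ℝ) T,
      (Integrable (fun x => φ (t, x) ^ 2) ∧ ∫ x, φ (t, x) ^ 2 ≤ M) ∧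
      ∀ α, Integrable (fun x => pd T α φ (t, x) ^ 2) ∧ ∫ x, pd T α φ (t, x) ^ 2 ≤ M := by
  obtain ⟨U, V, hUc, hVc, hUV⟩ := hH1
  obtain ⟨Y, hY, hYφ⟩ := hL2
  have hY' : ContinuousOn (derivWithin Y (Icc 0 T)) (Icc 0 T) :=
    hY.continuousOn_derivWithin (uniqueDiffOn_Icc hT) le_rfl
  have hc : ContinuousOn (fun t => ‖U t‖ ^ 2 + (∑ a, ‖V a t‖ ^ 2)
      + ‖derivWithin Y (Icc 0 T) t‖ ^ 2) (Icc 0 T) := by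
    refine ((hUc.norm.pow 2).add ?_).add (hY'.norm.pow 2)
    exact continuousOn_finsetSum _ fun a _ => (hVc a).norm.pow 2
  obtain ⟨M, hM⟩ := isCompact_Icc.bddAbove_image hc
  refine ⟨M, fun t ht => ?_⟩
  have hMt := hM ⟨t, ht, rfl⟩
  simp only at hMt
  have hsn : 0 ≤ ∑ a, ‖V a t‖ ^ 2 := Finset.sum_nonneg fun a _ => by positivity
  have n1 := sq_nonneg ‖U t‖
  have n2 := sq_nonneg ‖derivWithin Y (Icc 0 T) t‖
  obtain ⟨hU, hV⟩ := hUV t ht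
  refine ⟨?_, fun α => Fin.cases ?_ (fun a => ?_) α⟩
  · obtain ⟨h1, h2⟩ := integral_sq_eq_norm_sq hU
    exact ⟨h1, by linarith⟩
  · obtain ⟨h1, h2⟩ := integral_sq_eq_norm_sq (derivWithin_ae_eq_pd hφ hT ht hYφ
      ((hY.differentiableOn (by norm_num) t ht).hasDerivWithinAt))
    exact ⟨h1, by linarith⟩
  · obtain ⟨h1, h2⟩ := integral_sq_eq_norm_sq (weakPartial_ae_eq_pd hφ ht hU (hV a))
    have h3 : ‖V a t‖ ^ 2 ≤ ∑ a, ‖V a t‖ ^ 2 :=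
      Finset.single_le_sum (f := fun a => ‖V a t‖ ^ 2) (fun _ _ => by positivity)
        (Finset.mem_univ a)
    exact ⟨h1, by linarith⟩

theorem lintegral_openSlab_le {n : ℕ} {T : ℝ} {u : SpaceTime n → ℝ}
    (hu : ContinuousOn u (closedSlab n T)) {M : ℝ≥0∞}
    (hM : ∀ t ∈ Ioo 0 T, ∫⁻ x, ENNReal.ofReal (u (t, x)) ≤ M) :
    ∫⁻ z in openSlab n T, ENNReal.ofReal (u z) ≤ M * ENNReal.ofReal T := by
  have hm : AEMeasurable (fun z => ENNReal.ofReal (u z)) (volume.restrict (openSlab n T)) :=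
    ((hu.mono (openSlab_subset_closedSlab n T)).aestronglyMeasurable
      (measurableSet_openSlab n T)).aemeasurable.ennreal_ofReal
  rw [volume_restrict_openSlab] at hm ⊢
  rw [lintegral_prod _ hm]
  calc ∫⁻ t in Ioo 0 T, ∫⁻ x, ENNReal.ofReal (u (t, x))
      ≤ ∫⁻ _ in Ioo 0 T, M := setLIntegral_mono' measurableSet_Ioo hM
    _ = M * ENNReal.ofReal T := by simp

theorem integrableOn_openSlab {n : ℕ} {T : ℝ} {u : SpaceTime n → ℝ}
    (hu : ContinuousOn u (closedSlab n T)) (hu0 : ∀ z ∈ openSlab n T, 0 ≤ u z) {M : ℝ}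
    (hM : ∀ t ∈ Ioo 0 T, Integrable (fun x => u (t, x)) ∧ ∫ x, u (t, x) ≤ M) :
    IntegrableOn u (openSlab n T) := by
  refine ⟨(hu.mono (openSlab_subset_closedSlab n T)).aestronglyMeasurable
      (measurableSet_openSlab n T), ?_⟩
  rw [hasFiniteIntegral_iff_ofReal]
  · refine (lintegral_openSlab_le hu (M := ENNReal.ofReal M) fun t ht => ?_).trans_lt ?_
    · rw [← ofReal_integral_eq_lintegral_ofReal (hM t ht).1]
      · exact ENNReal.ofReal_le_ofReal (hM t ht).2
      · exact Filter.Eventually.of_forall fun x => hu0 _ (mem_openSlab.2 ht)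
    · exact ENNReal.mul_lt_top ENNReal.ofReal_lt_top ENNReal.ofReal_lt_top
  · filter_upwards [ae_restrict_mem (measurableSet_openSlab n T)] with z hz using hu0 z hz

/-! ### The multiplier identity -/

/-- The diagonal entries `(1, -1, …, -1)` of the Minkowski metric. -/
def sgn {n : ℕ} (α : Fin (n + 1)) : ℝ := if α = 0 then 1 else -1

/-- The coefficients `m^{αβ} + h^{αβ}` of the principal part of the equation. -/
def metric {n : ℕ} (h : Fin (n + 1) → Fin (n + 1) → SpaceTime n → ℝ) (α β : Fin (n + 1))
    (z : SpaceTime n) : ℝ :=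
  (if α = β then sgn α else 0) + h α β z

/-- The first-order multiplier `K φ = X^γ ∂_γ φ + w φ`. -/
def multiplier {n : ℕ} (T : ℝ) (X : Fin (n + 1) → SpaceTime n → ℝ) (w φ : SpaceTime n → ℝ)
    (z : SpaceTime n) : ℝ :=
  ∑ γ, X γ z * pd T γ φ z + w z * φ z

/-- The current whose divergence is `K φ` times the wave operator, up to terms of first order
in `φ`. -/
def current {n : ℕ} (T : ℝ) (h : Fin (n + 1) → Fin (n + 1) → SpaceTime n → ℝ)
    (X : Fin (n + 1) → SpaceTime n → ℝ) (w φ : SpaceTime n → ℝ) (α : Fin (n + 1))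
    (z : SpaceTime n) : ℝ :=
  (∑ β, metric h α β z * pd T β φ z) * multiplier T X w φ z
    - 1 / 2 * (X α z * ∑ β, ∑ γ, metric h β γ z * (pd T β φ z * pd T γ φ z))
    - 1 / 2 * sgn α * (pd T α w z * φ z ^ 2)

/-- The part of the divergence of the current which does not involve `h`. -/
def flatBulk {n : ℕ} (T : ℝ) (X : Fin (n + 1) → SpaceTime n → ℝ) (w φ : SpaceTime n → ℝ)
    (z : SpaceTime n) : ℝ :=
  (∑ α, sgn α * pd T α φ z * ∑ γ, pd T α (X γ) z * pd T γ φ z)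
    + (w z - 1 / 2 * ∑ α, pd T α (X α) z) * (∑ α, sgn α * pd T α φ z ^ 2)
    - 1 / 2 * φ z ^ 2 * ∑ α, sgn α * pd T α (pd T α w) z

/-- The part of the divergence of the current which is linear in `h` and `∂h`. -/
def pertBulk {n : ℕ} (T : ℝ) (h : Fin (n + 1) → Fin (n + 1) → SpaceTime n → ℝ)
    (X : Fin (n + 1) → SpaceTime n → ℝ) (w φ : SpaceTime n → ℝ) (z : SpaceTime n) : ℝ :=
  multiplier T X w φ z * (∑ α, ∑ β, pd T α (h α β) z * pd T β φ z)
    - 1 / 2 * (∑ α, X α z * ∑ β, ∑ γ, pd T α (h β γ) z * (pd T β φ z * pd T γ φ z))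
    + (∑ α, (∑ β, h α β z * pd T β φ z) * ∑ γ, pd T α (X γ) z * pd T γ φ z)
    + (w z - 1 / 2 * ∑ α, pd T α (X α) z) * (∑ α, (∑ β, h α β z * pd T β φ z) * pd T α φ z)
    + φ z * ∑ α, (∑ β, h α β z * pd T β φ z) * pd T α w z

theorem sum_metric_mul {n : ℕ} (h : Fin (n + 1) → Fin (n + 1) → SpaceTime n → ℝ)
    (α : Fin (n + 1)) (z : SpaceTime n) (v : Fin (n + 1) → ℝ) :
    ∑ β, metric h α β z * v β = sgn α * v α + ∑ β, h α β z * v β := by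
  simp [metric, add_mul, Finset.sum_add_distrib]

theorem waveOp_eq_sum_metric {n : ℕ} (T : ℝ)
    (h : Fin (n + 1) → Fin (n + 1) → SpaceTime n → ℝ) (φ : SpaceTime n → ℝ) (z : SpaceTime n) :
    waveOp T h φ z = ∑ α, ∑ β, metric h α β z * pd T α (pd T β φ) z := by
  simp only [sum_metric_mul, Finset.sum_add_distrib, waveOp]
  rw [Fin.sum_univ_succ (fun α => sgn α * pd T α (pd T α φ) z)]
  simp [sgn, Fin.succ_ne_zero, sub_eq_add_neg]

theorem contDiffOn_metric {n : ℕ} {T : ℝ} {h : Fin (n + 1) → Fin (n + 1) → SpaceTime n → ℝ}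
    (hh : ∀ α β, ContDiffOn ℝ 1 (h α β) (closedSlab n T)) (α β : Fin (n + 1)) :
    ContDiffOn ℝ 1 (metric h α β) (closedSlab n T) :=
  contDiffOn_const.add (hh α β)

theorem contDiffOn_multiplier {n : ℕ} {T : ℝ} (hT : 0 < T) {X : Fin (n + 1) → SpaceTime n → ℝ}
    {w φ : SpaceTime n → ℝ} (hX : ∀ γ, ContDiffOn ℝ 1 (X γ) (closedSlab n T))
    (hw : ContDiffOn ℝ 2 w (closedSlab n T)) (hφ : ContDiffOn ℝ 2 φ (closedSlab n T)) :
    ContDiffOn ℝ 1 (multiplier T X w φ) (closedSlab n T) :=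
  (ContDiffOn.sum fun γ _ => (hX γ).mul (contDiffOn_pd hT hφ γ)).add
    ((hw.of_le (by norm_num)).mul (hφ.of_le (by norm_num)))

theorem contDiffOn_current {n : ℕ} {T : ℝ} (hT : 0 < T)
    {h : Fin (n + 1) → Fin (n + 1) → SpaceTime n → ℝ} {X : Fin (n + 1) → SpaceTime n → ℝ}
    {w φ : SpaceTime n → ℝ} (hh : ∀ α β, ContDiffOn ℝ 1 (h α β) (closedSlab n T))
    (hX : ∀ γ, ContDiffOn ℝ 1 (X γ) (closedSlab n T))
    (hw : ContDiffOn ℝ 2 w (closedSlab n T)) (hφ : ContDiffOn ℝ 2 φ (closedSlab n T))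
    (α : Fin (n + 1)) : ContDiffOn ℝ 1 (current T h X w φ α) (closedSlab n T) := by
  have h1 := contDiffOn_pd hT hφ
  have h2 := contDiffOn_metric hh
  refine (((ContDiffOn.sum fun β _ => (h2 α β).mul (h1 β)).mul
    (contDiffOn_multiplier hT hX hw hφ)).sub (contDiffOn_const.mul ((hX α).mul
      (ContDiffOn.sum fun β _ => ContDiffOn.sum fun γ _ => (h2 β γ).mul ((h1 β).mul (h1 γ)))))).sub
    (contDiffOn_const.mul ((contDiffOn_pd hT hw α).mul ((hφ.of_le (by norm_num)).pow 2)))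

/-- The product rule applied to `∂_α P^α` for a single index `α`. -/
theorem pd_current {n : ℕ} {T : ℝ} (hT : 0 < T)
    {h : Fin (n + 1) → Fin (n + 1) → SpaceTime n → ℝ} {X : Fin (n + 1) → SpaceTime n → ℝ}
    {w φ : SpaceTime n → ℝ} (hh : ∀ α β, ContDiffOn ℝ 1 (h α β) (closedSlab n T))
    (hX : ∀ γ, ContDiffOn ℝ 1 (X γ) (closedSlab n T))
    (hw : ContDiffOn ℝ 2 w (closedSlab n T)) (hφ : ContDiffOn ℝ 2 φ (closedSlab n T))
    {z : SpaceTime n} (hz : z ∈ openSlab n T) (α : Fin (n + 1)) :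
    pd T α (current T h X w φ α) z =
      ((∑ β, pd T α (h α β) z * pd T β φ z) + ∑ β, metric h α β z * pd T α (pd T β φ) z)
          * multiplier T X w φ z
        + (∑ β, metric h α β z * pd T β φ z)
          * ((∑ γ, pd T α (X γ) z * pd T γ φ z) + (∑ γ, X γ z * pd T α (pd T γ φ) z)
              + (pd T α w z * φ z + w z * pd T α φ z))
        - 1 / 2 * (pd T α (X α) z * (∑ β, ∑ γ, metric h β γ z * (pd T β φ z * pd T γ φ z))
            + X α z * ((∑ β, ∑ γ, pd T α (h β γ) z * (pd T β φ z * pd T γ φ z))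
              + ∑ β, ∑ γ, metric h β γ z * (pd T α (pd T β φ) z * pd T γ φ z
                  + pd T β φ z * pd T α (pd T γ φ) z)))
        - 1 / 2 * sgn α * (pd T α (pd T α w) z * φ z ^ 2
            + pd T α w z * (2 * φ z * pd T α φ z)) := by
  have hd : ∀ {u : SpaceTime n → ℝ}, ContDiffOn ℝ 1 u (closedSlab n T) →
      HasDerivAt (fun τ : ℝ => u (z + τ • stBasis α)) (pd T α u z) 0 := fun hu =>
    hasDerivAt_pd hz (differentiableAt_of_contDiffOn hz hu) α
  have dφ := hd (hφ.of_le (by norm_num))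
  have dw := hd (hw.of_le (by norm_num))
  have dφ' := fun β => hd (contDiffOn_pd hT hφ β)
  have dw' := hd (contDiffOn_pd hT hw α)
  have dX := fun γ => hd (hX γ)
  have dG : ∀ β γ, HasDerivAt (fun τ : ℝ => metric h β γ (z + τ • stBasis α))
      (pd T α (h β γ) z) 0 := fun β γ => (hd (hh β γ)).const_add _
  refine pd_eq_of_hasDerivAt hz
    (differentiableAt_of_contDiffOn hz (contDiffOn_current hT hh hX hw hφ α)) ?_
  have d1 := HasDerivAt.fun_sum (u := Finset.univ) fun β _ => (dG α β).fun_mul (dφ' β)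
  have d2 := (HasDerivAt.fun_sum (u := Finset.univ) fun γ _ => (dX γ).fun_mul (dφ' γ)).fun_add
    (dw.fun_mul dφ)
  have d3 := HasDerivAt.fun_sum (u := Finset.univ) fun β _ =>
    HasDerivAt.fun_sum (u := Finset.univ) fun γ _ => (dG β γ).fun_mul ((dφ' β).fun_mul (dφ' γ))
  have d4 := ((d1.fun_mul d2).fun_sub (((dX α).fun_mul d3).const_mul (1 / 2))).fun_sub
    ((dw'.fun_mul (dφ.fun_pow 2)).const_mul (1 / 2 * sgn α))
  refine d4.congr_deriv ?_
  simp only [zero_smul, add_zero, Finset.sum_add_distrib, multiplier]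
  push_cast
  ring

/-- The multiplier identity: `∑ ∂_α P^α = K φ · (□φ + h^{αβ} ∂_α ∂_β φ)` plus terms quadratic in
`(φ, ∂φ)`. Symmetry of the coefficients is what makes the second derivatives outside the wave
operator cancel. -/
theorem sum_pd_current {n : ℕ} {T : ℝ} (hT : 0 < T)
    {h : Fin (n + 1) → Fin (n + 1) → SpaceTime n → ℝ} {X : Fin (n + 1) → SpaceTime n → ℝ}
    {w φ : SpaceTime n → ℝ} (hh : ∀ α β, ContDiffOn ℝ 1 (h α β) (closedSlab n T))
    (hsym : ∀ z ∈ closedSlab n T, ∀ α β, h α β z = h β α z)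
    (hX : ∀ γ, ContDiffOn ℝ 1 (X γ) (closedSlab n T))
    (hw : ContDiffOn ℝ 2 w (closedSlab n T)) (hφ : ContDiffOn ℝ 2 φ (closedSlab n T))
    {z : SpaceTime n} (hz : z ∈ openSlab n T) :
    ∑ α, pd T α (current T h X w φ α) z
      = multiplier T X w φ z * waveOp T h φ z + flatBulk T X w φ z + pertBulk T h X w φ z := by
  have hsym' : ∀ α β, metric h α β z = metric h β α z := by
    intro α β
    simp only [metric, hsym z (openSlab_subset_closedSlab n T hz) α β, eq_comm (a := α) (b := β)]
    split_ifs with e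
    · rw [e]
    · rfl
  have hu2 : ∀ α β, pd T α (pd T β φ) z = pd T β (pd T α φ) z := pd_comm hz hφ
  simp only [pd_current hT hh hX hw hφ hz]
  -- Abbreviations for the contractions with a single free index.
  set K := multiplier T X w φ z with hK
  set g : Fin (n + 1) → ℝ := fun α => ∑ β, metric h α β z * pd T β φ z with hg
  set k : Fin (n + 1) → ℝ := fun α => ∑ β, h α β z * pd T β φ z with hk
  set a : Fin (n + 1) → ℝ := fun α => ∑ β, pd T α (h α β) z * pd T β φ z with ha
  set b : Fin (n + 1) → ℝ := fun α => ∑ β, metric h α β z * pd T α (pd T β φ) z with hb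
  set c : Fin (n + 1) → ℝ := fun α => ∑ γ, pd T α (X γ) z * pd T γ φ z with hc
  set e : Fin (n + 1) → ℝ := fun α => ∑ γ, X γ z * pd T α (pd T γ φ) z with he
  set d : Fin (n + 1) → ℝ :=
    fun α => ∑ β, ∑ γ, pd T α (h β γ) z * (pd T β φ z * pd T γ φ z) with hd
  set Q : ℝ := ∑ β, ∑ γ, metric h β γ z * (pd T β φ z * pd T γ φ z) with hQ
  have hgk : ∀ α, g α = sgn α * pd T α φ z + k α := fun α =>
    sum_metric_mul h α z fun β => pd T β φ z
  have hQg : Q = ∑ α, g α * pd T α φ z := by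
    simp only [hQ, hg, Finset.sum_mul]
    exact Finset.sum_congr rfl fun α _ => Finset.sum_congr rfl fun β _ => by ring
  have hf : ∀ α, ∑ β, ∑ γ, metric h β γ z * (pd T α (pd T β φ) z * pd T γ φ z
      + pd T β φ z * pd T α (pd T γ φ) z) = 2 * ∑ β, g β * pd T α (pd T β φ) z := by
    intro α
    simp only [mul_add, Finset.sum_add_distrib, two_mul]
    congr 1
    · simp only [hg, Finset.sum_mul]
      exact Finset.sum_congr rfl fun β _ => Finset.sum_congr rfl fun γ _ => by ring
    · rw [Finset.sum_comm]
      simp only [hg, Finset.sum_mul]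
      exact Finset.sum_congr rfl fun β _ => Finset.sum_congr rfl fun γ _ => by
        rw [hsym' γ β]; ring
  -- The terms with two derivatives on one factor and `X` undifferentiated cancel.
  have hcancel : ∑ α, g α * e α = ∑ α, X α z * ∑ β, g β * pd T α (pd T β φ) z := by
    simp only [he, Finset.mul_sum]
    rw [Finset.sum_comm]
    exact Finset.sum_congr rfl fun α _ => Finset.sum_congr rfl fun β _ => by
      rw [hu2 β α]; ring
  simp only [hf]
  have hexp : ∑ α, ((a α + b α) * K
      + g α * (c α + e α + (pd T α w z * φ z + w z * pd T α φ z))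
      - 1 / 2 * (pd T α (X α) z * Q + X α z * (d α + 2 * ∑ β, g β * pd T α (pd T β φ) z))
      - 1 / 2 * sgn α * (pd T α (pd T α w) z * φ z ^ 2 + pd T α w z * (2 * φ z * pd T α φ z)))
      = K * (∑ α, a α) + K * (∑ α, b α) + (∑ α, sgn α * pd T α φ z * c α) + (∑ α, k α * c α)
        + (∑ α, g α * e α) + φ z * (∑ α, k α * pd T α w z) + w z * (∑ α, g α * pd T α φ z)
        - 1 / 2 * (∑ α, pd T α (X α) z) * Q - 1 / 2 * (∑ α, X α z * d α)
        - (∑ α, X α z * ∑ β, g β * pd T α (pd T β φ) z)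
        - 1 / 2 * φ z ^ 2 * ∑ α, sgn α * pd T α (pd T α w) z := by
    rw [Finset.mul_sum (s := Finset.univ) (f := a), Finset.mul_sum (s := Finset.univ) (f := b),
      Finset.mul_sum (a := φ z), Finset.mul_sum (a := w z),
      mul_assoc (1 / 2 : ℝ) (∑ α, pd T α (X α) z) Q, Finset.sum_mul,
      Finset.mul_sum (s := Finset.univ) (f := fun α => pd T α (X α) z * Q),
      Finset.mul_sum (s := Finset.univ) (f := fun α => X α z * d α),
      Finset.mul_sum (a := 1 / 2 * φ z ^ 2)]
    simp only [← Finset.sum_add_distrib, ← Finset.sum_sub_distrib]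
    refine Finset.sum_congr rfl fun α _ => ?_
    rw [hgk α]
    ring
  have hQk : Q = (∑ α, sgn α * pd T α φ z ^ 2) + ∑ α, k α * pd T α φ z := by
    rw [hQg, ← Finset.sum_add_distrib]
    exact Finset.sum_congr rfl fun α _ => by rw [hgk α]; ring
  rw [hexp, hcancel, ← hQg, waveOp_eq_sum_metric]
  simp only [flatBulk, pertBulk, ← hK]
  rw [hQk]
  ring

/-! ### Radial functions and Hardy's inequality -/

theorem norm_sq_eq_sum {n : ℕ} (x : Space n) : ‖x‖ ^ 2 = ∑ a, x a ^ 2 := by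
  rw [EuclideanSpace.norm_sq_eq]
  simp

theorem coord_sq_le_norm_sq {n : ℕ} (x : Space n) (a : Fin n) : x a ^ 2 ≤ ‖x‖ ^ 2 := by
  rw [norm_sq_eq_sum]
  exact Finset.single_le_sum (f := fun a => x a ^ 2) (fun _ _ => sq_nonneg _) (Finset.mem_univ a)

theorem contDiff_add_norm_sq {n : ℕ} (δ : ℝ) {k : ℕ∞ω} :
    ContDiff ℝ k fun x : Space n => δ + ‖x‖ ^ 2 :=
  contDiff_const.add (contDiff_norm_sq ℝ)

theorem contDiff_coord {n : ℕ} (a : Fin n) {k : ℕ∞ω} : ContDiff ℝ k fun x : Space n => x a :=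
  (EuclideanSpace.proj (𝕜 := ℝ) a).contDiff

theorem fderiv_coord {n : ℕ} (x : Space n) (a b : Fin n) :
    fderiv ℝ (fun x : Space n => x b) x (spaceBasis a) = if a = b then 1 else 0 := by
  have h : HasFDerivAt (fun x : Space n => x b) (EuclideanSpace.proj (𝕜 := ℝ) b) x :=
    (EuclideanSpace.proj (𝕜 := ℝ) b).hasFDerivAt
  rw [h.fderiv]
  simp [spaceBasis, PiLp.single_apply, eq_comm]

theorem hasFDerivAt_radial {n : ℕ} {δ : ℝ} {p : ℝ → ℝ} {p' : ℝ} {x : Space n}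
    (hp : HasDerivAt p p' (δ + ‖x‖ ^ 2)) :
    HasFDerivAt (fun x : Space n => p (δ + ‖x‖ ^ 2)) (p' • (2 • innerSL ℝ x)) x :=
  HasDerivAt.comp_hasFDerivAt x hp (((hasStrictFDerivAt_norm_sq x).hasFDerivAt).const_add δ)

theorem fderiv_radial {n : ℕ} {δ : ℝ} {p : ℝ → ℝ} {p' : ℝ} {x : Space n}
    (hp : HasDerivAt p p' (δ + ‖x‖ ^ 2)) (a : Fin n) :
    fderiv ℝ (fun x : Space n => p (δ + ‖x‖ ^ 2)) x (spaceBasis a) = 2 * x a * p' := by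
  rw [(hasFDerivAt_radial hp).fderiv]
  simp [spaceBasis, PiLp.inner_apply, PiLp.single_apply]
  ring

theorem integral_fderiv_eq_zero {n : ℕ} {u : Space n → ℝ} {v : Space n}
    (hu : Differentiable ℝ u) (hi : Integrable u) (hi' : Integrable fun x => fderiv ℝ u x v) :
    ∫ x, fderiv ℝ u x v = 0 := by
  have := integral_mul_fderiv_eq_neg_fderiv_mul_of_integrable (μ := (volume : Measure (Space n)))
    (f := fun _ => (1 : ℝ)) (g := u) (v := v) (by simp) (by simpa using hi') (by simpa using hi)
    (fun x _ => differentiableAt_const _) (fun x _ => hu x)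
  simpa using this

/-- Hardy's inequality with the regularized weight `1 / (δ + |x|²)`, obtained by integrating the
divergence of `x u² / (δ + |x|²)`. -/
theorem hardy {n : ℕ} (hn : 3 ≤ n) {δ : ℝ} (hδ : 0 < δ) {u : Space n → ℝ} (hu : ContDiff ℝ 1 u)
    (hi : Integrable fun x => u x ^ 2)
    (hi' : ∀ a, Integrable fun x => fderiv ℝ u x (spaceBasis a) ^ 2) :
    Integrable (fun x => u x ^ 2 / (δ + ‖x‖ ^ 2)) ∧
      ∫ x, u x ^ 2 / (δ + ‖x‖ ^ 2) ≤ 4 * ∫ x, ∑ a, fderiv ℝ u x (spaceBasis a) ^ 2 := by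
  have hs : ∀ x : Space n, 0 < δ + ‖x‖ ^ 2 := fun x => by positivity
  have hδs : ∀ x : Space n, δ ≤ δ + ‖x‖ ^ 2 := fun x => by linarith [sq_nonneg ‖x‖]
  have hsc : Continuous fun x : Space n => δ + ‖x‖ ^ 2 := by fun_prop
  have hxs : ∀ (x : Space n) a, x a ^ 2 ≤ δ + ‖x‖ ^ 2 := fun x a => by
    linarith [coord_sq_le_norm_sq x a]
  have hI0 : Integrable (fun x => u x ^ 2 / (δ + ‖x‖ ^ 2)) := by
    refine (hi.div_const δ).mono'
      ((hu.continuous.pow 2).div hsc fun x => (hs x).ne').aestronglyMeasurable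
      (Filter.Eventually.of_forall fun x => ?_)
    rw [Real.norm_of_nonneg (div_nonneg (sq_nonneg _) (hs x).le)]
    exact div_le_div_of_nonneg_left (sq_nonneg _) hδ (hδs x)
  refine ⟨hI0, ?_⟩
  -- The field `Y = x u² / (δ + |x|²)`; `Z a` is the explicit form of `∂_a Y^a`.
  set Y : Fin n → Space n → ℝ := fun a x => x a * ((δ + ‖x‖ ^ 2)⁻¹ * u x ^ 2) with hY
  have hYd : ∀ a, ContDiff ℝ 1 (Y a) := fun a =>
    (contDiff_coord a).mul (((contDiff_add_norm_sq δ).inv fun x => (hs x).ne').mul (hu.pow 2))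
  set Z : Fin n → Space n → ℝ := fun a x => u x ^ 2 / (δ + ‖x‖ ^ 2)
    - 2 * x a ^ 2 * u x ^ 2 / (δ + ‖x‖ ^ 2) ^ 2
    + 2 * x a * u x * fderiv ℝ u x (spaceBasis a) / (δ + ‖x‖ ^ 2) with hZ
  have hYZ : ∀ a x, fderiv ℝ (Y a) x (spaceBasis a) = Z a x := by
    intro a x
    have e1 : HasFDerivAt (fun x : Space n => x a) (fderiv ℝ (fun x : Space n => x a) x) x :=
      ((contDiff_coord (k := 1) a).differentiable (by norm_num) x).hasFDerivAt
    have e2 := hasFDerivAt_radial (δ := δ) (x := x) (hasDerivAt_inv (hs x).ne')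
    have e2' := fderiv_radial (δ := δ) (x := x) (hasDerivAt_inv (hs x).ne') a
    have e3 := ((hu.differentiable (by norm_num) x).hasFDerivAt).pow 2
    have e4 : fderiv ℝ (Y a) x = _ := (e1.mul (e2.mul e3)).fderiv
    rw [e2.fderiv] at e2'
    rw [e4]
    simp only [add_apply, smul_apply, Pi.mul_apply, fderiv_coord, smul_eq_mul, if_true, nsmul_eq_mul] at e2' ⊢
    rw [e2']
    have := (hs x).ne'
    simp only [hZ]
    push_cast
    field_simp
    ring
  have hYi : ∀ a, Integrable (Y a) := by
    intro a
    refine (hi.const_mul (1 + 1 / δ)).mono' (hYd a).continuous.aestronglyMeasurable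
      (Filter.Eventually.of_forall fun x => ?_)
    have h1 : |x a| ≤ (1 + 1 / δ) * (δ + ‖x‖ ^ 2) := by
      have h2 : |x a| ≤ 1 + x a ^ 2 := by nlinarith [sq_abs (x a), sq_nonneg (|x a| - 1)]
      have h3 : (1 + 1 / δ) * (δ + ‖x‖ ^ 2) = δ + 1 + ‖x‖ ^ 2 + ‖x‖ ^ 2 / δ := by
        field_simp
        ring
      have h4 : 0 ≤ ‖x‖ ^ 2 / δ := by positivity
      have := coord_sq_le_norm_sq x a
      linarith
    rw [Real.norm_eq_abs, abs_mul, abs_of_nonneg (by have := hs x; positivity :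
      0 ≤ (δ + ‖x‖ ^ 2)⁻¹ * u x ^ 2), ← mul_assoc]
    gcongr
    rwa [← div_eq_mul_inv, div_le_iff₀ (hs x)]
  have hZb : ∀ a x, |Z a x| ≤ (1 + 3 / δ) * u x ^ 2
      + 1 / δ * fderiv ℝ u x (spaceBasis a) ^ 2 := by
    intro a x
    have k1 : u x ^ 2 / (δ + ‖x‖ ^ 2) ≤ u x ^ 2 / δ :=
      div_le_div_of_nonneg_left (sq_nonneg _) hδ (hδs x)
    have k1' : 0 ≤ u x ^ 2 / (δ + ‖x‖ ^ 2) := div_nonneg (sq_nonneg _) (hs x).le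
    have k2 : 2 * x a ^ 2 * u x ^ 2 / (δ + ‖x‖ ^ 2) ^ 2 ≤ 2 * (u x ^ 2 / (δ + ‖x‖ ^ 2)) := by
      rw [← mul_div_assoc, div_le_div_iff₀ (by have := hs x; positivity) (hs x)]
      have : 0 ≤ 2 * u x ^ 2 * (δ + ‖x‖ ^ 2) * (δ + ‖x‖ ^ 2 - x a ^ 2) :=
        mul_nonneg (by have := hs x; positivity) (by linarith [hxs x a])
      nlinarith
    have k2' : 0 ≤ 2 * x a ^ 2 * u x ^ 2 / (δ + ‖x‖ ^ 2) ^ 2 := by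
      have := hs x; positivity
    have k3 : |2 * x a * u x * fderiv ℝ u x (spaceBasis a) / (δ + ‖x‖ ^ 2)|
        ≤ u x ^ 2 + fderiv ℝ u x (spaceBasis a) ^ 2 / δ := by
      have h1 : |2 * x a * u x * fderiv ℝ u x (spaceBasis a)|
          ≤ x a ^ 2 * u x ^ 2 + fderiv ℝ u x (spaceBasis a) ^ 2 := by
        rw [abs_le]
        constructor <;>
          nlinarith [sq_nonneg (x a * u x + fderiv ℝ u x (spaceBasis a)),
            sq_nonneg (x a * u x - fderiv ℝ u x (spaceBasis a))]
      rw [abs_div, abs_of_pos (hs x)]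
      calc _ ≤ (x a ^ 2 * u x ^ 2 + fderiv ℝ u x (spaceBasis a) ^ 2) / (δ + ‖x‖ ^ 2) := by
            have := hs x
            gcongr
        _ = x a ^ 2 * u x ^ 2 / (δ + ‖x‖ ^ 2)
            + fderiv ℝ u x (spaceBasis a) ^ 2 / (δ + ‖x‖ ^ 2) := add_div _ _ _
        _ ≤ _ := by
            refine add_le_add ?_ (div_le_div_of_nonneg_left (sq_nonneg _) hδ (hδs x))
            rw [div_le_iff₀ (hs x), mul_comm]
            exact mul_le_mul_of_nonneg_left (hxs x a) (sq_nonneg _)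
    have e1 : (1 + 3 / δ) * u x ^ 2 + 1 / δ * fderiv ℝ u x (spaceBasis a) ^ 2
        = u x ^ 2 + 3 * (u x ^ 2 / δ) + fderiv ℝ u x (spaceBasis a) ^ 2 / δ := by ring
    rw [e1]
    have k4 := abs_le.1 k3
    simp only [hZ]
    rw [abs_le]
    constructor <;> linarith
  have hZc : ∀ a, Continuous (Z a) := by
    intro a
    have : Z a = fun x => fderiv ℝ (Y a) x (spaceBasis a) := funext fun x => (hYZ a x).symm
    rw [this]
    exact ((hYd a).continuous_fderiv (by norm_num)).clm_apply continuous_const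
  have hZi : ∀ a, Integrable (Z a) := fun a =>
    ((hi.const_mul _).add ((hi' a).const_mul _)).mono' (hZc a).aestronglyMeasurable
      (Filter.Eventually.of_forall fun x => hZb a x)
  have hZ0 : ∫ x, ∑ a, Z a x = 0 := by
    rw [integral_finsetSum _ fun a _ => hZi a]
    refine Finset.sum_eq_zero fun a _ => ?_
    have := integral_fderiv_eq_zero (v := spaceBasis a) ((hYd a).differentiable (by norm_num))
      (hYi a) (by simpa only [hYZ] using hZi a)
    simpa only [hYZ] using this
  have hgi : Integrable fun x => ∑ a, fderiv ℝ u x (spaceBasis a) ^ 2 :=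
    integrable_finsetSum _ fun a _ => hi' a
  -- Completing the square in each component; `n ≥ 3` beats the loss `5/2` from the square.
  have hpt : ∀ x, 1 / 2 * (u x ^ 2 / (δ + ‖x‖ ^ 2))
      - 2 * ∑ a, fderiv ℝ u x (spaceBasis a) ^ 2 ≤ ∑ a, Z a x := by
    intro x
    have h1 : ∀ a, u x ^ 2 / (δ + ‖x‖ ^ 2)
        - 5 / 2 * (x a ^ 2 * (u x ^ 2 / (δ + ‖x‖ ^ 2) ^ 2))
        - 2 * fderiv ℝ u x (spaceBasis a) ^ 2 ≤ Z a x := by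
      intro a
      have h2 := sq_nonneg (x a * u x / (δ + ‖x‖ ^ 2) + 2 * fderiv ℝ u x (spaceBasis a))
      have h3 : Z a x = u x ^ 2 / (δ + ‖x‖ ^ 2)
          - 2 * (x a ^ 2 * (u x ^ 2 / (δ + ‖x‖ ^ 2) ^ 2))
          + 2 * (x a * u x / (δ + ‖x‖ ^ 2)) * fderiv ℝ u x (spaceBasis a) := by
        simp only [hZ]; ring
      have h4 : (x a * u x / (δ + ‖x‖ ^ 2)) ^ 2 = x a ^ 2 * (u x ^ 2 / (δ + ‖x‖ ^ 2) ^ 2) := by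
        rw [div_pow, mul_pow, mul_div_assoc]
      nlinarith
    have h5 := Finset.sum_le_sum fun a (_ : a ∈ Finset.univ) => h1 a
    simp only [Finset.sum_sub_distrib, ← Finset.mul_sum, ← Finset.sum_mul, Finset.sum_const,
      Finset.card_univ, Fintype.card_fin, nsmul_eq_mul, ← norm_sq_eq_sum] at h5
    refine le_trans ?_ h5
    have h6 : ‖x‖ ^ 2 * (u x ^ 2 / (δ + ‖x‖ ^ 2) ^ 2) ≤ u x ^ 2 / (δ + ‖x‖ ^ 2) := by
      rw [← mul_div_assoc, div_le_div_iff₀ (by have := hs x; positivity) (hs x)]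
      have : 0 ≤ u x ^ 2 * (δ + ‖x‖ ^ 2) * δ := by have := hs x; positivity
      nlinarith
    have h7 : 3 * (u x ^ 2 / (δ + ‖x‖ ^ 2)) ≤ n * (u x ^ 2 / (δ + ‖x‖ ^ 2)) :=
      mul_le_mul_of_nonneg_right (by exact_mod_cast hn) (div_nonneg (sq_nonneg _) (hs x).le)
    linarith
  have hfin := integral_mono ((hI0.const_mul (1 / 2)).sub (hgi.const_mul 2))
    (integrable_finsetSum _ fun a _ => hZi a) hpt
  rw [hZ0] at hfin
  have hsub := integral_sub (hI0.const_mul (1 / 2)) (hgi.const_mul 2)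
  rw [integral_const_mul, integral_const_mul] at hsub
  have : (1 / 2) * (∫ x, u x ^ 2 / (δ + ‖x‖ ^ 2))
      - 2 * ∫ x, ∑ a, fderiv ℝ u x (spaceBasis a) ^ 2 ≤ 0 := hsub ▸ hfin
  linarith

/-! ### The radial profile of the multiplier -/

/-- The profile `p(σ) = σ^{μ-1/2} (R²+σ)^{-μ}`: with `σ = |x|²` the field `x p` is
`(r² / (R² + r²))^μ ∂_r`, which saturates at the scale `r ≈ R`. -/
def prof (μ R σ : ℝ) : ℝ := σ ^ (μ - 1 / 2) * (R ^ 2 + σ) ^ (-μ)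

/-- The derivative of the profile. -/
def prof₁ (μ R σ : ℝ) : ℝ := -(prof μ R σ * ((1 / 2 - μ) / σ + μ / (R ^ 2 + σ)))

/-- The second derivative of the profile. -/
def prof₂ (μ R σ : ℝ) : ℝ :=
  prof μ R σ * (((1 / 2 - μ) / σ + μ / (R ^ 2 + σ)) ^ 2
    + (1 / 2 - μ) / σ ^ 2 + μ / (R ^ 2 + σ) ^ 2)

theorem prof_pos (μ R : ℝ) {σ : ℝ} (hσ : 0 < σ) : 0 < prof μ R σ :=
  mul_pos (Real.rpow_pos_of_pos hσ _) (Real.rpow_pos_of_pos (by positivity) _)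

theorem hasDerivAt_prof (μ R : ℝ) {σ : ℝ} (hσ : 0 < σ) :
    HasDerivAt (prof μ R) (prof₁ μ R σ) σ := by
  have hR : 0 < R ^ 2 + σ := by positivity
  have h1 := Real.hasDerivAt_rpow_const (x := σ) (p := μ - 1 / 2) (Or.inl hσ.ne')
  have h2 := ((hasDerivAt_id σ).const_add (R ^ 2)).rpow_const (p := -μ) (Or.inl hR.ne')
  refine (h1.mul h2).congr_deriv ?_
  simp only [id, prof₁, prof]
  rw [Real.rpow_sub_one hσ.ne', Real.rpow_sub_one hR.ne']
  ring

theorem hasDerivAt_prof₁ (μ R : ℝ) {σ : ℝ} (hσ : 0 < σ) :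
    HasDerivAt (prof₁ μ R) (prof₂ μ R σ) σ := by
  have hR : 0 < R ^ 2 + σ := by positivity
  have h1 := (hasDerivAt_inv hσ.ne').const_mul (1 / 2 - μ)
  have h2 := (((hasDerivAt_id σ).const_add (R ^ 2)).inv hR.ne').const_mul μ
  refine ((hasDerivAt_prof μ R hσ).mul (h1.add h2)).neg.congr_deriv ?_
  simp only [id, prof₂, prof₁, Pi.add_apply, Pi.inv_apply]
  field_simp
  ring

theorem contDiffAt_prof (μ R : ℝ) {σ : ℝ} (hσ : 0 < σ) {k : ℕ∞ω} :
    ContDiffAt ℝ k (prof μ R) σ := by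
  have hR : R ^ 2 + σ ≠ 0 := by positivity
  exact (contDiffAt_id.rpow_const_of_ne hσ.ne').mul
    ((contDiffAt_const.add contDiffAt_id).rpow_const_of_ne hR)

theorem abs_prof₁_le {μ R σ : ℝ} (hμ0 : 0 < μ) (hμ1 : μ < 1 / 2) (hσ : 0 < σ) :
    |prof₁ μ R σ| ≤ prof μ R σ / (2 * σ) := by
  have hp := prof_pos μ R hσ
  have hR : 0 < R ^ 2 + σ := by positivity
  have h1 : 0 ≤ (1 / 2 - μ) / σ + μ / (R ^ 2 + σ) :=
    add_nonneg (div_nonneg (by linarith) hσ.le) (by positivity)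
  rw [prof₁, abs_neg, abs_of_nonneg (by positivity), div_eq_mul_inv (prof μ R σ)]
  refine mul_le_mul_of_nonneg_left ?_ hp.le
  have h2 : μ / (R ^ 2 + σ) ≤ μ / σ := by gcongr; nlinarith
  calc (1 / 2 - μ) / σ + μ / (R ^ 2 + σ) ≤ (1 / 2 - μ) / σ + μ / σ := by gcongr
    _ = (2 * σ)⁻¹ := by field_simp; ring

theorem prof₁_nonpos {μ R σ : ℝ} (hμ0 : 0 < μ) (hμ1 : μ < 1 / 2) (hσ : 0 < σ) :
    prof₁ μ R σ ≤ 0 := by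
  have hp := prof_pos μ R hσ
  have h1 : 0 ≤ (1 / 2 - μ) / σ + μ / (R ^ 2 + σ) :=
    add_nonneg (div_nonneg (by linarith) hσ.le) (by positivity)
  rw [prof₁]
  exact neg_nonpos.2 (by positivity)

/-- Lower bound for the radial derivative of `r p(r²)`. -/
theorem prof_add_prof₁_ge {μ R σ ρ : ℝ} (hμ0 : 0 < μ) (hμ1 : μ < 1 / 2) (hσ : 0 < σ)
    (hρσ : ρ ≤ σ) :
    2 * μ * (prof μ R σ * (R ^ 2 / (R ^ 2 + σ))) ≤ prof μ R σ + 2 * ρ * prof₁ μ R σ := by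
  have hp := prof_pos μ R hσ
  have hR : 0 < R ^ 2 + σ := by positivity
  have h1 := mul_le_mul_of_nonpos_right hρσ (prof₁_nonpos (R := R) hμ0 hμ1 hσ)
  have h2 : prof μ R σ + 2 * σ * prof₁ μ R σ
      = 2 * μ * (prof μ R σ * (R ^ 2 / (R ^ 2 + σ))) := by
    rw [prof₁]
    field_simp
    ring
  linarith

/-- Superharmonicity of the profile in dimension at least three. -/
theorem neg_laplacian_prof_ge {n : ℕ} (hn : 3 ≤ n) {μ R σ ρ : ℝ} (hμ0 : 0 < μ) (hμ1 : μ < 1 / 2)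
    (hσ : 0 < σ) (hρσ : ρ ≤ σ) :
    4 * (1 / 2 - μ) * μ * (prof μ R σ * (R ^ 2 / (R ^ 2 + σ)) / σ)
      ≤ -(2 * n * prof₁ μ R σ + 4 * ρ * prof₂ μ R σ) := by
  have hp := prof_pos μ R hσ
  have hR : 0 < R ^ 2 + σ := by positivity
  have hν : 0 < 1 / 2 - μ := by linarith
  have h2 : 0 ≤ prof₂ μ R σ := by
    rw [prof₂]
    positivity
  have h1 := mul_le_mul_of_nonneg_right hρσ h2
  have h3 := mul_le_mul_of_nonpos_right (show (3 : ℝ) ≤ n by exact_mod_cast hn)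
    (prof₁_nonpos (R := R) hμ0 hμ1 hσ)
  suffices h : 4 * (1 / 2 - μ) * μ * (prof μ R σ * (R ^ 2 / (R ^ 2 + σ)) / σ)
      ≤ -(6 * prof₁ μ R σ + 4 * σ * prof₂ μ R σ) by linarith
  -- In terms of `θ = σ / (R² + σ)` the difference is a concave quadratic vanishing at `θ = 0, 1`.
  set θ := σ / (R ^ 2 + σ) with hθ
  have hθ0 : 0 ≤ θ := by positivity
  have hθ1 : θ ≤ 1 := by rw [hθ, div_le_one hR]; nlinarith
  have e1 : R ^ 2 / (R ^ 2 + σ) = 1 - θ := by rw [hθ]; field_simp; ring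
  have e2 : μ / (R ^ 2 + σ) = μ * θ / σ := by rw [hθ]; field_simp
  have e3 : μ / (R ^ 2 + σ) ^ 2 = μ * θ ^ 2 / σ ^ 2 := by rw [hθ]; field_simp
  have e4 : -(6 * prof₁ μ R σ + 4 * σ * prof₂ μ R σ)
      = prof μ R σ / σ * (6 * (1 / 2 - μ + μ * θ)
          - 4 * ((1 / 2 - μ + μ * θ) ^ 2 + (1 / 2 - μ) + μ * θ ^ 2)) := by
    rw [prof₁, prof₂, e2, e3]
    field_simp
    ring
  rw [e4, e1, show 4 * (1 / 2 - μ) * μ * (prof μ R σ * (1 - θ) / σ)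
    = prof μ R σ / σ * (4 * (1 / 2 - μ) * μ * (1 - θ)) by ring]
  refine mul_le_mul_of_nonneg_left ?_ (by positivity)
  have h4 : 0 ≤ μ * (θ * (1 - θ)) := mul_nonneg hμ0.le (mul_nonneg hθ0 (by linarith))
  nlinarith [mul_nonneg hμ0.le h4]

theorem prof_mul_le_one {μ R σ r : ℝ} (hμ0 : 0 < μ) (hσ : 0 < σ) (hr : 0 ≤ r)
    (hrσ : r ^ 2 ≤ σ) : prof μ R σ * r ≤ 1 := by
  have h1 : (R ^ 2 + σ) ^ (-μ) ≤ σ ^ (-μ) :=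
    Real.rpow_le_rpow_of_nonpos hσ (by nlinarith) (by linarith)
  have h2 : prof μ R σ ≤ (Real.sqrt σ)⁻¹ := by
    calc prof μ R σ ≤ σ ^ (μ - 1 / 2) * σ ^ (-μ) := by
          rw [prof]; gcongr
      _ = (Real.sqrt σ)⁻¹ := by
          rw [← Real.rpow_add hσ, Real.sqrt_eq_rpow, ← Real.rpow_neg hσ.le]
          ring_nf
  have h3 : r ≤ Real.sqrt σ := Real.le_sqrt_of_sq_le hrσ
  have h4 := Real.sqrt_pos.2 hσ
  calc prof μ R σ * r ≤ (Real.sqrt σ)⁻¹ * Real.sqrt σ := by gcongr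
    _ = 1 := inv_mul_cancel₀ h4.ne'

theorem prof_sq_le {μ R σ : ℝ} (hμ0 : 0 < μ) (hσ : 0 < σ) : prof μ R σ ^ 2 ≤ 1 / σ := by
  have h := prof_mul_le_one (R := R) hμ0 hσ (Real.sqrt_nonneg σ) (Real.sq_sqrt hσ.le).le
  have h1 := mul_nonneg (prof_pos μ R hσ).le (Real.sqrt_nonneg σ)
  rw [le_div_iff₀ hσ]
  calc prof μ R σ ^ 2 * σ = (prof μ R σ * Real.sqrt σ) ^ 2 := by
        rw [mul_pow, Real.sq_sqrt hσ.le]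
    _ ≤ 1 := pow_le_one₀ h1 h

theorem prof_le_weight {μ R δ r : ℝ} (hμ0 : 0 < μ) (hμ1 : μ < 1 / 2) (hδ : 0 ≤ δ) (hR : 1 ≤ R)
    (hr : 0 < r) :
    prof μ R (δ + r ^ 2) ≤ 1 / (r ^ (1 - 2 * μ) * Real.sqrt (1 + r ^ 2) ^ (2 * μ)) := by
  have h1 : (δ + r ^ 2) ^ (μ - 1 / 2) ≤ (r ^ 2) ^ (μ - 1 / 2) :=
    Real.rpow_le_rpow_of_nonpos (by positivity) (by linarith) (by linarith)
  have h2 : (R ^ 2 + (δ + r ^ 2)) ^ (-μ) ≤ (1 + r ^ 2) ^ (-μ) :=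
    Real.rpow_le_rpow_of_nonpos (by positivity) (by nlinarith) (by linarith)
  have h3 : (r ^ 2) ^ (μ - 1 / 2) = (r ^ (1 - 2 * μ))⁻¹ := by
    rw [← Real.rpow_natCast, ← Real.rpow_mul hr.le, ← Real.rpow_neg hr.le]
    congr 1; push_cast; ring
  have h4 : (1 + r ^ 2) ^ (-μ) = (Real.sqrt (1 + r ^ 2) ^ (2 * μ))⁻¹ := by
    rw [Real.sqrt_eq_rpow, ← Real.rpow_mul (by positivity), ← Real.rpow_neg (by positivity)]
    congr 1; ring
  rw [one_div, mul_inv, ← h3, ← h4, prof]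
  gcongr

/-! ### The energy–Morawetz multiplier -/

theorem pd_comp_snd {n : ℕ} {T : ℝ} (hT : 0 < T) {v : Space n → ℝ} {z : SpaceTime n}
    (hz : z ∈ closedSlab n T) (hv : DifferentiableAt ℝ v z.2) (α : Fin (n + 1)) :
    pd T α (fun z => v z.2) z = fderiv ℝ v z.2 (stBasis α).2 := by
  have h1 : HasFDerivAt (fun z : SpaceTime n => v z.2)
      ((fderiv ℝ v z.2).comp (ContinuousLinearMap.snd ℝ ℝ (Space n))) z :=
    hv.hasFDerivAt.comp z hasFDerivAt_snd
  rw [pd, h1.hasFDerivWithinAt.fderivWithin (uniqueDiffOn_closedSlab n hT z hz)]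
  rfl

theorem pd_zero_comp_snd {n : ℕ} {T : ℝ} (hT : 0 < T) {v : Space n → ℝ} {z : SpaceTime n}
    (hz : z ∈ closedSlab n T) (hv : DifferentiableAt ℝ v z.2) :
    pd T 0 (fun z => v z.2) z = 0 := by
  rw [pd_comp_snd hT hz hv, stBasis_zero, map_zero]

/-- The vector field `A ∂_t + p x·∇` with the radial profile `p` evaluated at `δ + |x|²`. -/
def radialField (n : ℕ) (A μ R δ : ℝ) (α : Fin (n + 1)) (z : SpaceTime n) : ℝ :=
  Fin.cases A (fun a => z.2 a * prof μ R (δ + ‖z.2‖ ^ 2)) α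

/-- The zeroth-order coefficient `(n-1)/2 · p` of the multiplier. -/
def radialWeight (n : ℕ) (μ R δ : ℝ) (z : SpaceTime n) : ℝ :=
  ((n : ℝ) - 1) / 2 * prof μ R (δ + ‖z.2‖ ^ 2)

theorem contDiff_radial {n : ℕ} {δ : ℝ} (hδ : 0 < δ) (μ R : ℝ) {k : ℕ∞ω} :
    ContDiff ℝ k fun x : Space n => prof μ R (δ + ‖x‖ ^ 2) := by
  rw [contDiff_iff_contDiffAt]
  intro x
  exact (contDiffAt_prof μ R (by positivity : 0 < δ + ‖x‖ ^ 2)).comp x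
    (contDiff_add_norm_sq δ).contDiffAt

theorem contDiff_radialField {n : ℕ} {δ : ℝ} (hδ : 0 < δ) (A μ R : ℝ) (α : Fin (n + 1))
    {k : ℕ∞ω} : ContDiff ℝ k (radialField n A μ R δ α) := by
  refine Fin.cases ?_ (fun a => ?_) α
  · exact contDiff_const
  · exact ((contDiff_coord a).mul (contDiff_radial hδ μ R)).comp contDiff_snd

theorem contDiff_radialWeight {n : ℕ} {δ : ℝ} (hδ : 0 < δ) (μ R : ℝ) {k : ℕ∞ω} :
    ContDiff ℝ k (radialWeight n μ R δ) :=
  contDiff_const.mul ((contDiff_radial hδ μ R).comp contDiff_snd)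

theorem hasFDerivAt_coord_mul_radial {n : ℕ} {δ : ℝ} {q : ℝ → ℝ} {q' : ℝ} {x : Space n}
    (hq : HasDerivAt q q' (δ + ‖x‖ ^ 2)) (b : Fin n) :
    DifferentiableAt ℝ (fun x : Space n => x b * q (δ + ‖x‖ ^ 2)) x ∧
    ∀ a, fderiv ℝ (fun x : Space n => x b * q (δ + ‖x‖ ^ 2)) x (spaceBasis a)
      = (if a = b then q (δ + ‖x‖ ^ 2) else 0) + 2 * x a * x b * q' := by
  have e1 : HasFDerivAt (fun x : Space n => x b) (fderiv ℝ (fun x : Space n => x b) x) x :=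
    ((contDiff_coord (k := 1) b).differentiable (by norm_num) x).hasFDerivAt
  have e2 := hasFDerivAt_radial hq
  refine ⟨(e1.fun_mul e2).differentiableAt, fun a => ?_⟩
  have e3 := fderiv_radial hq a
  rw [e2.fderiv] at e3
  rw [(e1.fun_mul e2).fderiv]
  change x b * (q' • 2 • innerSL ℝ x) (spaceBasis a)
    + q (δ + ‖x‖ ^ 2) * fderiv ℝ (fun x : Space n => x b) x (spaceBasis a) = _
  rw [e3, fderiv_coord]
  split_ifs <;> ring

section values

variable {n : ℕ} {T A μ R δ : ℝ} {z : SpaceTime n}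

theorem pd_radialField_zero (hT : 0 < T) (hz : z ∈ closedSlab n T) (α : Fin (n + 1)) :
    pd T α (radialField n A μ R δ 0) z = 0 := by
  have := pd_comp_snd (v := fun _ : Space n => A) hT hz (differentiableAt_const _) α
  exact this.trans (by simp)

theorem pd_zero_radialField (hT : 0 < T) (hδ : 0 < δ) (hz : z ∈ closedSlab n T)
    (γ : Fin (n + 1)) : pd T 0 (radialField n A μ R δ γ) z = 0 := by
  refine Fin.cases ?_ (fun b => ?_) γ
  · exact pd_radialField_zero hT hz 0
  · exact pd_zero_comp_snd hT hz (hasFDerivAt_coord_mul_radial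
      (hasDerivAt_prof μ R (by positivity : 0 < δ + ‖z.2‖ ^ 2)) b).1

theorem pd_succ_radialField (hT : 0 < T) (hδ : 0 < δ) (hz : z ∈ closedSlab n T)
    (a b : Fin n) : pd T a.succ (radialField n A μ R δ b.succ) z
      = (if a = b then prof μ R (δ + ‖z.2‖ ^ 2) else 0)
        + 2 * z.2 a * z.2 b * prof₁ μ R (δ + ‖z.2‖ ^ 2) := by
  have h := hasFDerivAt_coord_mul_radial
    (hasDerivAt_prof μ R (by positivity : 0 < δ + ‖z.2‖ ^ 2)) b
  rw [← h.2 a]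
  exact pd_comp_snd hT hz h.1 a.succ

theorem pd_zero_radialWeight (hT : 0 < T) (hδ : 0 < δ) (hz : z ∈ closedSlab n T) :
    pd T 0 (radialWeight n μ R δ) z = 0 :=
  pd_zero_comp_snd (v := fun x : Space n => ((n : ℝ) - 1) / 2 * prof μ R (δ + ‖x‖ ^ 2)) hT hz
    ((contDiff_const.mul (contDiff_radial (k := 1) hδ μ R)).differentiable (by norm_num) _)

theorem pd_succ_radialWeight (hT : 0 < T) (hδ : 0 < δ) (hz : z ∈ closedSlab n T) (a : Fin n) :
    pd T a.succ (radialWeight n μ R δ) z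
      = ((n : ℝ) - 1) * (z.2 a * prof₁ μ R (δ + ‖z.2‖ ^ 2)) := by
  have hp := hasDerivAt_prof μ R (by positivity : 0 < δ + ‖z.2‖ ^ 2)
  have h1 := pd_comp_snd (v := fun x : Space n => ((n : ℝ) - 1) / 2 * prof μ R (δ + ‖x‖ ^ 2)) hT hz
    ((contDiff_const.mul (contDiff_radial (k := 1) hδ μ R)).differentiable (by norm_num) _) a.succ
  refine Eq.trans h1 ?_
  rw [fderiv_const_mul (hasFDerivAt_radial hp).differentiableAt, smul_apply, stBasis_succ,
    fderiv_radial hp]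
  simp only [smul_eq_mul]
  ring

theorem pd_pd_radialWeight (hT : 0 < T) (hδ : 0 < δ) (hz : z ∈ closedSlab n T) (a : Fin n) :
    pd T a.succ (pd T a.succ (radialWeight n μ R δ)) z
      = ((n : ℝ) - 1) * (prof₁ μ R (δ + ‖z.2‖ ^ 2)
          + 2 * z.2 a ^ 2 * prof₂ μ R (δ + ‖z.2‖ ^ 2)) := by
  have h := hasFDerivAt_coord_mul_radial
    (hasDerivAt_prof₁ μ R (by positivity : 0 < δ + ‖z.2‖ ^ 2)) a
  have h1 : pd T a.succ (pd T a.succ (radialWeight n μ R δ)) z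
      = pd T a.succ (fun z : SpaceTime n =>
          ((n : ℝ) - 1) * (z.2 a * prof₁ μ R (δ + ‖z.2‖ ^ 2))) z := by
    rw [pd, fderivWithin_congr (fun y hy => pd_succ_radialWeight hT hδ hy a)
      (pd_succ_radialWeight hT hδ hz a)]
    rfl
  have h2 := pd_comp_snd
    (v := fun x : Space n => ((n : ℝ) - 1) * (x a * prof₁ μ R (δ + ‖x‖ ^ 2))) hT hz
    (h.1.const_mul _) a.succ
  refine h1.trans (h2.trans ?_)
  rw [fderiv_const_mul h.1, smul_apply, stBasis_succ, h.2]
  simp only [if_true, smul_eq_mul]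
  ring

theorem pd_zero_pd_zero_radialWeight (hT : 0 < T) (hδ : 0 < δ) (hz : z ∈ closedSlab n T) :
    pd T 0 (pd T 0 (radialWeight n μ R δ)) z = 0 := by
  have h1 : pd T 0 (pd T 0 (radialWeight n μ R δ)) z = pd T 0 (fun _ : SpaceTime n => (0 : ℝ)) z := by
    rw [pd, fderivWithin_congr (fun y hy => pd_zero_radialWeight hT hδ hy)
      (pd_zero_radialWeight hT hδ hz)]
    rfl
  rw [h1, pd]
  simp

end values

theorem normD_nonneg {n : ℕ} (T : ℝ) (φ : SpaceTime n → ℝ) (z : SpaceTime n) :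
    0 ≤ normD T φ z := Real.sqrt_nonneg _

theorem normD_sq {n : ℕ} (T : ℝ) (φ : SpaceTime n → ℝ) (z : SpaceTime n) :
    normD T φ z ^ 2 = ∑ α, pd T α φ z ^ 2 :=
  Real.sq_sqrt (Finset.sum_nonneg fun _ _ => sq_nonneg _)

theorem abs_pd_le_normD {n : ℕ} (T : ℝ) (φ : SpaceTime n → ℝ) (z : SpaceTime n)
    (α : Fin (n + 1)) : |pd T α φ z| ≤ normD T φ z := by
  refine Real.abs_le_sqrt ?_
  exact Finset.single_le_sum (f := fun α => pd T α φ z ^ 2) (fun _ _ => sq_nonneg _)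
    (Finset.mem_univ α)

theorem abs_le_normH {n : ℕ} (h : Fin (n + 1) → Fin (n + 1) → SpaceTime n → ℝ)
    (z : SpaceTime n) (α β : Fin (n + 1)) : |h α β z| ≤ normH h z := by
  refine Real.abs_le_sqrt ?_
  refine le_trans ?_ (Finset.single_le_sum (f := fun α => ∑ β, h α β z ^ 2)
    (fun _ _ => Finset.sum_nonneg fun _ _ => sq_nonneg _) (Finset.mem_univ α))
  exact Finset.single_le_sum (f := fun β => h α β z ^ 2) (fun _ _ => sq_nonneg _)
    (Finset.mem_univ β)

theorem abs_pd_le_normDH {n : ℕ} (T : ℝ) (h : Fin (n + 1) → Fin (n + 1) → SpaceTime n → ℝ)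
    (z : SpaceTime n) (γ α β : Fin (n + 1)) : |pd T γ (h α β) z| ≤ normDH T h z := by
  refine Real.abs_le_sqrt ?_
  have n0 : ∀ γ α, 0 ≤ ∑ β, pd T γ (h α β) z ^ 2 := fun _ _ =>
    Finset.sum_nonneg fun _ _ => sq_nonneg _
  refine le_trans ?_ (Finset.single_le_sum (f := fun γ => ∑ α, ∑ β, pd T γ (h α β) z ^ 2)
    (fun _ _ => Finset.sum_nonneg fun _ _ => n0 _ _) (Finset.mem_univ γ))
  refine le_trans ?_ (Finset.single_le_sum (f := fun α => ∑ β, pd T γ (h α β) z ^ 2)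
    (fun _ _ => n0 _ _) (Finset.mem_univ α))
  exact Finset.single_le_sum (f := fun β => pd T γ (h α β) z ^ 2) (fun _ _ => sq_nonneg _)
    (Finset.mem_univ β)

theorem normH_nonneg {n : ℕ} (h : Fin (n + 1) → Fin (n + 1) → SpaceTime n → ℝ)
    (z : SpaceTime n) : 0 ≤ normH h z := Real.sqrt_nonneg _

theorem normDH_nonneg {n : ℕ} (T : ℝ) (h : Fin (n + 1) → Fin (n + 1) → SpaceTime n → ℝ)
    (z : SpaceTime n) : 0 ≤ normDH T h z := Real.sqrt_nonneg _

/-- The weight which the multiplier identity controls in the interior of the slab. It is comparable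
to `R^{-2μ} r^{2μ-1}` for `δ = 0` and `r ≤ R`. -/
def bulkWeight (μ R δ : ℝ) {n : ℕ} (z : SpaceTime n) : ℝ :=
  prof μ R (δ + ‖z.2‖ ^ 2) * (R ^ 2 / (R ^ 2 + (δ + ‖z.2‖ ^ 2)))

/-- The density `|∂φ|² + φ² / (δ + r²)`. -/
def hardyDensity {n : ℕ} (T δ : ℝ) (φ : SpaceTime n → ℝ) (z : SpaceTime n) : ℝ :=
  normD T φ z ^ 2 + φ z ^ 2 / (δ + ‖z.2‖ ^ 2)

/-- The pointwise algebra behind `flatBulk_le`: `S`, `Y`, `q`, `v` stand for `|∇φ|²`,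
`x·∇φ`, `(∂_t φ)²` and `φ²`. -/
theorem flatBulk_arith {n : ℕ} (hn : 3 ≤ n) {μ p p₁ p₂ θ ρ s S Y q v : ℝ} (hμ0 : 0 < μ)
    (hμ1 : μ < 1 / 2) (hs : 0 < s) (g1 : 2 * μ * (p * θ) ≤ p + 2 * ρ * p₁)
    (g2 : 4 * (1 / 2 - μ) * μ * (p * θ / s) ≤ -(2 * n * p₁ + 4 * ρ * p₂)) (g3 : p₁ ≤ 0)
    (hpθ : 0 ≤ p * θ) (hCS : Y ^ 2 ≤ ρ * S) (hv : 0 ≤ v) (hqS : 0 ≤ q + S) :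
    -(p * S) - 2 * p₁ * Y ^ 2 - 1 / 2 * (p + 2 * ρ * p₁) * (q - S)
        - ((n : ℝ) - 1) / 4 * (v * -(2 * n * p₁ + 4 * ρ * p₂))
      ≤ -(μ * (1 - 2 * μ) * (p * θ * (q + S + v / s))) := by
  have hn' : (3 : ℝ) ≤ n := by exact_mod_cast hn
  have k1 := mul_le_mul_of_nonneg_right g1 hqS
  have k2 := mul_le_mul_of_nonpos_left hCS g3
  have hbs : 0 ≤ p * θ / s := div_nonneg hpθ hs.le
  have hL0 := le_trans (mul_nonneg (mul_nonneg (by linarith) hμ0.le) hbs) g2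
  generalize hL : -(2 * n * p₁ + 4 * ρ * p₂) = L at *
  have k3 : μ * (1 - 2 * μ) * (p * θ * (v / s)) ≤ ((n : ℝ) - 1) / 4 * (v * L) := by
    have e1 : μ * (1 - 2 * μ) * (p * θ * (v / s))
        = 1 / 2 * (v * (4 * (1 / 2 - μ) * μ * (p * θ / s))) := by ring
    rw [e1]
    refine mul_le_mul (by linarith) (mul_le_mul_of_nonneg_left g2 hv) ?_ (by linarith)
    exact mul_nonneg hv (mul_nonneg (mul_nonneg (by linarith) hμ0.le) hbs)
  have k4 : μ * (1 - 2 * μ) * (p * θ * (q + S)) ≤ μ * (p * θ * (q + S)) := by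
    have h5 : 0 ≤ μ * μ * (p * θ * (q + S)) := by positivity
    linarith
  have e5 : μ * (1 - 2 * μ) * (p * θ * (q + S + v / s))
      = μ * (1 - 2 * μ) * (p * θ * (q + S)) + μ * (1 - 2 * μ) * (p * θ * (v / s)) := by ring
  rw [e5]
  linarith

/-- The flat bulk is negative definite: the gradient terms by monotonicity of `r p(r²)`, together
with Cauchy–Schwarz for the radial derivative, the zeroth-order term by superharmonicity of `p`.
The time component `A` does not enter. -/
theorem flatBulk_le {n : ℕ} (hn : 3 ≤ n) {T A μ R δ : ℝ} (hT : 0 < T) (hμ0 : 0 < μ)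
    (hμ1 : μ < 1 / 2) (hδ : 0 < δ) (φ : SpaceTime n → ℝ) {z : SpaceTime n}
    (hz : z ∈ openSlab n T) :
    flatBulk T (radialField n A μ R δ) (radialWeight n μ R δ) φ z
      ≤ -(μ * (1 - 2 * μ) * (bulkWeight μ R δ z * hardyDensity T δ φ z)) := by
  have hz' := openSlab_subset_closedSlab n T hz
  have hs : 0 < δ + ‖z.2‖ ^ 2 := by positivity
  have hρ : ‖z.2‖ ^ 2 ≤ δ + ‖z.2‖ ^ 2 := by linarith
  have g1 := prof_add_prof₁_ge (R := R) hμ0 hμ1 hs hρ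
  have g2 := neg_laplacian_prof_ge (R := R) hn hμ0 hμ1 hs hρ
  have g3 := prof₁_nonpos (R := R) hμ0 hμ1 hs
  have hp := prof_pos μ R hs
  set p := prof μ R (δ + ‖z.2‖ ^ 2) with hpdef
  set p₁ := prof₁ μ R (δ + ‖z.2‖ ^ 2) with hp₁def
  set p₂ := prof₂ μ R (δ + ‖z.2‖ ^ 2) with hp₂def
  set u₀ := pd T 0 φ z with hu₀
  set u : Fin n → ℝ := fun a => pd T a.succ φ z with hu
  set S := ∑ a, u a ^ 2 with hS
  set Y := ∑ a, z.2 a * u a with hY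
  have hD : normD T φ z ^ 2 = u₀ ^ 2 + S := by
    rw [normD_sq, Fin.sum_univ_succ]
  have hCS : Y ^ 2 ≤ ‖z.2‖ ^ 2 * S := by
    rw [norm_sq_eq_sum]
    exact Finset.sum_mul_sq_le_sq_mul_sq _ _ _
  have f1 : ∑ α, sgn α * pd T α φ z * ∑ γ, pd T α (radialField n A μ R δ γ) z * pd T γ φ z
      = -(p * S) - 2 * p₁ * Y ^ 2 := by
    rw [Fin.sum_univ_succ]
    simp only [pd_zero_radialField hT hδ hz', zero_mul, Finset.sum_const_zero, mul_zero, zero_add]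
    have : ∀ a : Fin n, sgn a.succ * pd T a.succ φ z
        * ∑ γ, pd T a.succ (radialField n A μ R δ γ) z * pd T γ φ z
        = -(p * u a ^ 2) - 2 * p₁ * Y * (z.2 a * u a) := by
      intro a
      rw [Fin.sum_univ_succ, pd_radialField_zero hT hz']
      simp only [pd_succ_radialField hT hδ hz', add_mul, Finset.sum_add_distrib, ite_mul, zero_mul,
        Finset.sum_ite_eq, Finset.mem_univ, if_true, zero_add]
      have e : ∑ b, 2 * z.2 a * z.2 b * p₁ * pd T b.succ φ z = 2 * z.2 a * p₁ * Y := by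
        rw [hY, Finset.mul_sum]
        exact Finset.sum_congr rfl fun b _ => by simp only [hu]; ring
      rw [e]
      simp only [sgn, Fin.succ_ne_zero, if_false, hu]
      ring
    rw [Finset.sum_congr rfl fun a _ => this a, Finset.sum_sub_distrib, Finset.sum_neg_distrib,
      ← Finset.mul_sum, ← Finset.mul_sum]
    ring
  have f2 : ∑ α, pd T α (radialField n A μ R δ α) z = n * p + 2 * p₁ * ‖z.2‖ ^ 2 := by
    rw [Fin.sum_univ_succ, pd_radialField_zero hT hz', norm_sq_eq_sum]
    simp only [pd_succ_radialField hT hδ hz', if_true, Finset.sum_add_distrib, Finset.mul_sum]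
    simp only [Finset.sum_const, Finset.card_univ, Fintype.card_fin, nsmul_eq_mul, zero_add]
    congr 1
    exact Finset.sum_congr rfl fun a _ => by ring
  have f3 : ∑ α, sgn α * pd T α φ z ^ 2 = u₀ ^ 2 - S := by
    rw [Fin.sum_univ_succ]
    simp [sgn, Fin.succ_ne_zero, hS, hu, hu₀, sub_eq_add_neg]
  have f4 : ∑ α, sgn α * pd T α (pd T α (radialWeight n μ R δ)) z
      = -(((n : ℝ) - 1) * (n * p₁ + 2 * ‖z.2‖ ^ 2 * p₂)) := by
    rw [Fin.sum_univ_succ, pd_zero_pd_zero_radialWeight hT hδ hz', norm_sq_eq_sum]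
    simp only [pd_pd_radialWeight hT hδ hz', sgn, Fin.succ_ne_zero, if_false, mul_zero, zero_add,
      neg_one_mul, Finset.sum_neg_distrib, ← Finset.mul_sum, Finset.sum_add_distrib,
      ← Finset.sum_mul]
    simp only [Finset.sum_const, Finset.card_univ, Fintype.card_fin, nsmul_eq_mul,
      ← hp₁def, ← hp₂def]
  have hval : flatBulk T (radialField n A μ R δ) (radialWeight n μ R δ) φ z
      = -(p * S) - 2 * p₁ * Y ^ 2 - 1 / 2 * (p + 2 * ‖z.2‖ ^ 2 * p₁) * (u₀ ^ 2 - S)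
        - ((n : ℝ) - 1) / 4 * (φ z ^ 2 * -(2 * n * p₁ + 4 * ‖z.2‖ ^ 2 * p₂)) := by
    rw [flatBulk, f1, f2, f3, f4, radialWeight]
    ring
  rw [hval, hardyDensity, hD]
  exact flatBulk_arith hn hμ0 hμ1 hs g1 g2 g3 (by positivity) hCS (sq_nonneg _)
    (by rw [← hD]; positivity)

/-! ### Pointwise bounds for the multiplier and the current -/

theorem abs_sum_fin_le {m : ℕ} {f : Fin m → ℝ} {c : ℝ} (h : ∀ i, |f i| ≤ c) :
    |∑ i, f i| ≤ m * c := by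
  refine (Finset.abs_sum_le_sum_abs _ _).trans ?_
  refine (Finset.sum_le_card_nsmul _ _ c fun i _ => h i).trans ?_
  simp

section bounds

variable {n : ℕ} {T A μ R δ : ℝ} {z : SpaceTime n}

theorem prof_mul_abs_coord_le (hμ0 : 0 < μ) (hδ : 0 < δ) (x : Space n) (a : Fin n) :
    prof μ R (δ + ‖x‖ ^ 2) * |x a| ≤ 1 := by
  refine prof_mul_le_one hμ0 (by positivity) (abs_nonneg _) ?_
  rw [sq_abs]
  linarith [coord_sq_le_norm_sq x a]

theorem abs_radialField_le (hA : 0 ≤ A) (hμ0 : 0 < μ) (hδ : 0 < δ) (α : Fin (n + 1)) :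
    |radialField n A μ R δ α z| ≤ A + 1 := by
  refine Fin.cases ?_ (fun a => ?_) α
  · simp only [radialField, Fin.cases_zero, abs_of_nonneg hA]
    linarith
  · have h := prof_mul_abs_coord_le (R := R) hμ0 hδ z.2 a
    have hp := prof_pos μ R (by positivity : 0 < δ + ‖z.2‖ ^ 2)
    simp only [radialField, Fin.cases_succ, abs_mul, abs_of_pos hp]
    linarith

theorem abs_pd_radialField_le (hT : 0 < T) (hμ0 : 0 < μ) (hμ1 : μ < 1 / 2) (hδ : 0 < δ)
    (hz : z ∈ closedSlab n T) (α γ : Fin (n + 1)) :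
    |pd T α (radialField n A μ R δ γ) z| ≤ 2 * prof μ R (δ + ‖z.2‖ ^ 2) := by
  have hs : 0 < δ + ‖z.2‖ ^ 2 := by positivity
  have hp := prof_pos μ R hs
  refine Fin.cases ?_ (fun a => ?_) α
  · rw [pd_zero_radialField hT hδ hz, abs_zero]
    positivity
  refine Fin.cases ?_ (fun b => ?_) γ
  · rw [pd_radialField_zero hT hz, abs_zero]
    positivity
  rw [pd_succ_radialField hT hδ hz]
  have h1 := abs_prof₁_le (R := R) hμ0 hμ1 hs
  have h2 : |z.2 a * z.2 b| ≤ δ + ‖z.2‖ ^ 2 := by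
    have ha := coord_sq_le_norm_sq z.2 a
    have hb := coord_sq_le_norm_sq z.2 b
    rw [abs_le]
    constructor <;> nlinarith [sq_nonneg (z.2 a + z.2 b), sq_nonneg (z.2 a - z.2 b)]
  have h3 : |2 * z.2 a * z.2 b * prof₁ μ R (δ + ‖z.2‖ ^ 2)| ≤ prof μ R (δ + ‖z.2‖ ^ 2) := by
    rw [show 2 * z.2 a * z.2 b * prof₁ μ R (δ + ‖z.2‖ ^ 2)
      = 2 * ((z.2 a * z.2 b) * prof₁ μ R (δ + ‖z.2‖ ^ 2)) by ring, abs_mul, abs_mul,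
      abs_of_pos (by norm_num : (0 : ℝ) < 2)]
    calc 2 * (|z.2 a * z.2 b| * |prof₁ μ R (δ + ‖z.2‖ ^ 2)|)
        ≤ 2 * ((δ + ‖z.2‖ ^ 2) * (prof μ R (δ + ‖z.2‖ ^ 2) / (2 * (δ + ‖z.2‖ ^ 2)))) := by
          gcongr
      _ = prof μ R (δ + ‖z.2‖ ^ 2) := by field_simp
  have h4 : |if a = b then prof μ R (δ + ‖z.2‖ ^ 2) else 0| ≤ prof μ R (δ + ‖z.2‖ ^ 2) := by
    split_ifs
    · rw [abs_of_pos hp]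
    · rw [abs_zero]; exact hp.le
  calc _ ≤ _ := abs_add_le _ _
    _ ≤ _ := add_le_add h4 h3
    _ = _ := by ring

theorem abs_pd_radialWeight_le (hn : 1 ≤ n) (hT : 0 < T) (hμ0 : 0 < μ) (hμ1 : μ < 1 / 2)
    (hδ : 0 < δ) (hz : z ∈ closedSlab n T) (α : Fin (n + 1)) :
    |pd T α (radialWeight n μ R δ) z|
      ≤ n * (prof μ R (δ + ‖z.2‖ ^ 2) * ‖z.2‖ / (δ + ‖z.2‖ ^ 2)) := by
  have hs : 0 < δ + ‖z.2‖ ^ 2 := by positivity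
  have hp := prof_pos μ R hs
  have hn' : (1 : ℝ) ≤ n := by exact_mod_cast hn
  refine Fin.cases ?_ (fun a => ?_) α
  · rw [pd_zero_radialWeight hT hδ hz, abs_zero]
    positivity
  rw [pd_succ_radialWeight hT hδ hz, abs_mul, abs_mul, abs_of_nonneg (by linarith : (0 : ℝ) ≤ n - 1)]
  have h1 := abs_prof₁_le (R := R) hμ0 hμ1 hs
  have h2 : |z.2 a| ≤ ‖z.2‖ := abs_le_of_sq_le_sq (coord_sq_le_norm_sq z.2 a) (norm_nonneg _)
  have h3 : prof μ R (δ + ‖z.2‖ ^ 2) / (2 * (δ + ‖z.2‖ ^ 2))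
      ≤ prof μ R (δ + ‖z.2‖ ^ 2) / (δ + ‖z.2‖ ^ 2) :=
    div_le_div_of_nonneg_left hp.le hs (by linarith)
  calc ((n : ℝ) - 1) * (|z.2 a| * |prof₁ μ R (δ + ‖z.2‖ ^ 2)|)
      ≤ n * (‖z.2‖ * (prof μ R (δ + ‖z.2‖ ^ 2) / (δ + ‖z.2‖ ^ 2))) := by
        have := h1.trans h3
        gcongr
        linarith
    _ = _ := by ring

theorem multiplier_eq (φ : SpaceTime n → ℝ) :
    multiplier T (radialField n A μ R δ) (radialWeight n μ R δ) φ z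
      = A * pd T 0 φ z + ((∑ a : Fin n, z.2 a * prof μ R (δ + ‖z.2‖ ^ 2) * pd T a.succ φ z)
        + radialWeight n μ R δ z * φ z) := by
  rw [multiplier, Fin.sum_univ_succ]
  simp only [radialField, Fin.cases_zero, Fin.cases_succ]
  ring

theorem abs_spatial_multiplier_le (hn : 1 ≤ n) (hμ0 : 0 < μ) (hδ : 0 < δ)
    (φ : SpaceTime n → ℝ) :
    |(∑ a : Fin n, z.2 a * prof μ R (δ + ‖z.2‖ ^ 2) * pd T a.succ φ z)
        + radialWeight n μ R δ z * φ z|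
      ≤ n * normD T φ z + n / 2 * (prof μ R (δ + ‖z.2‖ ^ 2) * |φ z|) := by
  have hp := prof_pos μ R (by positivity : 0 < δ + ‖z.2‖ ^ 2)
  have hn' : (1 : ℝ) ≤ n := by exact_mod_cast hn
  refine (abs_add_le _ _).trans (add_le_add (abs_sum_fin_le fun a => ?_) ?_)
  · rw [abs_mul, abs_mul, abs_of_pos hp, mul_comm |z.2 a|]
    exact (mul_le_of_le_one_left (abs_nonneg _) (prof_mul_abs_coord_le hμ0 hδ z.2 a)).trans
      (abs_pd_le_normD T φ z a.succ)
  · rw [radialWeight, abs_mul, abs_mul, abs_of_pos hp,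
      abs_of_nonneg (by linarith : (0 : ℝ) ≤ (n - 1) / 2), mul_assoc]
    gcongr
    linarith

theorem abs_multiplier_le (hn : 1 ≤ n) (hA : 0 ≤ A) (hμ0 : 0 < μ) (hδ : 0 < δ)
    (φ : SpaceTime n → ℝ) :
    |multiplier T (radialField n A μ R δ) (radialWeight n μ R δ) φ z|
      ≤ (A + 1) * (n + 1) * (normD T φ z + prof μ R (δ + ‖z.2‖ ^ 2) * |φ z|) := by
  have hp := prof_pos μ R (by positivity : 0 < δ + ‖z.2‖ ^ 2)
  have hD := normD_nonneg T φ z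
  have h1 := abs_spatial_multiplier_le (T := T) (R := R) (z := z) hn hμ0 hδ φ
  have h2 := abs_pd_le_normD T φ z 0
  rw [multiplier_eq]
  have h3 : |A * pd T 0 φ z| ≤ A * normD T φ z := by
    rw [abs_mul, abs_of_nonneg hA]
    gcongr
  refine (abs_add_le _ _).trans ((add_le_add h3 h1).trans ?_)
  have hq : 0 ≤ prof μ R (δ + ‖z.2‖ ^ 2) * |φ z| := by positivity
  generalize prof μ R (δ + ‖z.2‖ ^ 2) * |φ z| = q at *
  generalize normD T φ z = D at *
  have e : (A + 1) * (n + 1) * (D + q) - (A * D + (n * D + n / 2 * q))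
    = A * n * D + D + (A * n + A + n / 2 + 1) * q := by ring
  have : 0 ≤ A * n * D + D + (A * n + A + n / 2 + 1) * q := by positivity
  linarith

theorem abs_multiplier_mul_le (hn : 1 ≤ n) (hA : 0 ≤ A) (hμ0 : 0 < μ) (hμ1 : μ < 1 / 2)
    (hδ : 0 < δ) (hR : 1 ≤ R) (φ F : SpaceTime n → ℝ) (hz : z.2 ≠ 0) :
    |multiplier T (radialField n A μ R δ) (radialWeight n μ R δ) φ z * F z|
      ≤ (A + 1) * (n + 1) * forcing T μ φ F z := by
  have hw := prof_le_weight hμ0 hμ1 hδ.le hR (norm_pos_iff.2 hz)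
  rw [abs_mul]
  calc _ ≤ (A + 1) * (n + 1) * (normD T φ z + prof μ R (δ + ‖z.2‖ ^ 2) * |φ z|) * |F z| := by
        gcongr
        exact abs_multiplier_le hn hA hμ0 hδ φ
    _ ≤ (A + 1) * (n + 1) * (normD T φ z
        + 1 / (‖z.2‖ ^ (1 - 2 * μ) * Real.sqrt (1 + ‖z.2‖ ^ 2) ^ (2 * μ)) * |φ z|) * |F z| := by
        gcongr
    _ = _ := by
        simp only [forcing, rad, jap]
        ring

/-- The perturbative part of the divergence is dominated by the weighted terms in `h`, `∂h`. -/
theorem abs_pertBulk_le (hn : 1 ≤ n) (hT : 0 < T) (hA : 0 ≤ A) (hμ0 : 0 < μ) (hμ1 : μ < 1 / 2)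
    (hδ : 0 < δ) (hR : 1 ≤ R) (h : Fin (n + 1) → Fin (n + 1) → SpaceTime n → ℝ)
    (φ : SpaceTime n → ℝ) (hzs : z ∈ closedSlab n T) (hz : z.2 ≠ 0) :
    |pertBulk T h (radialField n A μ R δ) (radialWeight n μ R δ) φ z|
      ≤ 4 * (A + 1) * (n + 1) ^ 3 * perturbation T μ h φ z := by
  have hs : 0 < δ + ‖z.2‖ ^ 2 := by positivity
  have hr : 0 < ‖z.2‖ := norm_pos_iff.2 hz
  have hp := prof_pos μ R hs
  have hw := prof_le_weight hμ0 hμ1 hδ.le hR hr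
  have hD := normD_nonneg T φ z
  have hH := normH_nonneg h z
  have hDH := normDH_nonneg T h z
  have hn' : (1 : ℝ) ≤ n := by exact_mod_cast hn
  have uD := abs_pd_le_normD T φ z
  have hK := abs_multiplier_le (T := T) (R := R) (z := z) hn hA hμ0 hδ φ
  have hX : ∀ α, |radialField n A μ R δ α z| ≤ A + 1 := abs_radialField_le hA hμ0 hδ
  have hdX := abs_pd_radialField_le (A := A) (R := R) hT hμ0 hμ1 hδ hzs
  have hwt : |radialWeight n μ R δ z| ≤ n * prof μ R (δ + ‖z.2‖ ^ 2) := by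
    rw [radialWeight, abs_mul, abs_of_pos hp, abs_of_nonneg (by linarith : (0 : ℝ) ≤ (n - 1) / 2)]
    gcongr
    linarith
  have hdw : ∀ α, |pd T α (radialWeight n μ R δ) z|
      ≤ n * (prof μ R (δ + ‖z.2‖ ^ 2) / ‖z.2‖) := by
    intro α
    refine (abs_pd_radialWeight_le hn hT hμ0 hμ1 hδ hzs α).trans ?_
    refine mul_le_mul_of_nonneg_left ?_ (by linarith)
    rw [div_le_div_iff₀ hs hr]
    nlinarith [hp.le]
  -- Replace the profile by the weight of the statement at the very end.
  simp only [perturbation, rad, jap]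
  have hr2 : ‖z.2‖ ^ (2 - 2 * μ) = ‖z.2‖ * ‖z.2‖ ^ (1 - 2 * μ) := by
    rw [show (2 - 2 * μ) = 1 + (1 - 2 * μ) by ring, Real.rpow_add hr, Real.rpow_one]
  have hr1 : 0 < ‖z.2‖ ^ (1 - 2 * μ) * Real.sqrt (1 + ‖z.2‖ ^ 2) ^ (2 * μ) := by positivity
  set p := prof μ R (δ + ‖z.2‖ ^ 2) with hpdef
  set wt := ‖z.2‖ ^ (1 - 2 * μ) * Real.sqrt (1 + ‖z.2‖ ^ 2) ^ (2 * μ) with hwt_def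
  set D := normD T φ z with hDdef
  set H := normH h z with hHdef
  set DH := normDH T h z with hDHdef
  have b1 : |∑ α, ∑ β, pd T α (h α β) z * pd T β φ z| ≤ (n + 1) ^ 2 * (DH * D) := by
    have : |∑ α : Fin (n + 1), ∑ β : Fin (n + 1), pd T α (h α β) z * pd T β φ z|
        ≤ (n + 1 : ℕ) * ((n + 1 : ℕ) * (DH * D)) :=
      abs_sum_fin_le fun α => abs_sum_fin_le fun β => by
        rw [abs_mul]
        exact mul_le_mul (abs_pd_le_normDH T h z _ _ _) (uD β) (abs_nonneg _) hDH
    refine this.trans (le_of_eq ?_)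
    push_cast; ring
  have b2 : |∑ α, radialField n A μ R δ α z
      * ∑ β, ∑ γ, pd T α (h β γ) z * (pd T β φ z * pd T γ φ z)|
      ≤ (n + 1) ^ 3 * ((A + 1) * (DH * D ^ 2)) := by
    have : |∑ α : Fin (n + 1), radialField n A μ R δ α z
      * ∑ β, ∑ γ, pd T α (h β γ) z * (pd T β φ z * pd T γ φ z)|
        ≤ (n + 1 : ℕ) * ((A + 1) * ((n + 1 : ℕ) * ((n + 1 : ℕ) * (DH * (D * D))))) :=
      abs_sum_fin_le fun α => by
        rw [abs_mul]
        refine mul_le_mul (hX α) ?_ (abs_nonneg _) (by linarith)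
        refine abs_sum_fin_le fun β => abs_sum_fin_le fun γ => ?_
        rw [abs_mul, abs_mul]
        have := abs_pd_le_normDH T h z α β γ
        have := uD β
        have := uD γ
        gcongr
    refine this.trans (le_of_eq ?_)
    push_cast; ring
  have bk : ∀ α, |∑ β, h α β z * pd T β φ z| ≤ (n + 1 : ℕ) * (H * D) := fun α =>
    abs_sum_fin_le fun β => by
      rw [abs_mul]
      exact mul_le_mul (abs_le_normH h z α β) (uD β) (abs_nonneg _) hH
  have b3 : |∑ α, (∑ β, h α β z * pd T β φ z)
      * ∑ γ, pd T α (radialField n A μ R δ γ) z * pd T γ φ z|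
      ≤ 2 * (n + 1) ^ 3 * (p * (H * D ^ 2)) := by
    have : |∑ α : Fin (n + 1), (∑ β, h α β z * pd T β φ z)
      * ∑ γ, pd T α (radialField n A μ R δ γ) z * pd T γ φ z|
        ≤ (n + 1 : ℕ) * (((n + 1 : ℕ) * (H * D)) * ((n + 1 : ℕ) * (2 * p * D))) :=
      abs_sum_fin_le fun α => by
        rw [abs_mul]
        refine mul_le_mul (bk α) ?_ (abs_nonneg _) (by positivity)
        refine abs_sum_fin_le fun γ => ?_
        rw [abs_mul]
        exact mul_le_mul (hdX α γ) (uD γ) (abs_nonneg _) (by positivity)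
    refine this.trans (le_of_eq ?_)
    push_cast; ring
  have b4 : |∑ α, (∑ β, h α β z * pd T β φ z) * pd T α φ z| ≤ (n + 1) ^ 2 * (H * D ^ 2) := by
    have : |∑ α : Fin (n + 1), (∑ β, h α β z * pd T β φ z) * pd T α φ z|
        ≤ (n + 1 : ℕ) * (((n + 1 : ℕ) * (H * D)) * D) :=
      abs_sum_fin_le fun α => by
        rw [abs_mul]
        exact mul_le_mul (bk α) (uD α) (abs_nonneg _) (by positivity)
    refine this.trans (le_of_eq ?_)
    push_cast; ring
  have b4' : |radialWeight n μ R δ z - 1 / 2 * ∑ α, pd T α (radialField n A μ R δ α) z|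
      ≤ 2 * (n + 1) * p := by
    have h1 : |∑ α : Fin (n + 1), pd T α (radialField n A μ R δ α) z| ≤ (n + 1 : ℕ) * (2 * p) :=
      abs_sum_fin_le fun α => hdX α α
    push_cast at h1
    have h2 := abs_le.1 h1
    have h3 := abs_le.1 hwt
    rw [abs_le]
    constructor <;> linarith
  have b5 : |∑ α, (∑ β, h α β z * pd T β φ z) * pd T α (radialWeight n μ R δ) z|
      ≤ (n + 1) ^ 3 * (p / ‖z.2‖ * (H * D)) := by
    have : |∑ α : Fin (n + 1), (∑ β, h α β z * pd T β φ z) * pd T α (radialWeight n μ R δ) z|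
        ≤ (n + 1 : ℕ) * (((n + 1 : ℕ) * (H * D)) * (n * (p / ‖z.2‖))) :=
      abs_sum_fin_le fun α => by
        rw [abs_mul]
        exact mul_le_mul (bk α) (hdw α) (abs_nonneg _) (by positivity)
    refine this.trans ?_
    push_cast
    have h1 : 0 ≤ (n + 1 : ℝ) ^ 2 * (p / ‖z.2‖ * (H * D)) := by positivity
    calc _ = (n : ℝ) * ((n + 1 : ℝ) ^ 2 * (p / ‖z.2‖ * (H * D))) := by ring
      _ ≤ (n + 1 : ℝ) * ((n + 1 : ℝ) ^ 2 * (p / ‖z.2‖ * (H * D))) := by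
          gcongr; linarith
      _ = _ := by ring
  have t1 : |multiplier T (radialField n A μ R δ) (radialWeight n μ R δ) φ z
      * ∑ α, ∑ β, pd T α (h α β) z * pd T β φ z|
      ≤ (A + 1) * (n + 1) ^ 3 * (DH * D ^ 2 + p * (DH * (|φ z| * D))) := by
    rw [abs_mul]
    refine (mul_le_mul hK b1 (abs_nonneg _) (by positivity)).trans (le_of_eq ?_)
    ring
  have t4 : |(radialWeight n μ R δ z - 1 / 2 * ∑ α, pd T α (radialField n A μ R δ α) z)
      * ∑ α, (∑ β, h α β z * pd T β φ z) * pd T α φ z|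
      ≤ 2 * (n + 1) ^ 3 * (p * (H * D ^ 2)) := by
    rw [abs_mul]
    refine (mul_le_mul b4' b4 (abs_nonneg _) (by positivity)).trans (le_of_eq ?_)
    ring
  have t5 : |φ z * ∑ α, (∑ β, h α β z * pd T β φ z) * pd T α (radialWeight n μ R δ) z|
      ≤ (n + 1) ^ 3 * (p / ‖z.2‖ * (H * (|φ z| * D))) := by
    rw [abs_mul]
    refine (mul_le_mul_of_nonneg_left b5 (abs_nonneg _)).trans (le_of_eq ?_)
    ring
  have q1 : 0 ≤ DH * D ^ 2 := by positivity
  have q2 : 0 ≤ p * (DH * (|φ z| * D)) := by positivity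
  have q3 : 0 ≤ p * (H * D ^ 2) := by positivity
  have q4 : 0 ≤ p / ‖z.2‖ * (H * (|φ z| * D)) := by positivity
  have r2 : p * (DH * (|φ z| * D)) ≤ DH * (|φ z| * D) / wt := by
    refine (mul_le_mul_of_nonneg_right hw (by positivity)).trans (le_of_eq ?_); ring
  have r3 : p * (H * D ^ 2) ≤ H * D ^ 2 / wt := by
    refine (mul_le_mul_of_nonneg_right hw (by positivity)).trans (le_of_eq ?_); ring
  have r4 : p / ‖z.2‖ * (H * (|φ z| * D)) ≤ H * (|φ z| * D)
      / (‖z.2‖ ^ (2 - 2 * μ) * Real.sqrt (1 + ‖z.2‖ ^ 2) ^ (2 * μ)) := by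
    rw [hr2, mul_assoc ‖z.2‖, ← hwt_def]
    calc p / ‖z.2‖ * (H * (|φ z| * D)) ≤ (1 / wt) / ‖z.2‖ * (H * (|φ z| * D)) := by gcongr
      _ = _ := by field_simp
  have key : |pertBulk T h (radialField n A μ R δ) (radialWeight n μ R δ) φ z|
      ≤ 4 * (A + 1) * (n + 1) ^ 3 * (DH * D ^ 2 + p * (DH * (|φ z| * D)) + p * (H * D ^ 2)
        + p / ‖z.2‖ * (H * (|φ z| * D))) := by
    have c1 : 0 ≤ A * (n + 1 : ℝ) ^ 3 := by positivity
    have c2 : 0 ≤ (n + 1 : ℝ) ^ 3 := by positivity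
    have s1 := abs_le.1 t1
    have s2 := abs_le.1 b2
    have s3 := abs_le.1 b3
    have s4 := abs_le.1 t4
    have s5 := abs_le.1 t5
    simp only [pertBulk]
    have m1 := mul_nonneg c1 q1
    have m2 := mul_nonneg c1 q2
    have m3 := mul_nonneg c1 q3
    have m4 := mul_nonneg c1 q4
    have m1' := mul_nonneg c2 q1
    have m2' := mul_nonneg c2 q2
    have m3' := mul_nonneg c2 q3
    have m4' := mul_nonneg c2 q4
    generalize hN : (n + 1 : ℝ) ^ 3 = N at *
    rw [abs_le]
    constructor <;> linarith
  refine key.trans ?_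
  gcongr

theorem abs_metric_le (h : Fin (n + 1) → Fin (n + 1) → SpaceTime n → ℝ)
    (hsum : ∑ α, ∑ β, |h α β z| ≤ 1 / 2) (α β : Fin (n + 1)) : |metric h α β z| ≤ 3 / 2 := by
  have h1 : |h α β z| ≤ 1 / 2 := by
    refine le_trans ?_ hsum
    refine le_trans ?_ (Finset.single_le_sum (f := fun α => ∑ β, |h α β z|)
      (fun _ _ => Finset.sum_nonneg fun _ _ => abs_nonneg _) (Finset.mem_univ α))
    exact Finset.single_le_sum (f := fun β => |h α β z|) (fun _ _ => abs_nonneg _)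
      (Finset.mem_univ β)
  have h2 : |if α = β then sgn α else (0 : ℝ)| ≤ 1 := by
    simp only [sgn]
    split_ifs <;> simp
  refine (abs_add_le _ _).trans ?_
  linarith

/-- A crude bound, not uniform in `δ`, that serves only to make the current integrable. -/
theorem abs_current_le (hn : 1 ≤ n) (hT : 0 < T) (hA : 0 ≤ A) (hμ0 : 0 < μ) (hμ1 : μ < 1 / 2)
    (hδ : 0 < δ) (h : Fin (n + 1) → Fin (n + 1) → SpaceTime n → ℝ)
    (hsum : ∑ α, ∑ β, |h α β z| ≤ 1 / 2)
    (φ : SpaceTime n → ℝ) (hzs : z ∈ closedSlab n T) (α : Fin (n + 1)) :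
    |current T h (radialField n A μ R δ) (radialWeight n μ R δ) φ α z|
      ≤ 4 * (A + 1) * (n + 1) ^ 2 * (normD T φ z ^ 2 + φ z ^ 2 / δ) := by
  have hs : 0 < δ + ‖z.2‖ ^ 2 := by positivity
  have hδs : δ ≤ δ + ‖z.2‖ ^ 2 := by linarith [sq_nonneg ‖z.2‖]
  have hp := prof_pos μ R hs
  have hD := normD_nonneg T φ z
  have hn' : (1 : ℝ) ≤ n := by exact_mod_cast hn
  have uD := abs_pd_le_normD T φ z
  have hG := abs_metric_le h hsum
  have hK := abs_multiplier_le (T := T) (R := R) (z := z) hn hA hμ0 hδ φ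
  have hX : |radialField n A μ R δ α z| ≤ A + 1 := abs_radialField_le hA hμ0 hδ α
  have hdw : |pd T α (radialWeight n μ R δ) z| ≤ n / δ := by
    refine (abs_pd_radialWeight_le hn hT hμ0 hμ1 hδ hzs α).trans ?_
    have h1 := prof_mul_le_one (R := R) hμ0 hs (norm_nonneg z.2) (by linarith)
    rw [div_eq_mul_one_div (n : ℝ)]
    gcongr
  have hpφ : (prof μ R (δ + ‖z.2‖ ^ 2) * |φ z|) ^ 2 ≤ φ z ^ 2 / δ := by
    rw [mul_pow, sq_abs]
    have h1 := prof_sq_le (R := R) hμ0 hs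
    calc _ ≤ 1 / (δ + ‖z.2‖ ^ 2) * φ z ^ 2 := by gcongr
      _ ≤ 1 / δ * φ z ^ 2 := by gcongr
      _ = _ := by ring
  have hq : 0 ≤ prof μ R (δ + ‖z.2‖ ^ 2) * |φ z| := by positivity
  set q := prof μ R (δ + ‖z.2‖ ^ 2) * |φ z| with hqdef
  set D := normD T φ z with hDdef
  have b1 : |∑ β, metric h α β z * pd T β φ z| ≤ (n + 1 : ℕ) * (3 / 2 * D) :=
    abs_sum_fin_le fun β => by
      rw [abs_mul]
      exact mul_le_mul (hG α β) (uD β) (abs_nonneg _) (by norm_num)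
  have b2 : |∑ β, ∑ γ, metric h β γ z * (pd T β φ z * pd T γ φ z)|
      ≤ (n + 1 : ℕ) * ((n + 1 : ℕ) * (3 / 2 * (D * D))) :=
    abs_sum_fin_le fun β => abs_sum_fin_le fun γ => by
      rw [abs_mul, abs_mul]
      have := hG β γ
      have := uD β
      have := uD γ
      gcongr
  have t1 : |(∑ β, metric h α β z * pd T β φ z)
      * multiplier T (radialField n A μ R δ) (radialWeight n μ R δ) φ z|
      ≤ (A + 1) * (n + 1) ^ 2 * (3 * D ^ 2 + 3 / 2 * (φ z ^ 2 / δ)) := by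
    rw [abs_mul]
    refine (mul_le_mul b1 hK (abs_nonneg _) (by positivity)).trans ?_
    have e : ((n + 1 : ℕ) : ℝ) * (3 / 2 * D) * ((A + 1) * (n + 1) * (D + q))
        = (A + 1) * (n + 1) ^ 2 * (3 / 2 * D ^ 2 + 3 / 2 * (D * q)) := by push_cast; ring
    rw [e]
    refine mul_le_mul_of_nonneg_left ?_ (by positivity)
    nlinarith [sq_nonneg (D - q), sq_nonneg D, sq_nonneg q]
  have t2 : |radialField n A μ R δ α z
      * ∑ β, ∑ γ, metric h β γ z * (pd T β φ z * pd T γ φ z)|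
      ≤ (A + 1) * (n + 1) ^ 2 * (3 / 2 * D ^ 2) := by
    rw [abs_mul]
    refine (mul_le_mul hX b2 (abs_nonneg _) (by linarith)).trans (le_of_eq ?_)
    push_cast; ring
  have t3 : |1 / 2 * sgn α * (pd T α (radialWeight n μ R δ) z * φ z ^ 2)|
      ≤ (A + 1) * (n + 1) ^ 2 * (1 / 2 * (φ z ^ 2 / δ)) := by
    have h1 : |sgn α| = 1 := by
      simp only [sgn]
      split_ifs <;> simp
    rw [abs_mul, abs_mul, abs_mul, h1, abs_of_nonneg (sq_nonneg (φ z)),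
      abs_of_pos (by norm_num : (0 : ℝ) < 1 / 2)]
    have h2 : (n : ℝ) ≤ (A + 1) * (n + 1) ^ 2 := by
      have : 0 ≤ A * (n + 1 : ℝ) ^ 2 := by positivity
      nlinarith
    calc 1 / 2 * 1 * (|pd T α (radialWeight n μ R δ) z| * φ z ^ 2)
        ≤ 1 / 2 * 1 * (n / δ * φ z ^ 2) := by gcongr
      _ = n * (1 / 2 * (φ z ^ 2 / δ)) := by ring
      _ ≤ _ := by gcongr
  have hc : 0 ≤ (A + 1) * (n + 1 : ℝ) ^ 2 := by positivity
  have m1 := mul_nonneg hc (sq_nonneg D)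
  have m2 : 0 ≤ (A + 1) * (n + 1 : ℝ) ^ 2 * (φ z ^ 2 / δ) := by positivity
  have s1 := abs_le.1 t1
  have s2 := abs_le.1 t2
  have s3 := abs_le.1 t3
  rw [current, abs_le, mul_assoc 4 (A + 1)]
  generalize (A + 1) * (n + 1 : ℝ) ^ 2 = c at *
  constructor <;> linarith

/-- The time component of the current is the energy density up to a term that Hardy's inequality
controls. The smallness of `h` makes the energy density coercive. -/
theorem abs_current_zero_sub_le (hn : 1 ≤ n) (hT : 0 < T) (hA : 0 ≤ A) (hμ0 : 0 < μ)
    (hδ : 0 < δ) (h : Fin (n + 1) → Fin (n + 1) → SpaceTime n → ℝ)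
    (hsum : ∑ α, ∑ β, |h α β z| ≤ 1 / 2)
    (φ : SpaceTime n → ℝ) (hzs : z ∈ closedSlab n T) :
    |current T h (radialField n A μ R δ) (radialWeight n μ R δ) φ 0 z
        - A / 2 * normD T φ z ^ 2|
      ≤ (A / 4 + 2 * n) * normD T φ z ^ 2 + n * (φ z ^ 2 / (δ + ‖z.2‖ ^ 2)) := by
  have hs : 0 < δ + ‖z.2‖ ^ 2 := by positivity
  have hp := prof_pos μ R hs
  have hD := normD_nonneg T φ z
  have hn' : (1 : ℝ) ≤ n := by exact_mod_cast hn
  have uD := abs_pd_le_normD T φ z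
  have hV := abs_spatial_multiplier_le (T := T) (R := R) (z := z) hn hμ0 hδ φ
  have hDsq := normD_sq T φ z
  have hpφ : (prof μ R (δ + ‖z.2‖ ^ 2) * |φ z|) ^ 2 ≤ φ z ^ 2 / (δ + ‖z.2‖ ^ 2) := by
    rw [mul_pow, sq_abs]
    have h1 := prof_sq_le (R := R) hμ0 hs
    calc _ ≤ 1 / (δ + ‖z.2‖ ^ 2) * φ z ^ 2 := by gcongr
      _ = _ := by ring
  have hq : 0 ≤ prof μ R (δ + ‖z.2‖ ^ 2) * |φ z| := by positivity
  rw [current, multiplier_eq, pd_zero_radialWeight hT hδ hzs]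
  set q := prof μ R (δ + ‖z.2‖ ^ 2) * |φ z| with hqdef
  set V := (∑ a : Fin n, z.2 a * prof μ R (δ + ‖z.2‖ ^ 2) * pd T a.succ φ z)
    + radialWeight n μ R δ z * φ z with hVdef
  set D := normD T φ z with hDdef
  set k : Fin (n + 1) → ℝ := fun α => ∑ β, h α β z * pd T β φ z with hk
  have hQ : ∑ β, ∑ γ, metric h β γ z * (pd T β φ z * pd T γ φ z)
      = (∑ β, sgn β * pd T β φ z ^ 2) + ∑ β, k β * pd T β φ z := by
    rw [← Finset.sum_add_distrib]
    refine Finset.sum_congr rfl fun β _ => ?_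
    rw [sum_metric_mul]
    simp only [hk, Finset.sum_mul]
    congr 1
    · ring
    · exact Finset.sum_congr rfl fun γ _ => by ring
  have hkb : ∑ α, |k α| ≤ 1 / 2 * D := by
    calc ∑ α, |k α| ≤ ∑ α, ∑ β, |h α β z| * D := by
          refine Finset.sum_le_sum fun α _ => (Finset.abs_sum_le_sum_abs _ _).trans ?_
          refine Finset.sum_le_sum fun β _ => ?_
          rw [abs_mul]
          exact mul_le_mul_of_nonneg_left (uD β) (abs_nonneg _)
      _ = (∑ α, ∑ β, |h α β z|) * D := by simp only [Finset.sum_mul]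
      _ ≤ _ := by gcongr
  have hk0 : |k 0| ≤ 1 / 2 * D :=
    (Finset.single_le_sum (f := fun α => |k α|) (fun _ _ => abs_nonneg _)
      (Finset.mem_univ 0)).trans hkb
  have hS : D ^ 2 = pd T 0 φ z ^ 2 + ∑ a : Fin n, pd T a.succ φ z ^ 2 := by
    rw [hDsq, Fin.sum_univ_succ]
  have hm : ∑ β, sgn β * pd T β φ z ^ 2 = 2 * pd T 0 φ z ^ 2 - D ^ 2 := by
    rw [Fin.sum_univ_succ, hS]
    simp [sgn, Fin.succ_ne_zero]
    ring
  have hks : ∑ β, sgn β * k β * pd T β φ z = 2 * (k 0 * pd T 0 φ z) - ∑ β, k β * pd T β φ z := by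
    rw [Fin.sum_univ_succ, Fin.sum_univ_succ]
    simp [sgn, Fin.succ_ne_zero]
    ring
  have hksb : |∑ β, sgn β * k β * pd T β φ z| ≤ 1 / 2 * D ^ 2 := by
    calc _ ≤ ∑ β, |sgn β * k β * pd T β φ z| := Finset.abs_sum_le_sum_abs _ _
      _ ≤ ∑ β, |k β| * D := by
          refine Finset.sum_le_sum fun β _ => ?_
          have h1 : |sgn β| = 1 := by
            simp only [sgn]
            split_ifs <;> simp
          rw [abs_mul, abs_mul, h1, one_mul]
          exact mul_le_mul_of_nonneg_left (uD β) (abs_nonneg _)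
      _ = (∑ β, |k β|) * D := by rw [Finset.sum_mul]
      _ ≤ 1 / 2 * D * D := by gcongr
      _ = _ := by ring
  have hg0 : |pd T 0 φ z + k 0| ≤ 3 / 2 * D := by
    refine (abs_add_le _ _).trans ?_
    linarith [uD 0]
  have hgV : |(pd T 0 φ z + k 0) * V|
      ≤ 2 * n * D ^ 2 + n * (φ z ^ 2 / (δ + ‖z.2‖ ^ 2)) := by
    rw [abs_mul]
    refine (mul_le_mul hg0 hV (abs_nonneg _) (by positivity)).trans ?_
    have e : 3 / 2 * D * (n * D + n / 2 * q) = n * (3 / 2 * D ^ 2 + 3 / 4 * (D * q)) := by ring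
    rw [e, show 2 * n * D ^ 2 + n * (φ z ^ 2 / (δ + ‖z.2‖ ^ 2))
      = n * (2 * D ^ 2 + φ z ^ 2 / (δ + ‖z.2‖ ^ 2)) by ring]
    refine mul_le_mul_of_nonneg_left ?_ (by positivity)
    nlinarith [sq_nonneg (D - q), sq_nonneg D, sq_nonneg q]
  have hval : (∑ β, metric h 0 β z * pd T β φ z) * (A * pd T 0 φ z + V)
      - 1 / 2 * (radialField n A μ R δ 0 z
          * ∑ β, ∑ γ, metric h β γ z * (pd T β φ z * pd T γ φ z))
      - 1 / 2 * sgn (0 : Fin (n + 1)) * (0 * φ z ^ 2) - A / 2 * D ^ 2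
      = A / 2 * (∑ β, sgn β * k β * pd T β φ z) + (pd T 0 φ z + k 0) * V := by
    rw [hQ, hm, hks, sum_metric_mul h 0 z fun β => pd T β φ z,
      show radialField n A μ R δ 0 z = A from rfl, show sgn (0 : Fin (n + 1)) = 1 from if_pos rfl]
    simp only [hk]
    ring
  rw [hval]
  refine (abs_add_le _ _).trans ?_
  have h5 : |A / 2 * ∑ β, sgn β * k β * pd T β φ z| ≤ A / 4 * D ^ 2 := by
    rw [abs_mul, abs_of_nonneg (by linarith : 0 ≤ A / 2)]
    calc A / 2 * _ ≤ A / 2 * (1 / 2 * D ^ 2) := by gcongr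
      _ = _ := by ring
  linarith

end bounds

/-! ### The energy–Morawetz estimate at a single scale -/

/-- A classical finite-energy solution `φ` of `□φ + h^{αβ} ∂_α ∂_β φ = F` on the slab, with small
symmetric `C¹` coefficients. -/
structure WaveSolution (n : ℕ) (T : ℝ) (h : Fin (n + 1) → Fin (n + 1) → SpaceTime n → ℝ)
    (F φ : SpaceTime n → ℝ) : Prop where
  coeff : ∀ α β, ContDiffOn ℝ 1 (h α β) (closedSlab n T)
  small : ∀ z ∈ closedSlab n T, ∑ α, ∑ β, |h α β z| ≤ 1 / 2
  symm : ∀ z ∈ closedSlab n T, ∀ α β, h α β z = h β α z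
  smooth : ContDiffOn ℝ 2 φ (closedSlab n T)
  equation : ∀ z ∈ openSlab n T, waveOp T h φ z = F z
  continuousInH1 : ContinuousInH1 T φ
  contDiffInL2 : ContDiffInL2 T φ

/-- The energy `∫ |∂φ(t,x)|² dx` of the time slice `t`, time derivative included. -/
def energyAt {n : ℕ} (T : ℝ) (φ : SpaceTime n → ℝ) (t : ℝ) : ℝ := ∫ x, normD T φ (t, x) ^ 2

theorem energyAt_nonneg {n : ℕ} (T : ℝ) (φ : SpaceTime n → ℝ) (t : ℝ) : 0 ≤ energyAt T φ t :=
  integral_nonneg fun _ => sq_nonneg _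

theorem ae_snd_ne_zero {n : ℕ} (hn : 1 ≤ n) (t : ℝ) :
    ∀ᵐ z : SpaceTime n ∂(volume.restrict (openSlab n t)), z.2 ≠ 0 := by
  have : Nonempty (Fin n) := ⟨⟨0, hn⟩⟩
  have : Nontrivial (Space n) := inferInstance
  refine ae_restrict_of_ae ?_
  rw [ae_iff]
  have h1 : {z : SpaceTime n | ¬ z.2 ≠ 0} = (univ : Set ℝ) ×ˢ {(0 : Space n)} := by
    ext z; simp
  rw [h1, Measure.volume_eq_prod, Measure.prod_prod]
  simp

theorem forcing_nonneg {n : ℕ} (T μ : ℝ) (φ F : SpaceTime n → ℝ) (z : SpaceTime n) :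
    0 ≤ forcing T μ φ F z := by
  have h1 := normD_nonneg T φ z
  have h2 : 0 ≤ rad z := norm_nonneg _
  have h3 : 0 ≤ jap z := Real.sqrt_nonneg _
  rw [forcing]
  positivity

theorem perturbation_nonneg {n : ℕ} (T μ : ℝ)
    (h : Fin (n + 1) → Fin (n + 1) → SpaceTime n → ℝ) (φ : SpaceTime n → ℝ) (z : SpaceTime n) :
    0 ≤ perturbation T μ h φ z := by
  have h1 := normD_nonneg T φ z
  have h2 : 0 ≤ rad z := norm_nonneg _
  have h3 : 0 ≤ jap z := Real.sqrt_nonneg _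
  have h4 := normH_nonneg h z
  have h5 := normDH_nonneg T h z
  rw [perturbation]
  positivity

theorem continuousOn_normD {n : ℕ} {T : ℝ} (hT : 0 < T) {φ : SpaceTime n → ℝ}
    (hφ : ContDiffOn ℝ 1 φ (closedSlab n T)) : ContinuousOn (normD T φ) (closedSlab n T) :=
  (continuousOn_finsetSum _ fun α _ => (continuousOn_pd hT hφ α).pow 2).sqrt

theorem continuous_slice {n : ℕ} {T : ℝ} {u : SpaceTime n → ℝ}
    (hu : ContinuousOn u (closedSlab n T)) {t : ℝ} (ht : t ∈ Icc 0 T) :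
    Continuous fun x : Space n => u (t, x) :=
  hu.comp_continuous (by fun_prop) fun _ => mem_closedSlab.2 ⟨ht.1, ht.2⟩

theorem continuousOn_normH {n : ℕ} {T : ℝ} {h : Fin (n + 1) → Fin (n + 1) → SpaceTime n → ℝ}
    (hh : ∀ α β, ContDiffOn ℝ 1 (h α β) (closedSlab n T)) :
    ContinuousOn (normH h) (closedSlab n T) :=
  (continuousOn_finsetSum _ fun α _ => continuousOn_finsetSum _ fun β _ =>
    (hh α β).continuousOn.pow 2).sqrt

theorem continuousOn_normDH {n : ℕ} {T : ℝ} (hT : 0 < T)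
    {h : Fin (n + 1) → Fin (n + 1) → SpaceTime n → ℝ}
    (hh : ∀ α β, ContDiffOn ℝ 1 (h α β) (closedSlab n T)) :
    ContinuousOn (normDH T h) (closedSlab n T) :=
  (continuousOn_finsetSum _ fun γ _ => continuousOn_finsetSum _ fun α _ =>
    continuousOn_finsetSum _ fun β _ => (continuousOn_pd hT (hh α β) γ).pow 2).sqrt

theorem aemeasurable_of_continuousOn {n : ℕ} {T : ℝ} {u : SpaceTime n → ℝ}
    (hu : ContinuousOn u (closedSlab n T)) : AEMeasurable u (volume.restrict (openSlab n T)) :=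
  ((hu.mono (openSlab_subset_closedSlab n T)).aestronglyMeasurable
    (measurableSet_openSlab n T)).aemeasurable

theorem measurable_rad (n : ℕ) : Measurable (rad : SpaceTime n → ℝ) :=
  measurable_snd.norm

theorem measurable_jap (n : ℕ) : Measurable (jap : SpaceTime n → ℝ) :=
  (measurable_const.add (measurable_snd.norm.pow_const 2)).sqrt

theorem aemeasurable_perturbation {n : ℕ} {T : ℝ} (hT : 0 < T) (μ : ℝ)
    {h : Fin (n + 1) → Fin (n + 1) → SpaceTime n → ℝ}
    (hh : ∀ α β, ContDiffOn ℝ 1 (h α β) (closedSlab n T)) {φ : SpaceTime n → ℝ}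
    (hφ : ContDiffOn ℝ 1 φ (closedSlab n T)) :
    AEMeasurable (perturbation T μ h φ) (volume.restrict (openSlab n T)) := by
  have m1 := aemeasurable_of_continuousOn (continuousOn_normD hT hφ)
  have m2 := aemeasurable_of_continuousOn (continuousOn_normH hh)
  have m3 := aemeasurable_of_continuousOn (continuousOn_normDH hT hh)
  have m4 : AEMeasurable (fun z => |φ z|) (volume.restrict (openSlab n T)) :=
    aemeasurable_of_continuousOn hφ.continuousOn.abs
  have m5 : ∀ p q : ℝ, AEMeasurable (fun z : SpaceTime n => rad z ^ p * jap z ^ q)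
      (volume.restrict (openSlab n T)) := fun p q =>
    (((measurable_rad n).pow_const p).mul ((measurable_jap n).pow_const q)).aemeasurable
  exact (((m3.mul (m1.pow_const 2)).add ((m3.mul (m4.mul m1)).div (m5 _ _))).add
    ((m2.mul (m1.pow_const 2)).div (m5 _ _))).add ((m2.mul (m4.mul m1)).div (m5 _ _))

namespace WaveSolution

variable {n : ℕ} {T : ℝ} {h : Fin (n + 1) → Fin (n + 1) → SpaceTime n → ℝ}
  {F φ : SpaceTime n → ℝ}

theorem contDiffOn_one (H : WaveSolution n T h F φ) : ContDiffOn ℝ 1 φ (closedSlab n T) :=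
  H.smooth.of_le (by norm_num)

/-- The energy and the `L²` norm are bounded in time, without any quantitative information. -/
theorem exists_energy_bound (H : WaveSolution n T h F φ) (hT : 0 < T) :
    ∃ M : ℝ, ∀ t ∈ Icc (0 : ℝ) T,
      (Integrable (fun x => φ (t, x) ^ 2) ∧ ∫ x, φ (t, x) ^ 2 ≤ M) ∧
      (Integrable (fun x => normD T φ (t, x) ^ 2) ∧ energyAt T φ t ≤ M) := by
  obtain ⟨M, hM⟩ := exists_bound_integral_sq hT H.contDiffOn_one H.continuousInH1 H.contDiffInL2
  refine ⟨max M ((n + 1 : ℕ) * M), fun t ht => ⟨⟨(hM t ht).1.1, (hM t ht).1.2.trans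
    (le_max_left _ _)⟩, ?_, ?_⟩⟩
  · simp only [normD_sq]
    exact integrable_finsetSum _ fun α _ => ((hM t ht).2 α).1
  · simp only [energyAt, normD_sq]
    rw [integral_finsetSum _ fun α _ => ((hM t ht).2 α).1]
    refine le_trans ?_ (le_max_right _ _)
    refine (Finset.sum_le_card_nsmul _ _ M fun α _ => ((hM t ht).2 α).2).trans ?_
    simp

/-- Hardy's inequality on a time slice. -/
theorem hardy_slice (H : WaveSolution n T h F φ) (hn : 3 ≤ n) (hT : 0 < T) {δ : ℝ} (hδ : 0 < δ)
    {t : ℝ} (ht : t ∈ Icc 0 T) :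
    Integrable (fun x => φ (t, x) ^ 2 / (δ + ‖x‖ ^ 2)) ∧
      ∫ x, φ (t, x) ^ 2 / (δ + ‖x‖ ^ 2) ≤ 4 * energyAt T φ t := by
  obtain ⟨M, hM⟩ := exists_bound_integral_sq hT H.contDiffOn_one H.continuousInH1 H.contDiffInL2
  have h1 := hardy hn hδ (contDiff_slice H.contDiffOn_one ht) (hM t ht).1.1
    (by
      simp only [fderiv_slice H.contDiffOn_one ht]
      exact fun a => ((hM t ht).2 a.succ).1)
  refine ⟨h1.1, h1.2.trans ?_⟩
  simp only [fderiv_slice H.contDiffOn_one ht]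
  refine mul_le_mul_of_nonneg_left ?_ (by norm_num)
  refine integral_mono (integrable_finsetSum _ fun a _ => ((hM t ht).2 a.succ).1) ?_ fun x => ?_
  · simp only [normD_sq]
    exact integrable_finsetSum _ fun α _ => ((hM t ht).2 α).1
  · simp only [normD_sq]
    rw [Fin.sum_univ_succ]
    linarith [sq_nonneg (pd T 0 φ (t, x))]

/-- The estimate obtained from the multiplier `28 n ∂_t + p (x·∇ + (n-1)/2)` on `[0,t]`, with all
constants independent of the scale `R` and the regularization `δ`. -/
theorem energy_morawetz (H : WaveSolution n T h F φ) (hn : 3 ≤ n) (hT : 0 < T) {μ R δ : ℝ}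
    (hμ0 : 0 < μ) (hμ1 : μ < 1 / 2) (hδ : 0 < δ) (hR : 1 ≤ R)
    (hB : IntegrableOn (fun z => forcing T μ φ F z + perturbation T μ h φ z) (openSlab n T))
    {t : ℝ} (ht : t ∈ Icc 0 T) :
    IntegrableOn (fun z : SpaceTime n => bulkWeight μ R δ z * hardyDensity T δ φ z) (openSlab n t) ∧
    energyAt T φ t + μ * (1 - 2 * μ) * ∫ z in openSlab n t, bulkWeight μ R δ z * hardyDensity T δ φ z
      ≤ 4 * (28 * n + 1) * (n + 1) ^ 3 * (energyAt T φ 0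
          + ∫ z in openSlab n T, (forcing T μ φ F z + perturbation T μ h φ z)) := by
  have hn1 : 1 ≤ n := by omega
  have hn' : (3 : ℝ) ≤ n := by exact_mod_cast hn
  obtain ⟨M, hM⟩ := H.exists_energy_bound hT
  have hφ1 := H.contDiffOn_one
  have h0 : (0 : ℝ) ∈ Icc 0 T := ⟨le_rfl, hT.le⟩
  -- `28 n` makes `A / 2` exceed the error `A / 4 + 2 n + 4 n` of the slices, `4` being Hardy's
  -- constant, with `n` to spare.
  set A : ℝ := 28 * n with hA
  have hA0 : 0 ≤ A := by positivity
  have hc0 : 0 < μ * (1 - 2 * μ) := mul_pos hμ0 (by linarith)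
  have hN : (1 : ℝ) ≤ (n + 1) ^ 3 := one_le_pow₀ (by linarith)
  have hXc : ∀ γ, ContDiffOn ℝ 1 (radialField n A μ R δ γ) (closedSlab n T) := fun γ =>
    (contDiff_radialField hδ A μ R γ).contDiffOn
  have hwc : ContDiffOn ℝ 2 (radialWeight n μ R δ) (closedSlab n T) :=
    (contDiff_radialWeight hδ μ R).contDiffOn
  set P := current T h (radialField n A μ R δ) (radialWeight n μ R δ) φ with hPdef
  have hP : ∀ α, ContDiffOn ℝ 1 (P α) (closedSlab n T) :=
    contDiffOn_current hT H.coeff hXc hwc H.smooth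
  set Q : SpaceTime n → ℝ :=
    fun z => 4 * (A + 1) * (n + 1) ^ 2 * (normD T φ z ^ 2 + φ z ^ 2 / δ) with hQ
  have hPQ : ∀ z ∈ closedSlab n T, ∀ α, |P α z| ≤ Q z := fun z hz α =>
    abs_current_le hn1 hT hA0 hμ0 hμ1 hδ h (H.small z hz) φ hz α
  have hDc := continuousOn_normD hT hφ1
  have hQc : ContinuousOn Q (closedSlab n T) :=
    continuousOn_const.mul ((hDc.pow 2).add ((hφ1.continuousOn.pow 2).div_const δ))
  have hQs : ∀ s ∈ Icc (0 : ℝ) T, Integrable fun x => Q (s, x) := fun s hs =>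
    ((hM s hs).2.1.add ((hM s hs).1.1.div_const δ)).const_mul _
  have hQi : IntegrableOn Q (openSlab n T) := by
    refine integrableOn_openSlab hQc (fun z _ => by simp only [hQ]; positivity)
      (M := 4 * (A + 1) * (n + 1) ^ 2 * (M + M / δ)) fun s hs => ?_
    have hs' := Ioo_subset_Icc_self hs
    refine ⟨hQs s hs', ?_⟩
    simp only [hQ]
    rw [integral_const_mul, integral_add (hM s hs').2.1 ((hM s hs').1.1.div_const δ),
      integral_div]
    refine mul_le_mul_of_nonneg_left ?_ (by positivity)
    exact add_le_add (hM s hs').2.2 (by gcongr; exact (hM s hs').1.2)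
  have hPs : ∀ s ∈ Icc (0 : ℝ) T, Integrable fun x => P 0 (s, x) := fun s hs =>
    (hQs s hs).mono' (continuous_slice (hP 0).continuousOn hs).aestronglyMeasurable
      (Filter.Eventually.of_forall fun x => hPQ _ (mem_closedSlab.2 ⟨hs.1, hs.2⟩) 0)
  set W : SpaceTime n → ℝ := fun z => bulkWeight μ R δ z * hardyDensity T δ φ z with hW
  have hsc : ContinuousOn (fun z : SpaceTime n => δ + ‖z.2‖ ^ 2) (closedSlab n T) := by fun_prop
  have hs0 : ∀ z : SpaceTime n, 0 < δ + ‖z.2‖ ^ 2 := fun z => by positivity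
  have hWc : ContinuousOn W (closedSlab n T) := by
    refine ContinuousOn.mul (ContinuousOn.mul ?_ ?_) ((hDc.pow 2).add
      ((hφ1.continuousOn.pow 2).div hsc fun z _ => (hs0 z).ne'))
    · exact ((contDiff_radial (k := 0) hδ μ R).continuous.comp continuous_snd).continuousOn
    · refine continuousOn_const.div (continuousOn_const.add hsc) fun z _ => ?_
      have := hs0 z
      positivity
  have hW0 : ∀ z, 0 ≤ W z := fun z => by
    have h1 := prof_pos μ R (hs0 z)
    have h2 := hs0 z
    simp only [hW, bulkWeight, hardyDensity]
    positivity
  set B : SpaceTime n → ℝ := fun z => 4 * (A + 1) * (n + 1) ^ 3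
    * (forcing T μ φ F z + perturbation T μ h φ z) with hBdef
  have hfp : ∀ z, 0 ≤ forcing T μ φ F z + perturbation T μ h φ z := fun z =>
    add_nonneg (forcing_nonneg T μ φ F z) (perturbation_nonneg T μ h φ z)
  have hBT : IntegrableOn B (openSlab n T) := hB.const_mul _
  have hB0 : ∀ z, 0 ≤ B z := fun z => mul_nonneg (by positivity) (hfp z)
  have hdiv : ∀ᵐ z ∂(volume.restrict (openSlab n t)), ∑ α, pd T α (P α) z
      ≤ -(μ * (1 - 2 * μ) * W z) + B z := by
    filter_upwards [ae_restrict_mem (measurableSet_openSlab n t), ae_snd_ne_zero hn1 t]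
      with z hz hz0
    have hzT := openSlab_mono n ht.2 hz
    have hzc := openSlab_subset_closedSlab n T hzT
    rw [sum_pd_current hT H.coeff H.symm hXc hwc H.smooth hzT, H.equation z hzT]
    have e1 := (abs_le.1 (abs_multiplier_mul_le (T := T) hn1 hA0 hμ0 hμ1 hδ hR φ F hz0)).2
    have e2 := (abs_le.1 (abs_pertBulk_le hn1 hT hA0 hμ0 hμ1 hδ hR h φ hzc hz0)).2
    have e3 := flatBulk_le (A := A) (R := R) hn hT hμ0 hμ1 hδ φ hzT
    have e4 : (A + 1) * (n + 1) * forcing T μ φ F z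
        ≤ 4 * (A + 1) * (n + 1) ^ 3 * forcing T μ φ F z := by
      refine mul_le_mul_of_nonneg_right ?_ (forcing_nonneg T μ φ F z)
      have h1 : (n + 1 : ℝ) ≤ (n + 1) ^ 3 := le_self_pow₀ (by linarith) (by norm_num)
      have h2 := mul_le_mul_of_nonneg_left h1 (by linarith : 0 ≤ A + 1)
      have h3 : 0 ≤ (A + 1) * (n + 1 : ℝ) ^ 3 := by positivity
      linarith
    simp only [hBdef, hW, mul_add (4 * (A + 1) * (n + 1 : ℝ) ^ 3)]
    linarith
  have hmain := integral_le_of_divergence_le (W := fun z => μ * (1 - 2 * μ) * W z) (B := B) hT ht hP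
    (hQi.mono_set (openSlab_mono n ht.2))
    (fun z hz a => hPQ z (openSlab_subset_closedSlab n T (openSlab_mono n ht.2 hz)) a.succ)
    (hPs t ht) (hPs 0 h0) (continuousOn_const.mul hWc)
    (fun z _ => mul_nonneg hc0.le (hW0 z)) (hBT.mono_set (openSlab_mono n ht.2))
    (Filter.Eventually.of_forall hB0) hdiv
  have hWi : IntegrableOn W (openSlab n t) := by
    have := hmain.1.const_mul (μ * (1 - 2 * μ))⁻¹
    refine this.congr (Filter.Eventually.of_forall fun z => ?_)
    simp only
    rw [← mul_assoc, inv_mul_cancel₀ hc0.ne', one_mul]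
  refine ⟨hWi, ?_⟩
  have hm2 := hmain.2
  rw [integral_const_mul (μ * (1 - 2 * μ)) W] at hm2
  have hBle : ∫ z in openSlab n t, B z ≤ 4 * (A + 1) * (n + 1) ^ 3
      * ∫ z in openSlab n T, (forcing T μ φ F z + perturbation T μ h φ z) := by
    rw [← integral_const_mul]
    exact setIntegral_mono_set hBT (Filter.Eventually.of_forall hB0)
      (openSlab_mono n ht.2).eventuallyLE
  -- The time slices of the current are comparable to the energy.
  have hslice : ∀ s ∈ Icc (0 : ℝ) T, |(∫ x, P 0 (s, x)) - A / 2 * energyAt T φ s|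
      ≤ (A / 4 + 6 * n) * energyAt T φ s := by
    intro s hs
    obtain ⟨k1, k2⟩ := H.hardy_slice hn hT hδ hs
    have k3 := (hM s hs).2.1
    have e1 : (∫ x, P 0 (s, x)) - A / 2 * energyAt T φ s
        = ∫ x, (P 0 (s, x) - A / 2 * normD T φ (s, x) ^ 2) := by
      rw [integral_sub (hPs s hs) (k3.const_mul _), integral_const_mul]
      rfl
    have e2 : ‖∫ x, (P 0 (s, x) - A / 2 * normD T φ (s, x) ^ 2)‖
        ≤ ∫ x, ((A / 4 + 2 * n) * normD T φ (s, x) ^ 2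
          + n * (φ (s, x) ^ 2 / (δ + ‖x‖ ^ 2))) := by
      refine norm_integral_le_of_norm_le ((k3.const_mul _).add (k1.const_mul _))
        (Filter.Eventually.of_forall fun x => ?_)
      have hz : ((s, x) : SpaceTime n) ∈ closedSlab n T := mem_closedSlab.2 ⟨hs.1, hs.2⟩
      exact abs_current_zero_sub_le hn1 hT hA0 hμ0 hδ h (H.small _ hz) φ hz
    rw [e1]
    refine (Real.norm_eq_abs _ ▸ e2).trans ?_
    rw [integral_add (k3.const_mul _) (k1.const_mul _), integral_const_mul, integral_const_mul]
    change (A / 4 + 2 * n) * energyAt T φ s + _ ≤ _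
    have := mul_le_mul_of_nonneg_left k2 (by linarith : (0 : ℝ) ≤ n)
    linarith
  have s1 := (abs_le.1 (hslice t ht)).1
  have s2 := (abs_le.1 (hslice 0 h0)).2
  have hEt := energyAt_nonneg T φ t
  have hE0 := energyAt_nonneg T φ 0
  have k5 : energyAt T φ t ≤ n * energyAt T φ t := le_mul_of_one_le_left hEt (by linarith)
  have k6 : 27 * n * energyAt T φ 0 ≤ 4 * (A + 1) * (n + 1) ^ 3 * energyAt T φ 0 := by
    refine mul_le_mul_of_nonneg_right ?_ hE0
    have := mul_le_mul_of_nonneg_left hN (by linarith : 0 ≤ 4 * (A + 1))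
    linarith
  rw [mul_add (4 * (A + 1) * (n + 1 : ℝ) ^ 3)]
  have e7 : A / 2 * energyAt T φ t - (A / 4 + 6 * n) * energyAt T φ t = n * energyAt T φ t := by
    rw [hA]; ring
  have e8 : A / 2 * energyAt T φ 0 + (A / 4 + 6 * n) * energyAt T φ 0
      = 27 * n * energyAt T φ 0 := by
    rw [hA]; ring
  linarith

end WaveSolution

/-! ### Removing the regularization -/

theorem hardyDensity_nonneg {n : ℕ} {δ : ℝ} (hδ : 0 ≤ δ) (T : ℝ) (φ : SpaceTime n → ℝ)
    (z : SpaceTime n) : 0 ≤ hardyDensity T δ φ z := by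
  rw [hardyDensity]
  positivity

theorem bulkWeight_nonneg {n : ℕ} {δ : ℝ} (hδ : 0 ≤ δ) (μ R : ℝ) (z : SpaceTime n) :
    0 ≤ bulkWeight μ R δ z := by
  rw [bulkWeight, prof]
  positivity

theorem tendsto_bulkWeight_mul_hardyDensity {n : ℕ} (T μ R : ℝ) (φ : SpaceTime n → ℝ)
    {z : SpaceTime n} (hz : z.2 ≠ 0) :
    Filter.Tendsto (fun k : ℕ => bulkWeight μ R (1 / ((k : ℝ) + 1)) z
        * hardyDensity T (1 / ((k : ℝ) + 1)) φ z) Filter.atTop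
      (nhds (bulkWeight μ R 0 z * hardyDensity T 0 φ z)) := by
  have hr : 0 < (0 : ℝ) + ‖z.2‖ ^ 2 := by
    have := norm_pos_iff.2 hz
    positivity
  have hc : ContinuousAt (fun δ : ℝ => bulkWeight μ R δ z * hardyDensity T δ φ z) 0 := by
    have h1 : ContinuousAt (fun δ : ℝ => δ + ‖z.2‖ ^ 2) 0 := by fun_prop
    have h2 : ContinuousAt (fun δ : ℝ => prof μ R (δ + ‖z.2‖ ^ 2)) 0 :=
      ContinuousAt.comp (g := prof μ R) (contDiffAt_prof μ R hr (k := 0)).continuousAt h1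
    have h3 : R ^ 2 + (0 + ‖z.2‖ ^ 2) ≠ 0 := by positivity
    exact (h2.mul (continuousAt_const.div (continuousAt_const.add h1) h3)).mul
      (continuousAt_const.add (continuousAt_const.div h1 hr.ne'))
  exact hc.tendsto.comp tendsto_one_div_add_atTop_nhds_zero_nat

namespace WaveSolution

variable {n : ℕ} {T : ℝ} {h : Fin (n + 1) → Fin (n + 1) → SpaceTime n → ℝ}
  {F φ : SpaceTime n → ℝ}

theorem continuousOn_hardyDensity (H : WaveSolution n T h F φ) (hT : 0 < T) {δ : ℝ}
    (hδ : 0 < δ) : ContinuousOn (hardyDensity T δ φ) (closedSlab n T) := by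
  have hs0 : ∀ z : SpaceTime n, δ + ‖z.2‖ ^ 2 ≠ 0 := fun z => by positivity
  exact ((continuousOn_normD hT H.contDiffOn_one).pow 2).add
    ((H.contDiffOn_one.continuousOn.pow 2).div (by fun_prop) fun z _ => hs0 z)

/-- The scale-`R` weighted norm on the whole slab, with the singular weights `δ = 0`. -/
theorem lintegral_bulk_le (H : WaveSolution n T h F φ) (hn : 3 ≤ n) (hT : 0 < T) {μ R : ℝ}
    (hμ0 : 0 < μ) (hμ1 : μ < 1 / 2) (hR : 1 ≤ R)
    (hB : IntegrableOn (fun z => forcing T μ φ F z + perturbation T μ h φ z) (openSlab n T)) :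
    ∫⁻ z in openSlab n T, ENNReal.ofReal (bulkWeight μ R 0 z * hardyDensity T 0 φ z)
      ≤ ENNReal.ofReal (4 * (28 * n + 1) * (n + 1) ^ 3 / (μ * (1 - 2 * μ)) * (energyAt T φ 0
          + ∫ z in openSlab n T, (forcing T μ φ F z + perturbation T μ h φ z))) := by
  have hc0 : 0 < μ * (1 - 2 * μ) := mul_pos hμ0 (by linarith)
  have hn1 : 1 ≤ n := by omega
  have hreg : ∀ k : ℕ, IntegrableOn (fun z : SpaceTime n => bulkWeight μ R (1 / ((k : ℝ) + 1)) z
        * hardyDensity T (1 / ((k : ℝ) + 1)) φ z) (openSlab n T) ∧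
      ∫⁻ z in openSlab n T, ENNReal.ofReal (bulkWeight μ R (1 / ((k : ℝ) + 1)) z
        * hardyDensity T (1 / ((k : ℝ) + 1)) φ z)
      ≤ ENNReal.ofReal (4 * (28 * n + 1) * (n + 1) ^ 3 / (μ * (1 - 2 * μ)) * (energyAt T φ 0
          + ∫ z in openSlab n T, (forcing T μ φ F z + perturbation T μ h φ z))) := by
    intro k
    have hδ : (0 : ℝ) < 1 / ((k : ℝ) + 1) := by positivity
    obtain ⟨h1, h2⟩ := H.energy_morawetz hn hT hμ0 hμ1 hδ hR hB ⟨hT.le, le_rfl⟩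
    refine ⟨h1, ?_⟩
    rw [← ofReal_integral_eq_lintegral_ofReal h1 (Filter.Eventually.of_forall fun z =>
      mul_nonneg (bulkWeight_nonneg hδ.le μ R z) (hardyDensity_nonneg hδ.le T φ z))]
    refine ENNReal.ofReal_le_ofReal ?_
    rw [div_mul_eq_mul_div, le_div_iff₀ hc0, mul_comm]
    have := energyAt_nonneg T φ T
    linarith
  calc ∫⁻ z in openSlab n T, ENNReal.ofReal (bulkWeight μ R 0 z * hardyDensity T 0 φ z)
      = ∫⁻ z in openSlab n T, Filter.liminf (fun k : ℕ =>
          ENNReal.ofReal (bulkWeight μ R (1 / ((k : ℝ) + 1)) z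
            * hardyDensity T (1 / ((k : ℝ) + 1)) φ z)) Filter.atTop := by
        refine lintegral_congr_ae ?_
        filter_upwards [ae_snd_ne_zero hn1 T] with z hz
        exact (ENNReal.tendsto_ofReal
          (tendsto_bulkWeight_mul_hardyDensity T μ R φ hz)).liminf_eq.symm
    _ ≤ Filter.liminf (fun k : ℕ => ∫⁻ z in openSlab n T,
          ENNReal.ofReal (bulkWeight μ R (1 / ((k : ℝ) + 1)) z
            * hardyDensity T (1 / ((k : ℝ) + 1)) φ z)) Filter.atTop :=
        lintegral_liminf_le' fun k => (hreg k).1.aestronglyMeasurable.aemeasurable.ennreal_ofReal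
    _ ≤ _ := by
        refine (Filter.liminf_le_liminf (Filter.Eventually.of_forall fun k => (hreg k).2)).trans ?_
        rw [Filter.liminf_const]

/-- The uniform-in-time energy bound, integrated over the slab. -/
theorem lintegral_hardyDensity_le (H : WaveSolution n T h F φ) (hn : 3 ≤ n) (hT : 0 < T) {μ : ℝ}
    (hμ0 : 0 < μ) (hμ1 : μ < 1 / 2)
    (hB : IntegrableOn (fun z => forcing T μ φ F z + perturbation T μ h φ z) (openSlab n T)) :
    ∫⁻ z in openSlab n T, ENNReal.ofReal (hardyDensity T 1 φ z)
      ≤ ENNReal.ofReal (5 * (4 * (28 * n + 1) * (n + 1) ^ 3) * (energyAt T φ 0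
          + ∫ z in openSlab n T, (forcing T μ φ F z + perturbation T μ h φ z)))
        * ENNReal.ofReal T := by
  have hc0 : 0 < μ * (1 - 2 * μ) := mul_pos hμ0 (by linarith)
  refine lintegral_openSlab_le (H.continuousOn_hardyDensity hT one_pos) fun t ht => ?_
  have ht' := Ioo_subset_Icc_self ht
  obtain ⟨M, hM⟩ := H.exists_energy_bound hT
  have i1 := (hM t ht').2.1
  obtain ⟨i2, i3⟩ := H.hardy_slice hn hT one_pos ht'
  have hint : Integrable fun x => hardyDensity T 1 φ (t, x) := i1.add i2
  rw [← ofReal_integral_eq_lintegral_ofReal hint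
    (Filter.Eventually.of_forall fun x => hardyDensity_nonneg zero_le_one T φ _)]
  refine ENNReal.ofReal_le_ofReal ?_
  have e1 : ∫ x, hardyDensity T 1 φ (t, x)
      = energyAt T φ t + ∫ x, φ (t, x) ^ 2 / (1 + ‖x‖ ^ 2) := integral_add i1 i2
  obtain ⟨-, h2⟩ := H.energy_morawetz hn hT hμ0 hμ1 one_pos le_rfl hB ht'
  have h3 : 0 ≤ μ * (1 - 2 * μ) * ∫ z in openSlab n t, bulkWeight μ 1 1 z
        * hardyDensity T 1 φ z :=
    mul_nonneg hc0.le (integral_nonneg fun z => mul_nonneg (bulkWeight_nonneg zero_le_one μ 1 z)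
      (hardyDensity_nonneg zero_le_one T φ z))
  rw [e1]
  linarith

end WaveSolution

/-! ### Comparison of the weights -/

section weights

variable {n : ℕ} {T μ : ℝ} {z : SpaceTime n}

theorem bulkWeight_zero_eq (μ R : ℝ) (z : SpaceTime n) :
    bulkWeight μ R 0 z = rad z ^ (2 * μ - 1)
      * ((R ^ 2 + rad z ^ 2) ^ (-μ) * (R ^ 2 / (R ^ 2 + rad z ^ 2))) := by
  have h1 : (‖z.2‖ ^ 2) ^ (μ - 1 / 2) = ‖z.2‖ ^ (2 * μ - 1) := by
    rw [← Real.rpow_natCast, ← Real.rpow_mul (norm_nonneg _)]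
    congr 1; push_cast; ring
  rw [bulkWeight, prof, rad, zero_add, h1, mul_assoc]

theorem jap_rpow (μ : ℝ) (z : SpaceTime n) : jap z ^ (-(2 * μ)) = (1 + rad z ^ 2) ^ (-μ) := by
  rw [jap, rad, Real.sqrt_eq_rpow, ← Real.rpow_mul (by positivity)]
  congr 1; ring

theorem two_rpow_neg_ge (hμ0 : 0 < μ) (hμ1 : μ < 1 / 2) : (1 : ℝ) / 2 ≤ 2 ^ (-μ) := by
  have h1 : (2 : ℝ) ^ (-1 : ℝ) ≤ 2 ^ (-μ) :=
    Real.rpow_le_rpow_of_exponent_le (by norm_num) (by linarith)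
  rw [Real.rpow_neg_one] at h1
  linarith

/-- Inside the ball `r ≤ R` the scale-`R` weight dominates `R^{-2μ} r^{2μ-1}`. -/
theorem near_weight_le (hμ0 : 0 < μ) (hμ1 : μ < 1 / 2) {R : ℝ} (hR : 0 < R) (hr : rad z ≤ R) :
    R ^ (-(2 * μ)) * rad z ^ (2 * μ - 1) ≤ 4 * bulkWeight μ R 0 z := by
  have hr0 : 0 ≤ rad z := norm_nonneg _
  have hr2 : rad z ^ 2 ≤ R ^ 2 := by gcongr
  rw [bulkWeight_zero_eq]
  have h1 : (1 : ℝ) / 2 ≤ R ^ 2 / (R ^ 2 + rad z ^ 2) := by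
    rw [div_le_div_iff₀ (by norm_num) (by positivity)]
    linarith
  have h2 : 1 / 2 * R ^ (-(2 * μ)) ≤ (R ^ 2 + rad z ^ 2) ^ (-μ) := by
    calc 1 / 2 * R ^ (-(2 * μ)) ≤ 2 ^ (-μ) * R ^ (-(2 * μ)) := by
          have := two_rpow_neg_ge hμ0 hμ1
          gcongr
      _ = (2 * R ^ 2) ^ (-μ) := by
          rw [Real.mul_rpow (by norm_num) (by positivity), ← Real.rpow_natCast R,
            ← Real.rpow_mul hR.le]
          congr 2; push_cast; ring
      _ ≤ _ := Real.rpow_le_rpow_of_nonpos (by positivity) (by linarith) (by linarith)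
  calc R ^ (-(2 * μ)) * rad z ^ (2 * μ - 1)
      = 4 * (rad z ^ (2 * μ - 1) * (1 / 2 * R ^ (-(2 * μ)) * (1 / 2))) := by ring
    _ ≤ _ := by gcongr

/-- In the shell `R ≤ r ≤ 2R` the scale-`R` weight dominates `r^{2μ-1} ⟨r⟩^{-2μ}`. -/
theorem shell_weight_le (hμ0 : 0 < μ) (hμ1 : μ < 1 / 2) {R : ℝ} (hR : 0 < R) (hr : R ≤ rad z)
    (hr' : rad z ≤ 2 * R) :
    rad z ^ (2 * μ - 1) * jap z ^ (-(2 * μ)) ≤ 10 * bulkWeight μ R 0 z := by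
  have hr0 : 0 ≤ rad z := norm_nonneg _
  have hr2 : R ^ 2 ≤ rad z ^ 2 := by gcongr
  have hr2' : rad z ^ 2 ≤ 4 * R ^ 2 := by nlinarith
  rw [bulkWeight_zero_eq, jap_rpow]
  have h1 : (1 : ℝ) / 5 ≤ R ^ 2 / (R ^ 2 + rad z ^ 2) := by
    rw [div_le_div_iff₀ (by norm_num) (by positivity)]
    linarith
  have h2 : 1 / 2 * (1 + rad z ^ 2) ^ (-μ) ≤ (R ^ 2 + rad z ^ 2) ^ (-μ) := by
    calc 1 / 2 * (1 + rad z ^ 2) ^ (-μ) ≤ 2 ^ (-μ) * (1 + rad z ^ 2) ^ (-μ) := by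
          have := two_rpow_neg_ge hμ0 hμ1
          gcongr
      _ = (2 * (1 + rad z ^ 2)) ^ (-μ) := by
          rw [Real.mul_rpow (by norm_num) (by positivity)]
      _ ≤ _ := Real.rpow_le_rpow_of_nonpos (by positivity) (by linarith) (by linarith)
  calc rad z ^ (2 * μ - 1) * (1 + rad z ^ 2) ^ (-μ)
      = 10 * (rad z ^ (2 * μ - 1) * (1 / 2 * (1 + rad z ^ 2) ^ (-μ) * (1 / 5))) := by ring
    _ ≤ _ := by gcongr

theorem core_weight_le (hr : rad z ≤ 1) :
    rad z ^ (2 * μ - 1) * jap z ^ (-(2 * μ)) ≤ 10 * bulkWeight μ 1 0 z := by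
  have hr0 : 0 ≤ rad z := norm_nonneg _
  have hr2 : rad z ^ 2 ≤ 1 := pow_le_one₀ hr0 hr
  rw [bulkWeight_zero_eq, jap_rpow, one_pow]
  have h1 : (1 : ℝ) / 10 ≤ 1 / (1 + rad z ^ 2) :=
    one_div_le_one_div_of_le (by positivity) (by linarith)
  calc rad z ^ (2 * μ - 1) * (1 + rad z ^ 2) ^ (-μ)
      = 10 * (rad z ^ (2 * μ - 1) * ((1 + rad z ^ 2) ^ (-μ) * (1 / 10))) := by ring
    _ ≤ _ := by gcongr

/-- Away from the unit ball the regularization only costs a factor two. -/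
theorem hardyDensity_zero_le (φ : SpaceTime n → ℝ) (hr : 1 ≤ rad z) :
    hardyDensity T 0 φ z ≤ 2 * hardyDensity T 1 φ z := by
  have h2 : (1 : ℝ) ≤ ‖z.2‖ ^ 2 := one_le_pow₀ hr
  have h1 : φ z ^ 2 / (0 + ‖z.2‖ ^ 2) ≤ 2 * (φ z ^ 2 / (1 + ‖z.2‖ ^ 2)) := by
    rw [← mul_div_assoc, div_le_div_iff₀ (by linarith) (by linarith)]
    nlinarith [sq_nonneg (φ z)]
  simp only [hardyDensity]
  linarith [sq_nonneg (normD T φ z)]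

/-- The first weight, bounded by the scale `1 + T` and the far zone. -/
theorem first_weight_le (hT : 0 < T) (hμ0 : 0 < μ) (hμ1 : μ < 1 / 2) (φ : SpaceTime n → ℝ) :
    (1 + T) ^ (-(2 * μ)) * (rad z ^ (2 * μ - 1) * hardyDensity T 0 φ z)
      ≤ 4 * (bulkWeight μ (1 + T) 0 z * hardyDensity T 0 φ z)
        + 2 * (1 + T)⁻¹ * hardyDensity T 1 φ z := by
  have hR : 0 < 1 + T := by linarith
  have hd0 := hardyDensity_nonneg le_rfl T φ z
  have hd1 := hardyDensity_nonneg zero_le_one T φ z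
  have hb := bulkWeight_nonneg le_rfl μ (1 + T) z
  rcases le_total (rad z) (1 + T) with hr | hr
  · have h1 := mul_le_mul_of_nonneg_right (near_weight_le hμ0 hμ1 hR hr) hd0
    have h2 : 0 ≤ 2 * (1 + T)⁻¹ * hardyDensity T 1 φ z := by positivity
    linarith
  · have h1 : rad z ^ (2 * μ - 1) ≤ (1 + T) ^ (2 * μ - 1) :=
      Real.rpow_le_rpow_of_nonpos hR hr (by linarith)
    have h2 : (1 + T) ^ (-(2 * μ)) * (1 + T) ^ (2 * μ - 1) = (1 + T)⁻¹ := by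
      rw [← Real.rpow_add hR, show -(2 * μ) + (2 * μ - 1) = -1 by ring, Real.rpow_neg_one]
    have h3 := hardyDensity_zero_le (T := T) φ (show 1 ≤ rad z by linarith)
    calc (1 + T) ^ (-(2 * μ)) * (rad z ^ (2 * μ - 1) * hardyDensity T 0 φ z)
        ≤ (1 + T) ^ (-(2 * μ)) * ((1 + T) ^ (2 * μ - 1) * (2 * hardyDensity T 1 φ z)) := by
          gcongr
      _ = 2 * (1 + T)⁻¹ * hardyDensity T 1 φ z := by rw [← h2]; ring
      _ ≤ _ := le_add_of_nonneg_left (by positivity)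

/-- The second weight, bounded by the dyadic scales up to `1 + T` and the far zone. -/
theorem second_weight_le (hT : 0 < T) (hμ0 : 0 < μ) (hμ1 : μ < 1 / 2) (φ : SpaceTime n → ℝ)
    {K : ℕ} (hK : 1 + T < 2 ^ (K + 1)) :
    rad z ^ (2 * μ - 1) * jap z ^ (-(2 * μ)) * hardyDensity T 0 φ z
      ≤ 10 * ∑ k ∈ Finset.range (K + 1), bulkWeight μ (2 ^ k) 0 z * hardyDensity T 0 φ z
        + 2 * (1 + T)⁻¹ * hardyDensity T 1 φ z := by
  have hR : 0 < 1 + T := by linarith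
  have hd0 := hardyDensity_nonneg le_rfl T φ z
  have hd1 := hardyDensity_nonneg zero_le_one T φ z
  have hb : ∀ k : ℕ, 0 ≤ bulkWeight μ (2 ^ k) 0 z * hardyDensity T 0 φ z := fun k =>
    mul_nonneg (bulkWeight_nonneg le_rfl μ _ z) hd0
  have hsum : 0 ≤ ∑ k ∈ Finset.range (K + 1), bulkWeight μ (2 ^ k) 0 z * hardyDensity T 0 φ z :=
    Finset.sum_nonneg fun k _ => hb k
  have hfar : 0 ≤ 2 * (1 + T)⁻¹ * hardyDensity T 1 φ z := by positivity
  have hone : ∀ k ∈ Finset.range (K + 1), bulkWeight μ (2 ^ k) 0 z * hardyDensity T 0 φ z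
      ≤ ∑ k ∈ Finset.range (K + 1), bulkWeight μ (2 ^ k) 0 z * hardyDensity T 0 φ z :=
    fun k hk => Finset.single_le_sum (fun k _ => hb k) hk
  rcases le_total (rad z) 1 with hr1 | hr1
  · have h1 := mul_le_mul_of_nonneg_right (core_weight_le (μ := μ) hr1) hd0
    have h2 := hone 0 (by simp)
    rw [pow_zero] at h2
    linarith
  rcases le_total (rad z) (1 + T) with hr | hr
  · obtain ⟨k, hk1, hk2⟩ := exists_nat_pow_near hr1 (one_lt_two : (1 : ℝ) < 2)
    have hkK : k ∈ Finset.range (K + 1) := by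
      rw [Finset.mem_range]
      exact (pow_lt_pow_iff_right₀ (one_lt_two : (1 : ℝ) < 2)).1 ((hk1.trans hr).trans_lt hK)
    have h1 := mul_le_mul_of_nonneg_right (shell_weight_le hμ0 hμ1 (by positivity) hk1
      (by rw [pow_succ] at hk2; linarith)) hd0
    have h2 := hone k hkK
    linarith
  · have hr0 : 0 < rad z := by linarith
    have h1 : jap z ^ (-(2 * μ)) ≤ rad z ^ (-(2 * μ)) := by
      refine Real.rpow_le_rpow_of_nonpos hr0 ?_ (by linarith)
      exact Real.le_sqrt_of_sq_le (by rw [rad]; linarith)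
    have h2 : rad z ^ (2 * μ - 1) * rad z ^ (-(2 * μ)) = (rad z)⁻¹ := by
      rw [← Real.rpow_add hr0, show 2 * μ - 1 + -(2 * μ) = -1 by ring, Real.rpow_neg_one]
    have h3 := hardyDensity_zero_le (T := T) φ hr1
    calc rad z ^ (2 * μ - 1) * jap z ^ (-(2 * μ)) * hardyDensity T 0 φ z
        ≤ rad z ^ (2 * μ - 1) * rad z ^ (-(2 * μ)) * (2 * hardyDensity T 1 φ z) := by gcongr
      _ = (rad z)⁻¹ * (2 * hardyDensity T 1 φ z) := by rw [h2]
      _ ≤ (1 + T)⁻¹ * (2 * hardyDensity T 1 φ z) := by gcongr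
      _ = 2 * (1 + T)⁻¹ * hardyDensity T 1 φ z := by ring
      _ ≤ _ := le_add_of_nonneg_left (by positivity)

end weights

/-- The number of dyadic scales between `1` and `1 + T` is `O(log (2 + T))`. -/
theorem exists_dyadic_scale {T : ℝ} (hT : 0 < T) :
    ∃ K : ℕ, 1 + T < 2 ^ (K + 1) ∧ ((K : ℝ) + 1) ≤ 4 * Real.log (2 + T) := by
  obtain ⟨K, h1, h2⟩ := exists_nat_pow_near (show (1 : ℝ) ≤ 1 + T by linarith)
    (one_lt_two : (1 : ℝ) < 2)
  refine ⟨K, h2, ?_⟩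
  have h3 : (K : ℝ) * Real.log 2 ≤ Real.log (2 + T) := by
    rw [← Real.log_pow]
    exact Real.log_le_log (by positivity) (by linarith)
  have h4 : Real.log 2 ≤ Real.log (2 + T) := Real.log_le_log (by norm_num) (by linarith)
  have h5 := Real.log_two_gt_d9
  nlinarith [(Nat.cast_nonneg K : (0 : ℝ) ≤ K)]

/-! ### The two sides of the estimate as integrals -/

theorem sq_eLpNorm_two {α E : Type*} [MeasurableSpace α] [NormedAddCommGroup E] (m : Measure α)
    (u : α → E) : eLpNorm u 2 m ^ 2 = ∫⁻ x, ENNReal.ofReal (‖u x‖ ^ 2) ∂m := by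
  have h1 := eLpNorm_nnreal_pow_eq_lintegral (f := u) (μ := m) (p := 2) (by norm_num)
  simp only [NNReal.coe_ofNat, ENNReal.coe_ofNat, ENNReal.rpow_ofNat] at h1
  rw [h1]
  refine lintegral_congr fun x => ?_
  rw [ENNReal.ofReal_pow (norm_nonneg _), ofReal_norm]

/-- For a weight `v`, the weighted norms of `φ / r` and `∂φ` add up to the weighted integral of
the density `|∂φ|² + φ² / r²`. -/
theorem sqNormSlab_add {n : ℕ} (hn : 1 ≤ n) {T : ℝ} {φ : SpaceTime n → ℝ}
    {v w₁ w₂ : SpaceTime n → ℝ} (hm : AEMeasurable w₁ (volume.restrict (openSlab n T)))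
    (hv : ∀ z : SpaceTime n, z.2 ≠ 0 → 0 ≤ v z)
    (h₁ : ∀ z : SpaceTime n, z.2 ≠ 0 → w₁ z ^ 2 = v z * (φ z ^ 2 / ‖z.2‖ ^ 2))
    (h₂ : ∀ z : SpaceTime n, z.2 ≠ 0 → w₂ z ^ 2 = v z * normD T φ z ^ 2) :
    sqNormSlab T w₁ + sqNormSlab T w₂
      = ∫⁻ z in openSlab n T, ENNReal.ofReal (v z * hardyDensity T 0 φ z) := by
  rw [sqNormSlab, sqNormSlab, sq_eLpNorm_two, sq_eLpNorm_two,
    ← lintegral_add_left' (hm.norm.pow_const 2).ennreal_ofReal]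
  refine lintegral_congr_ae ?_
  filter_upwards [ae_snd_ne_zero hn T] with z hz
  rw [Real.norm_eq_abs, Real.norm_eq_abs, sq_abs, sq_abs, h₁ z hz, h₂ z hz,
    ← ENNReal.ofReal_add (mul_nonneg (hv z hz) (by positivity))
      (mul_nonneg (hv z hz) (by positivity)), hardyDensity, zero_add]
  congr 1
  ring

theorem norm_gradient_sq {n : ℕ} (u : Space n → ℝ) (x : Space n) :
    ‖gradient u x‖ ^ 2 = ∑ a, fderiv ℝ u x (spaceBasis a) ^ 2 := by
  rw [norm_sq_eq_sum]
  refine Finset.sum_congr rfl fun a _ => ?_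
  congr 1
  have h1 : inner ℝ (gradient u x) (spaceBasis a) = fderiv ℝ u x (spaceBasis a) := by
    rw [gradient, InnerProductSpace.toDual_symm_apply]
  have h2 : inner ℝ (gradient u x) (spaceBasis a) = gradient u x a := by
    rw [spaceBasis, EuclideanSpace.inner_single_right]
    simp
  rw [← h2, h1]

theorem WaveSolution.ofReal_energyAt_zero {n : ℕ} {T : ℝ}
    {h : Fin (n + 1) → Fin (n + 1) → SpaceTime n → ℝ} {F φ : SpaceTime n → ℝ}
    (H : WaveSolution n T h F φ) (hT : 0 < T) {f g : Space n → ℝ} (hf : ∀ x, φ (0, x) = f x)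
    (hg : ∀ x, pd T 0 φ (0, x) = g x) :
    ENNReal.ofReal (energyAt T φ 0)
      = eLpNorm (gradient f) 2 volume ^ 2 + eLpNorm g 2 volume ^ 2 := by
  have h0 : (0 : ℝ) ∈ Icc 0 T := ⟨le_rfl, hT.le⟩
  obtain ⟨M, hM⟩ := H.exists_energy_bound hT
  have hf' : f = fun x => φ (0, x) := funext fun x => (hf x).symm
  have hg' : g = fun x => pd T 0 φ (0, x) := funext fun x => (hg x).symm
  have hgm : Continuous g := by
    rw [hg']
    exact continuous_slice (continuousOn_pd hT H.contDiffOn_one 0) h0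
  rw [energyAt, ofReal_integral_eq_lintegral_ofReal (hM 0 h0).2.1
    (Filter.Eventually.of_forall fun x => sq_nonneg _), sq_eLpNorm_two, sq_eLpNorm_two,
    ← lintegral_add_right _ (hgm.norm.measurable.pow_const 2).ennreal_ofReal]
  refine lintegral_congr fun x => ?_
  rw [← ENNReal.ofReal_add (by positivity) (by positivity), norm_gradient_sq, hf', hg',
    Real.norm_eq_abs, sq_abs, normD_sq, Fin.sum_univ_succ, add_comm]
  simp only [fderiv_slice H.contDiffOn_one h0]

/-! ### The weighted space-time estimate -/

/-- Both weighted norms are controlled by a common bound `M` for the estimates at all scales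
`R ≥ 1` and for the far zone. -/
theorem weighted_norms_le {n : ℕ} (hn : 1 ≤ n) {T μ : ℝ} (hT : 0 < T) (hμ0 : 0 < μ)
    (hμ1 : μ < 1 / 2) {φ : SpaceTime n → ℝ} (hφ : ContDiffOn ℝ 1 φ (closedSlab n T)) {M : ℝ≥0∞}
    (hnear : ∀ R : ℝ, 1 ≤ R →
      ∫⁻ z in openSlab n T, ENNReal.ofReal (bulkWeight μ R 0 z * hardyDensity T 0 φ z) ≤ M)
    (hfar : ∫⁻ z in openSlab n T, ENNReal.ofReal (hardyDensity T 1 φ z)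
      ≤ M * ENNReal.ofReal T) :
    ENNReal.ofReal ((1 + T) ^ (-(2 * μ))) *
        (sqNormSlab T (fun z : SpaceTime n => rad z ^ (-(3 / 2) + μ) * φ z)
          + sqNormSlab T (fun z : SpaceTime n => rad z ^ (-(1 / 2) + μ) * normD T φ z))
      + ENNReal.ofReal ((Real.log (2 + T))⁻¹) *
        (sqNormSlab T (fun z : SpaceTime n => rad z ^ (-(3 / 2) + μ) * jap z ^ (-μ) * φ z)
          + sqNormSlab T
            (fun z : SpaceTime n => rad z ^ (-(1 / 2) + μ) * jap z ^ (-μ) * normD T φ z))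
      ≤ 50 * M := by
  have hR : 0 < 1 + T := by linarith
  have hlog : 0 < Real.log (2 + T) := Real.log_pos (by linarith)
  have hrpos : ∀ z : SpaceTime n, z.2 ≠ 0 → 0 < rad z := fun z hz => norm_pos_iff.2 hz
  have hjpos : ∀ z : SpaceTime n, 0 < jap z := fun z => Real.sqrt_pos.2 (by positivity)
  have mφ := aemeasurable_of_continuousOn hφ.continuousOn
  have mD := aemeasurable_of_continuousOn (continuousOn_normD hT hφ)
  have mr : ∀ p : ℝ, AEMeasurable (fun z : SpaceTime n => rad z ^ p)
      (volume.restrict (openSlab n T)) := fun p => ((measurable_rad n).pow_const p).aemeasurable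
  have mj : ∀ p : ℝ, AEMeasurable (fun z : SpaceTime n => jap z ^ p)
      (volume.restrict (openSlab n T)) := fun p => ((measurable_jap n).pow_const p).aemeasurable
  have mrad : AEMeasurable (fun z : SpaceTime n => ‖z.2‖) (volume.restrict (openSlab n T)) :=
    (measurable_rad n).aemeasurable
  have mh : ∀ δ : ℝ, AEMeasurable (hardyDensity T δ φ) (volume.restrict (openSlab n T)) :=
    fun δ => (mD.pow_const 2).add ((mφ.pow_const 2).div ((mrad.pow_const 2).const_add δ))
  have mb : ∀ R : ℝ, AEMeasurable (bulkWeight μ R 0) (volume.restrict (openSlab n T)) := by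
    intro R
    have h1 : AEMeasurable (fun z : SpaceTime n => rad z ^ (2 * μ - 1)
        * ((R ^ 2 + rad z ^ 2) ^ (-μ) * (R ^ 2 / (R ^ 2 + rad z ^ 2))))
        (volume.restrict (openSlab n T)) :=
      (mr _).mul (((((measurable_rad n).pow_const 2).const_add (R ^ 2)).pow_const (-μ)).aemeasurable.mul
        ((((measurable_rad n).pow_const 2).const_add (R ^ 2)).const_div (R ^ 2)).aemeasurable)
    exact h1.congr (Filter.Eventually.of_forall fun z => (bulkWeight_zero_eq μ R z).symm)
  have r3 : ∀ z : SpaceTime n, z.2 ≠ 0 →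
      (rad z ^ (-(3 / 2) + μ)) ^ 2 = rad z ^ (2 * μ - 1) / ‖z.2‖ ^ 2 := by
    intro z hz
    have h1 := hrpos z hz
    rw [← Real.rpow_natCast, ← Real.rpow_mul h1.le, eq_div_iff (by
      have : 0 < ‖z.2‖ := h1
      positivity), ← Real.rpow_natCast ‖z.2‖]
    change rad z ^ _ * rad z ^ _ = _
    rw [← Real.rpow_add h1]
    congr 1; push_cast; ring
  have r1 : ∀ z : SpaceTime n, z.2 ≠ 0 → (rad z ^ (-(1 / 2) + μ)) ^ 2 = rad z ^ (2 * μ - 1) := by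
    intro z hz
    rw [← Real.rpow_natCast, ← Real.rpow_mul (hrpos z hz).le]
    congr 1; push_cast; ring
  have j1 : ∀ z : SpaceTime n, (jap z ^ (-μ)) ^ 2 = jap z ^ (-(2 * μ)) := by
    intro z
    rw [← Real.rpow_natCast, ← Real.rpow_mul (hjpos z).le]
    congr 1; push_cast; ring
  rw [sqNormSlab_add (φ := φ) (v := fun z => rad z ^ (2 * μ - 1))
      (w₁ := fun z : SpaceTime n => rad z ^ (-(3 / 2) + μ) * φ z)
      (w₂ := fun z : SpaceTime n => rad z ^ (-(1 / 2) + μ) * normD T φ z) hn ((mr _).mul mφ)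
      (fun z hz => (Real.rpow_pos_of_pos (hrpos z hz) _).le)
      (fun z hz => by simp only [mul_pow, r3 z hz]; ring)
      (fun z hz => by simp only [mul_pow, r1 z hz]),
    sqNormSlab_add (φ := φ) (v := fun z => rad z ^ (2 * μ - 1) * jap z ^ (-(2 * μ)))
      (w₁ := fun z : SpaceTime n => rad z ^ (-(3 / 2) + μ) * jap z ^ (-μ) * φ z)
      (w₂ := fun z : SpaceTime n => rad z ^ (-(1 / 2) + μ) * jap z ^ (-μ) * normD T φ z) hn
      (((mr _).mul (mj _)).mul mφ)
      (fun z hz => (mul_pos (Real.rpow_pos_of_pos (hrpos z hz) _)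
        (Real.rpow_pos_of_pos (hjpos z) _)).le)
      (fun z hz => by simp only [mul_pow, r3 z hz, j1]; ring)
      (fun z hz => by simp only [mul_pow, r1 z hz, j1])]
  -- The far zone costs a factor `T` from the time integral, compensated by the weight `1/(1+T)`.
  have hfar' : ∫⁻ z in openSlab n T, ENNReal.ofReal (2 * (1 + T)⁻¹ * hardyDensity T 1 φ z)
      ≤ 2 * M := by
    have hc : 0 ≤ 2 * (1 + T)⁻¹ := by positivity
    simp only [ENNReal.ofReal_mul hc]
    rw [lintegral_const_mul'' _ (mh 1).ennreal_ofReal]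
    calc ENNReal.ofReal (2 * (1 + T)⁻¹) * ∫⁻ z in openSlab n T, ENNReal.ofReal (hardyDensity T 1 φ z)
        ≤ ENNReal.ofReal (2 * (1 + T)⁻¹) * (M * ENNReal.ofReal T) := by gcongr
      _ = ENNReal.ofReal (2 * (1 + T)⁻¹ * T) * M := by
          rw [ENNReal.ofReal_mul hc]; ring
      _ ≤ 2 * M := by
          gcongr
          refine ENNReal.ofReal_le_of_le_toReal ?_
          rw [ENNReal.toReal_ofNat, mul_assoc, inv_mul_eq_div]
          have : T / (1 + T) ≤ 1 := (div_le_one hR).2 (by linarith)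
          linarith
  have hd : ∀ δ : ℝ, 0 ≤ δ → ∀ z : SpaceTime n, 0 ≤ hardyDensity T δ φ z := fun δ hδ z =>
    hardyDensity_nonneg hδ T φ z
  have hbd : ∀ (R : ℝ) (z : SpaceTime n), 0 ≤ bulkWeight μ R 0 z * hardyDensity T 0 φ z :=
    fun R z => mul_nonneg (bulkWeight_nonneg le_rfl μ R z) (hd 0 le_rfl z)
  have hfz : ∀ z : SpaceTime n, 0 ≤ 2 * (1 + T)⁻¹ * hardyDensity T 1 φ z := fun z =>
    mul_nonneg (by positivity) (hd 1 zero_le_one z)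
  have first : ENNReal.ofReal ((1 + T) ^ (-(2 * μ))) * ∫⁻ z in openSlab n T,
      ENNReal.ofReal (rad z ^ (2 * μ - 1) * hardyDensity T 0 φ z) ≤ 6 * M := by
    have hm : AEMeasurable (fun z : SpaceTime n =>
        ENNReal.ofReal (rad z ^ (2 * μ - 1) * hardyDensity T 0 φ z))
        (volume.restrict (openSlab n T)) := ((mr _).mul (mh 0)).ennreal_ofReal
    rw [← lintegral_const_mul'' _ hm]
    calc ∫⁻ z in openSlab n T, ENNReal.ofReal ((1 + T) ^ (-(2 * μ)))
          * ENNReal.ofReal (rad z ^ (2 * μ - 1) * hardyDensity T 0 φ z)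
        ≤ ∫⁻ z in openSlab n T, (4 * ENNReal.ofReal (bulkWeight μ (1 + T) 0 z
            * hardyDensity T 0 φ z) + ENNReal.ofReal (2 * (1 + T)⁻¹ * hardyDensity T 1 φ z)) := by
          refine lintegral_mono fun z => ?_
          rw [← ENNReal.ofReal_mul (by positivity)]
          refine (ENNReal.ofReal_le_ofReal (first_weight_le hT hμ0 hμ1 φ)).trans ?_
          rw [ENNReal.ofReal_add (mul_nonneg (by norm_num) (hbd _ z)) (hfz z),
            ENNReal.ofReal_mul (by norm_num), ENNReal.ofReal_ofNat]
      _ = 4 * (∫⁻ z in openSlab n T, ENNReal.ofReal (bulkWeight μ (1 + T) 0 z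
            * hardyDensity T 0 φ z))
          + ∫⁻ z in openSlab n T, ENNReal.ofReal (2 * (1 + T)⁻¹ * hardyDensity T 1 φ z) := by
          have hm : AEMeasurable (fun z : SpaceTime n =>
              ENNReal.ofReal (bulkWeight μ (1 + T) 0 z * hardyDensity T 0 φ z))
              (volume.restrict (openSlab n T)) := ((mb (1 + T)).mul (mh 0)).ennreal_ofReal
          rw [← lintegral_const_mul'' _ hm]
          exact lintegral_add_left' (hm.const_mul _) _
      _ ≤ 4 * M + 2 * M := by
          gcongr
          exact hnear _ (by linarith)
      _ = 6 * M := by ring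
  obtain ⟨K, hK1, hK2⟩ := exists_dyadic_scale hT
  have second : ∫⁻ z in openSlab n T,
      ENNReal.ofReal (rad z ^ (2 * μ - 1) * jap z ^ (-(2 * μ)) * hardyDensity T 0 φ z)
      ≤ ((10 * (K + 1) + 2 : ℕ) : ℝ≥0∞) * M := by
    calc ∫⁻ z in openSlab n T,
          ENNReal.ofReal (rad z ^ (2 * μ - 1) * jap z ^ (-(2 * μ)) * hardyDensity T 0 φ z)
        ≤ ∫⁻ z in openSlab n T, (10 * (∑ k ∈ Finset.range (K + 1),
            ENNReal.ofReal (bulkWeight μ (2 ^ k) 0 z * hardyDensity T 0 φ z))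
            + ENNReal.ofReal (2 * (1 + T)⁻¹ * hardyDensity T 1 φ z)) := by
          refine lintegral_mono fun z => ?_
          refine (ENNReal.ofReal_le_ofReal (second_weight_le hT hμ0 hμ1 φ hK1)).trans ?_
          rw [ENNReal.ofReal_add (mul_nonneg (by norm_num) (Finset.sum_nonneg fun k _ => hbd _ z))
            (hfz z), ENNReal.ofReal_mul (by norm_num), ENNReal.ofReal_ofNat,
            ENNReal.ofReal_sum_of_nonneg fun k _ => hbd _ z]
      _ = 10 * (∑ k ∈ Finset.range (K + 1), ∫⁻ z in openSlab n T,
            ENNReal.ofReal (bulkWeight μ (2 ^ k) 0 z * hardyDensity T 0 φ z))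
          + ∫⁻ z in openSlab n T, ENNReal.ofReal (2 * (1 + T)⁻¹ * hardyDensity T 1 φ z) := by
          have hm : ∀ k ∈ Finset.range (K + 1), AEMeasurable (fun z : SpaceTime n =>
              ENNReal.ofReal (bulkWeight μ (2 ^ k) 0 z * hardyDensity T 0 φ z))
              (volume.restrict (openSlab n T)) := fun k _ =>
            ((mb (2 ^ k)).mul (mh 0)).ennreal_ofReal
          have hm' := Finset.aemeasurable_fun_sum _ hm
          rw [← lintegral_finsetSum' _ hm, ← lintegral_const_mul'' _ hm']
          exact lintegral_add_left' (hm'.const_mul _) _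
      _ ≤ 10 * (∑ _k ∈ Finset.range (K + 1), M) + 2 * M := by
          gcongr with k hk
          exact hnear _ (one_le_pow₀ one_le_two)
      _ = _ := by
          rw [Finset.sum_const, Finset.card_range, nsmul_eq_mul]
          push_cast
          ring
  have second' : ENNReal.ofReal ((Real.log (2 + T))⁻¹) * ∫⁻ z in openSlab n T,
      ENNReal.ofReal (rad z ^ (2 * μ - 1) * jap z ^ (-(2 * μ)) * hardyDensity T 0 φ z)
      ≤ 44 * M := by
    have hlog2 : 1 / 2 ≤ Real.log (2 + T) := by
      have h5 := Real.log_two_gt_d9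
      have h6 : Real.log 2 ≤ Real.log (2 + T) := Real.log_le_log (by norm_num) (by linarith)
      linarith
    have hcoef : ENNReal.ofReal ((Real.log (2 + T))⁻¹) * ((10 * (K + 1) + 2 : ℕ) : ℝ≥0∞) ≤ 44 := by
      rw [← ENNReal.ofReal_natCast, ← ENNReal.ofReal_mul (by positivity)]
      refine ENNReal.ofReal_le_of_le_toReal ?_
      rw [ENNReal.toReal_ofNat, inv_mul_le_iff₀ hlog]
      push_cast
      linarith
    calc _ ≤ ENNReal.ofReal ((Real.log (2 + T))⁻¹) * (((10 * (K + 1) + 2 : ℕ) : ℝ≥0∞) * M) := by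
          gcongr
      _ = ENNReal.ofReal ((Real.log (2 + T))⁻¹) * ((10 * (K + 1) + 2 : ℕ) : ℝ≥0∞) * M := by
          rw [mul_assoc]
      _ ≤ 44 * M := by gcongr
  calc _ ≤ 6 * M + 44 * M := add_le_add first second'
    _ = 50 * M := by ring

end KSSWave

end

theorem theorem2p1 (n : ℕ) (hn : 3 ≤ n) (μ : ℝ) (hμ0 : 0 < μ) (hμ1 : μ < 1 / 2) :
    ∃ C₁ : ℝ, 0 < C₁ ∧
      ∀ (T : ℝ), 0 < T →
      ∀ (h : Fin (n + 1) → Fin (n + 1) → KSSWave.SpaceTime n → ℝ)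
        (F φ : KSSWave.SpaceTime n → ℝ) (f g : KSSWave.Space n → ℝ),
        -- the coefficients: `C¹` on the closed slab, bounded with their first derivatives
        (∀ α β, ContDiffOn ℝ 1 (h α β) (KSSWave.closedSlab n T)) →
        (∃ M : ℝ, ∀ z ∈ KSSWave.closedSlab n T, ∀ α β,
          |h α β z| ≤ M ∧ ∀ γ, |KSSWave.pd T γ (h α β) z| ≤ M) →
        -- smallness and symmetry
        (∀ z ∈ KSSWave.closedSlab n T, ∑ α, ∑ β, |h α β z| ≤ 1 / 2) →
        (∀ z ∈ KSSWave.closedSlab n T, ∀ α β, h α β z = h β α z) →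
        -- the classical solution of the initial value problem
        ContDiffOn ℝ 2 φ (KSSWave.closedSlab n T) →
        (∀ z ∈ KSSWave.openSlab n T, KSSWave.waveOp T h φ z = F z) →
        (∀ x, φ (0, x) = f x) →
        (∀ x, KSSWave.pd T 0 φ (0, x) = g x) →
        KSSWave.MemH1 f →
        MemLp g 2 volume →
        -- finite energy and integrability
        KSSWave.ContinuousInH1 T φ →
        KSSWave.ContDiffInL2 T φ →
        IntegrableOn (KSSWave.forcing T μ φ F) (KSSWave.openSlab n T) volume →
        ENNReal.ofReal ((1 + T) ^ (-(2 * μ))) *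
            (KSSWave.sqNormSlab T
                (fun z : KSSWave.SpaceTime n => KSSWave.rad z ^ (-(3 / 2) + μ) * φ z)
              + KSSWave.sqNormSlab T
                (fun z : KSSWave.SpaceTime n =>
                  KSSWave.rad z ^ (-(1 / 2) + μ) * KSSWave.normD T φ z))
          + ENNReal.ofReal ((Real.log (2 + T))⁻¹) *
            (KSSWave.sqNormSlab T
                (fun z : KSSWave.SpaceTime n =>
                  KSSWave.rad z ^ (-(3 / 2) + μ) * KSSWave.jap z ^ (-μ) * φ z)
              + KSSWave.sqNormSlab T
                (fun z : KSSWave.SpaceTime n =>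
                  KSSWave.rad z ^ (-(1 / 2) + μ) * KSSWave.jap z ^ (-μ) * KSSWave.normD T φ z))
        ≤ ENNReal.ofReal C₁ *
            ((eLpNorm (gradient f) 2 volume) ^ 2 + (eLpNorm g 2 volume) ^ 2)
          + ENNReal.ofReal C₁ *
            ∫⁻ z in KSSWave.openSlab n T,
              ENNReal.ofReal (KSSWave.forcing T μ φ F z + KSSWave.perturbation T μ h φ z) := by
  have hc0 : 0 < μ * (1 - 2 * μ) := mul_pos hμ0 (by linarith)
  have hc1 : μ * (1 - 2 * μ) ≤ 1 := by nlinarith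
  -- The factor `5 = 1 + 4` adds Hardy's constant to the energy in the far zone.
  set C : ℝ := 5 * (4 * (28 * n + 1) * (n + 1) ^ 3) / (μ * (1 - 2 * μ)) with hC
  have hCpos : 0 < C := by positivity
  refine ⟨50 * C, by positivity, ?_⟩
  intro T hT h F φ f g hh _ hsmall hsymm hφ heq hf hg _ _ hH1 hL2 hforce
  have H : KSSWave.WaveSolution n T h F φ := ⟨hh, hsmall, hsymm, hφ, heq, hH1, hL2⟩
  have hnn : ∀ z, 0 ≤ KSSWave.forcing T μ φ F z + KSSWave.perturbation T μ h φ z := fun z =>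
    add_nonneg (KSSWave.forcing_nonneg T μ φ F z) (KSSWave.perturbation_nonneg T μ h φ z)
  -- If the right-hand integral is infinite there is nothing to prove.
  by_cases htop : ∫⁻ z in KSSWave.openSlab n T,
      ENNReal.ofReal (KSSWave.forcing T μ φ F z + KSSWave.perturbation T μ h φ z) = ⊤
  · rw [htop, ENNReal.mul_top (by simpa using (by positivity : 0 < 50 * C)), add_top]
    exact le_top
  have hB : IntegrableOn (fun z => KSSWave.forcing T μ φ F z + KSSWave.perturbation T μ h φ z)
      (KSSWave.openSlab n T) := by
    refine ⟨(hforce.aestronglyMeasurable.aemeasurable.add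
      (KSSWave.aemeasurable_perturbation hT μ hh H.contDiffOn_one)).aestronglyMeasurable, ?_⟩
    rw [hasFiniteIntegral_iff_ofReal (Filter.Eventually.of_forall hnn)]
    exact lt_top_iff_ne_top.2 htop
  have hE0 := KSSWave.energyAt_nonneg T φ 0
  have hI0 : 0 ≤ ∫ z in KSSWave.openSlab n T,
      (KSSWave.forcing T μ φ F z + KSSWave.perturbation T μ h φ z) := integral_nonneg hnn
  rw [← mul_add, ← H.ofReal_energyAt_zero hT hf hg,
    ← ofReal_integral_eq_lintegral_ofReal hB (Filter.Eventually.of_forall hnn),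
    ← ENNReal.ofReal_add hE0 hI0]
  set X : ℝ := KSSWave.energyAt T φ 0 + ∫ z in KSSWave.openSlab n T,
      (KSSWave.forcing T μ φ F z + KSSWave.perturbation T μ h φ z) with hX
  have hX0 : 0 ≤ X := add_nonneg hE0 hI0
  have hN : (0 : ℝ) ≤ 4 * (28 * n + 1) * (n + 1) ^ 3 := by positivity
  have hmain := KSSWave.weighted_norms_le (M := ENNReal.ofReal (C * X)) (by omega) hT hμ0 hμ1
    H.contDiffOn_one
    (fun R hR => (H.lintegral_bulk_le hn hT hμ0 hμ1 hR hB).trans (ENNReal.ofReal_le_ofReal (by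
      refine mul_le_mul_of_nonneg_right ?_ hX0
      rw [hC]
      exact div_le_div_of_nonneg_right (by linarith) hc0.le)))
    ((H.lintegral_hardyDensity_le hn hT hμ0 hμ1 hB).trans (by
      gcongr
      rw [hC, le_div_iff₀ hc0]
      exact mul_le_of_le_one_right (by linarith) hc1))
  refine hmain.trans (le_of_eq ?_)
  rw [← ENNReal.ofReal_mul (by positivity), mul_assoc, ENNReal.ofReal_mul (by norm_num : (0:ℝ) ≤ 50),
    ENNReal.ofReal_ofNat]
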